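/- For $n\ge 0$ let $M_n=\mathbb{CP}^2\# n\overline{\mathbb{CP}^2}$, with the basis $H,E_1,\dots,E_n$ of $H_2(M_n,\mathbb Z)$ in which the intersection form $Q$ is $\mathrm{diag}(1,-1,\dots,-1)$. Identify $\mathrm{Mod}(M_n)=\pi_0(\mathrm{Homeo}^+(M_n))$ with $\mathrm{Aut}(H_2(M_n,\mathbb Z),Q)=\mathrm O(1,n)(\mathbb Z)$ through its action on $H_2$. Let $W_n\le \mathrm{Mod}(M_n)$ be the stabilizer of $K=-3H+E_1+\dots+E_n$. For $3\le n\le 8$ a Coxeter element of $W_n$ is a product, in any order and each taken once, of the $n$ simple reflections, i.e. the reflections $x\mapsto x-\frac{2Q(x,v)}{Q(v,v)}v$ in the vectors $v=H-E_1-E_2-E_3$ and $v=E_i-E_{i+1}$, $1\le i\le n-1$. Call $g\in\mathrm{Mod}(M_n)$ reducible if there are a del Pezzo manifold $M$ (that is, $M=\mathbb{CP}^1\times\mathbb{CP}^1$ or $M=M_m$ with $0\le m\le 8$), an integer $k>0$, an isometry $\iota: H_2(M,\mathbb Z)\oplus H_2(\#k\overline{\mathbb{CP}^2},\mathbb Z)\to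 H_2(M_n,\mathbb Z)$ for the intersection forms, and isometries $g_1$ of $H_2(M,\mathbb Z)$ and $g_2$ of $H_2(\#k\overline{\mathbb{CP}^2},\mathbb Z)$ with $g=\iota\circ(g_1\oplus g_2)\circ\iota^{-1}$. Otherwise call $g$ irreducible. **Theorem.** 1. If $n=3$, $5$ or $7$, then $W_n$ has no irreducible element of odd prime order. 2. In $W_4$ there is exactly one conjugacy class of irreducible elements of odd prime order, and every Coxeter element of $W_4$ represents it. 3. In $W_6$ there is exactly one conjugacy class of irreducible elements of odd prime order, and $c^4$ represents it for every Coxeter element $c$ of $W_6$. 4. In $W_8$ there are exactly two conjugacy classes of irreducible elements of odd prime order, and for every Coxeter element $c$ of $W_8$ each of the two is represented by a power of $c$. -/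

import Mathlib

namespace DelPezzo

/-- The group `Aut(V, B)` of isometries of a lattice `(V, B)`. -/
def isometryGroup {V : Type*} [AddCommGroup V] (B : LinearMap.BilinForm ℤ V) :
    Subgroup (V ≃ₗ[ℤ] V) where
  carrier := {g | ∀ x y, B (g x) (g y) = B x y}
  one_mem' := fun _ _ => rfl
  mul_mem' := by
    intro a b ha hb x y
    exact (ha (b x) (b y)).trans (hb x y)
  inv_mem' := by
    intro a ha x y
    have h := ha (a⁻¹ x) (a⁻¹ y)
    have e : ∀ z, a (a⁻¹ z) = z := fun z => a.apply_symm_apply z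
    rw [e, e] at h
    exact h.symm

/-- The orthogonal direct sum `B₁ ⊕ B₂` of two bilinear forms. -/
def directSum {V W : Type*} [AddCommGroup V] [AddCommGroup W]
    (B₁ : LinearMap.BilinForm ℤ V) (B₂ : LinearMap.BilinForm ℤ W) :
    LinearMap.BilinForm ℤ (V × W) :=
  B₁.comp (LinearMap.fst ℤ V W) (LinearMap.fst ℤ V W) +
    B₂.comp (LinearMap.snd ℤ V W) (LinearMap.snd ℤ V W)

/-- `H₂(M_n, ℤ)`, where `M_n` is `ℂP²` blown up at `n` points, in the coordinates of the
basis `H, E₁, …, E_n` (coordinate `0` is that of `H`, coordinate `k` is that of `E_k`). -/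
abbrev H2 (n : ℕ) : Type := Fin (n + 1) → ℤ

/-- The Gram matrix `diag(1, -1, …, -1)` of the basis `H, E₁, …, E_n`. -/
def gram (n : ℕ) : Matrix (Fin (n + 1)) (Fin (n + 1)) ℤ :=
  Matrix.diagonal (fun i => if i = 0 then 1 else -1)

/-- The intersection form of `M_n`. -/
def form (n : ℕ) : LinearMap.BilinForm ℤ (H2 n) := Matrix.toBilin' (gram n)

/-- `Mod(M_n) = π₀(Homeo⁺(M_n))`, identified with `Aut(H₂(M_n, ℤ), Q) = O(1,n)(ℤ)` through
its action on `H₂`. -/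
abbrev MCG (n : ℕ) : Subgroup (H2 n ≃ₗ[ℤ] H2 n) := isometryGroup (form n)

/-- The del Pezzo manifolds: `blowup m` is `M_m` for `0 ≤ m ≤ 8` (with `M_0 = ℂP²`), and
`quadric` is `ℂP¹ × ℂP¹`. -/
inductive Manifold : Type where
  | blowup (m : Fin 9) : Manifold
  | quadric : Manifold

/-- The second Betti number. -/
def Manifold.rank : Manifold → ℕ
  | .blowup m => m.val + 1
  | .quadric => 2

/-- The Gram matrix of the intersection form: of `H, E₁, …, E_m` for `M_m`, and of the classes
of the two factors for `ℂP¹ × ℂP¹`. -/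
def Manifold.gram : (M : Manifold) → Matrix (Fin M.rank) (Fin M.rank) ℤ
  | .blowup m => DelPezzo.gram m.val
  | .quadric => (!![0, 1; 1, 0] : Matrix (Fin 2) (Fin 2) ℤ)

/-- The intersection form on `H₂(M, ℤ) = ℤ ^ rank M`. -/
def Manifold.form (M : Manifold) : LinearMap.BilinForm ℤ (Fin M.rank → ℤ) :=
  Matrix.toBilin' M.gram

/-- The intersection form `k⟨-1⟩` of the connected sum of `k` copies of `ℂP²` with the
reversed orientation. -/
def negForm (k : ℕ) : LinearMap.BilinForm ℤ (Fin k → ℤ) :=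
  Matrix.toBilin' (Matrix.diagonal (fun _ => -1))

/-- `g` is reducible if for some del Pezzo manifold `M`, some `k > 0` and some isometry `ι`
from `H₂(M) ⊕ H₂(#k -ℂP²)` to `H₂(M_n)`, it is the image `ι ∘ (g₁ ⊕ g₂) ∘ ι⁻¹` of a pair
`(g₁, g₂)` of isometries of the two summands. -/
def IsReducible {n : ℕ} (g : MCG n) : Prop :=
  ∃ (M : Manifold) (k : ℕ) (_ : 0 < k)
    (ι : ((Fin M.rank → ℤ) × (Fin k → ℤ)) ≃ₗ[ℤ] H2 n)
    (_ : ∀ x y, form n (ι x) (ι y) = directSum M.form (negForm k) x y)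
    (g₁ : isometryGroup M.form) (g₂ : isometryGroup (negForm k)),
    ∀ x y, g.1 (ι (x, y)) = ι (g₁.1 x, g₂.1 y)

/-- `g` is irreducible if it is not reducible. -/
def IsIrreducible {n : ℕ} (g : MCG n) : Prop := ¬ IsReducible g

/-- The canonical class `K = -3H + E₁ + … + E_n`. -/
def canonicalClass (n : ℕ) : H2 n := fun i => if i = 0 then -3 else 1

/-- The Weyl group `W_n`: the stabilizer of the canonical class in `Mod(M_n)`. -/
abbrev Weyl (n : ℕ) : Subgroup (MCG n) := MulAction.stabilizer (MCG n) (canonicalClass n)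

/-- For `0 ≤ k ≤ n`, the basis vector with index `k`: `H` for `k = 0` and `E_k` for `k ≥ 1`. -/
def basisVec (n k : ℕ) : H2 n := fun i => if i.val = k then 1 else 0

/-- The simple roots: `H - E₁ - E₂ - E₃` for `i = 0`, and `E_i - E_{i+1}` for `1 ≤ i ≤ n - 1`. -/
def simpleRoot (n : ℕ) (i : Fin n) : H2 n :=
  if i.val = 0 then basisVec n 0 - basisVec n 1 - basisVec n 2 - basisVec n 3
  else basisVec n i.val - basisVec n (i.val + 1)

theorem form_apply (n : ℕ) (x y : H2 n) :
    form n x y = ∑ i, (if i = 0 then 1 else -1) * (x i * y i) := by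
  simp only [form, gram, Matrix.toBilin'_apply, Matrix.diagonal_apply]
  refine Finset.sum_congr rfl fun i _ => ?_
  rw [Finset.sum_eq_single i]
  · simp only [if_true]; ring
  · intro j _ hj; simp [Ne.symm hj]
  · simp

theorem form_symm (n : ℕ) (x y : H2 n) : form n x y = form n y x := by
  simp only [form_apply, mul_comm]

theorem form_basisVec (n k : ℕ) (hk : k ≤ n) (x : H2 n) :
    form n x (basisVec n k) = (if k = 0 then 1 else -1) * x ⟨k, Nat.lt_succ_of_le hk⟩ := by
  rw [form_apply, Finset.sum_eq_single ⟨k, Nat.lt_succ_of_le hk⟩]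
  · simp [basisVec, Fin.ext_iff]
  · intro j _ hj
    have : j.val ≠ k := fun h => hj (Fin.ext h)
    simp [basisVec, this]
  · simp

theorem form_simpleRoot_self {n : ℕ} (hn : 3 ≤ n) (i : Fin n) :
    form n (simpleRoot n i) (simpleRoot n i) = -2 := by
  have hi := i.isLt
  unfold simpleRoot
  split_ifs with h
  · simp only [map_sub, LinearMap.sub_apply, form_basisVec n 0 (by omega),
      form_basisVec n 1 (by omega), form_basisVec n 2 (by omega), form_basisVec n 3 (by omega)]
    simp [basisVec]
  · simp only [map_sub, LinearMap.sub_apply, form_basisVec n i.val (by omega),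
      form_basisVec n (i.val + 1) (by omega)]
    simp [basisVec, h]

theorem form_canonicalClass_simpleRoot {n : ℕ} (hn : 3 ≤ n) (i : Fin n) :
    form n (canonicalClass n) (simpleRoot n i) = 0 := by
  have hi := i.isLt
  unfold simpleRoot
  split_ifs with h
  · simp only [map_sub]
    rw [form_basisVec n 0 (by omega), form_basisVec n 1 (by omega), form_basisVec n 2 (by omega),
      form_basisVec n 3 (by omega)]
    simp [canonicalClass, Fin.ext_iff]
  · simp only [map_sub]
    rw [form_basisVec n i.val (by omega), form_basisVec n (i.val + 1) (by omega)]
    simp [canonicalClass, h, Fin.ext_iff]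

/-- The reflection `x ↦ x - (2 Q(x,v) / Q(v,v)) v = x + Q(x,v) v` about a vector `v` with
`Q(v,v) = -2`, as a linear automorphism. -/
def reflection {n : ℕ} (v : H2 n) (hv : form n v v = -2) : H2 n ≃ₗ[ℤ] H2 n :=
  Module.reflection (x := v) (f := -(form n).flip v) (by simp [hv])

theorem reflection_apply {n : ℕ} (v : H2 n) (hv : form n v v = -2) (x : H2 n) :
    reflection v hv x = x + form n x v • v := by
  simp [reflection, Module.reflection_apply]

theorem reflection_mem {n : ℕ} (v : H2 n) (hv : form n v v = -2) :
    reflection v hv ∈ MCG n := by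
  intro x y
  simp only [reflection_apply, map_add, map_smul, LinearMap.add_apply, LinearMap.smul_apply,
    smul_eq_mul, hv, form_symm n v y]
  ring

/-- The simple reflections, as elements of the Weyl group. -/
def simpleReflection {n : ℕ} (hn : 3 ≤ n) (i : Fin n) : Weyl n :=
  ⟨⟨reflection (simpleRoot n i) (form_simpleRoot_self hn i), reflection_mem _ _⟩, by
    change reflection (simpleRoot n i) (form_simpleRoot_self hn i) (canonicalClass n) =
      canonicalClass n
    rw [reflection_apply, form_canonicalClass_simpleRoot hn, zero_smul, add_zero]⟩

/-- A Coxeter element of `W_n`: the product of the simple reflections, each taken once, in some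
order. -/
def IsCoxeterElement {n : ℕ} (hn : 3 ≤ n) (c : Weyl n) : Prop :=
  ∃ σ : Equiv.Perm (Fin n), c = (List.ofFn fun i => simpleReflection hn (σ i)).prod

/-- The irreducible elements of odd prime order in `W_n`. -/
def oddPrimeIrreducibles (n : ℕ) : Set (Weyl n) :=
  {w | (orderOf w).Prime ∧ Odd (orderOf w) ∧ IsIrreducible (w : MCG n)}

/-- The conjugacy classes of `W_n` that consist of irreducible elements of odd prime order. -/
def oddPrimeIrreducibleClasses (n : ℕ) : Set (ConjClasses (Weyl n)) :=
  ConjClasses.mk '' oddPrimeIrreducibles n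

end DelPezzo

namespace DelPezzo

/-! ### The intersection form -/

/-! Call an element of W_n elliptic if it fixes only multiples of K. In odd prime order p,
irreducible means elliptic (`mem_oddPrimeIrreducibles_iff`). A reducible element of odd order fixes
a class of negative square, namely an orbit sum in k⟨-1⟩, while multiples of K have nonnegative
square. Conversely, suppose w fixes a nonzero x in K^⊥. Adding a suitable multiple of K gives a
fixed class y that is nonnegative on all exceptional classes and zero on some e. Descent by
quadratic transformations shows y² ≥ 0, so y^⊥ is negative semidefinite; with p odd this makes
distinct members of the orbit of e orthogonal. They span a summand k⟨-1⟩ permuted by w, whose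
complement is a del Pezzo lattice (`exists_complement`, `isReducible_of_perm`).

For elliptic w the orbit sum of E_1 is a multiple of K, and pairing it with K gives (9 - n) ∣ p
(`IsElliptic.dvd`). This excludes n = 3, 5, 7 and forces p = 5 for n = 4 and p = 3 for n = 6. For n
= 8 it says nothing; there, counting the fixed vectors of w modulo 2 and modulo 3 leaves p = 3 or 5
(`IsElliptic.dvd_pow_sub`).

Uniqueness of the class comes from normal forms. For n = 4 a pentagon of exceptional classes, and
for n = 6 seven lines from three orbits, form a unimodular frame with a prescribed Gram matrix on
which w acts in a prescribed way (`isConj_four`, `isConj_six`). For n = 8, after conjugation, g = r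
h, where r is a Coxeter element of an A_2 or A_4 in K^⊥ and h is an elliptic element of W_6 or W_4
commuting with r; the smaller cases then apply (`isConj_of_splitting`).

Existence uses Coxeter elements. They are all conjugate because the Dynkin diagram is a forest
(`IsCoxeterElement.isConj`), and for one of them a single matrix identity on the orbit-sum operator
of a power certifies both its order and its ellipticity
(`mem_oddPrimeIrreducibles_of_smul_orbitSum`). -/

theorem form_eq (n : ℕ) (x y : H2 n) :
    form n x y = x 0 * y 0 - ∑ i : Fin n, x i.succ * y i.succ := by
  rw [form_apply, Fin.sum_univ_succ]
  simp [Fin.succ_ne_zero, sub_eq_add_neg]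

theorem form_canonicalClass (n : ℕ) (x : H2 n) :
    form n x (canonicalClass n) = -3 * x 0 - ∑ i : Fin n, x i.succ := by
  rw [form_eq]
  simp [canonicalClass, Fin.succ_ne_zero, mul_comm]

theorem form_canonicalClass_self (n : ℕ) :
    form n (canonicalClass n) (canonicalClass n) = 9 - n := by
  rw [form_canonicalClass]
  simp [canonicalClass, Fin.succ_ne_zero]

theorem canonicalClass_zero (n : ℕ) : canonicalClass n 0 = -3 := by simp [canonicalClass]

theorem canonicalClass_succ {n : ℕ} (i : Fin n) : canonicalClass n i.succ = 1 := by
  simp [canonicalClass, Fin.succ_ne_zero]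

theorem canonicalClass_ne_zero (n : ℕ) : canonicalClass n ≠ 0 := fun h => by
  have := congrFun h 0
  simp [canonicalClass] at this

/-- The class `E_{i+1}`. -/
def exc {n : ℕ} (i : Fin n) : H2 n := Pi.single i.succ 1

theorem form_single_zero {n : ℕ} (x : H2 n) : form n x (Pi.single 0 1) = x 0 := by
  rw [form_eq]; simp [Fin.succ_ne_zero]

theorem form_exc {n : ℕ} (x : H2 n) (i : Fin n) : form n x (exc i) = -x i.succ := by
  rw [form_eq]
  simp [exc, Pi.single_apply, (Fin.succ_ne_zero _).symm]

theorem sum_smul_self (n : ℕ) (x : H2 n) :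
    form n x x = x 0 ^ 2 - ∑ i : Fin n, x i.succ ^ 2 := by
  rw [form_eq]; simp [pow_two]

/-- Vectors orthogonal to a nonzero vector of nonnegative square have nonpositive square. -/
theorem form_self_nonpos_of_orthogonal {n : ℕ} {y z : H2 n} (hy : 0 ≤ form n y y) (hy0 : y ≠ 0)
    (hz : form n z y = 0) : form n z z ≤ 0 ∧ (form n z z = 0 → y 0 • z = z 0 • y) ∧ y 0 ≠ 0 := by
  have h0 : y 0 ≠ 0 := by
    intro h
    apply hy0
    rw [sum_smul_self, h] at hy
    have hs : ∑ i : Fin n, y i.succ ^ 2 = 0 :=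
      le_antisymm (by linarith) (Finset.sum_nonneg fun i _ => sq_nonneg _)
    rw [Finset.sum_eq_zero_iff_of_nonneg fun i _ => sq_nonneg _] at hs
    ext j
    refine Fin.cases h (fun i => ?_) j
    simpa using hs i (Finset.mem_univ i)
  -- This combination has no H-coordinate, so its square is nonpositive; since z·y = 0, its square
  -- is also y₀² z² + z₀² y².
  set w : H2 n := y 0 • z - z 0 • y with hw
  have hw0 : w 0 = 0 := by simp [hw, mul_comm]
  have hww : form n w w = y 0 ^ 2 * form n z z + z 0 ^ 2 * form n y y := by
    simp only [hw, map_sub, map_smul, LinearMap.sub_apply, LinearMap.smul_apply, smul_eq_mul,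
      form_symm n y z, hz]
    ring
  have hw2 : form n w w = - ∑ i : Fin n, w i.succ ^ 2 := by
    rw [sum_smul_self, hw0]; ring
  have hneg : 0 ≤ ∑ i : Fin n, w i.succ ^ 2 := Finset.sum_nonneg fun i _ => sq_nonneg _
  have hy2 : 0 < y 0 ^ 2 := by positivity
  have hp := mul_nonneg (sq_nonneg (z 0)) hy
  refine ⟨by nlinarith, fun hz0 => ?_, h0⟩
  rw [hz0] at hww
  have hs : ∑ i : Fin n, w i.succ ^ 2 = 0 := le_antisymm (by linarith) hneg
  rw [Finset.sum_eq_zero_iff_of_nonneg fun i _ => sq_nonneg _] at hs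
  have : w = 0 := by
    ext j
    refine Fin.cases hw0 (fun i => ?_) j
    simpa using hs i (Finset.mem_univ i)
  exact sub_eq_zero.1 this

/-- Since K² = 9 - n > 0 and the signature is (1, n), the complement of K is negative definite. -/
theorem form_self_neg_of_orthogonal_canonicalClass {n : ℕ} (hn : n ≤ 8) {x : H2 n}
    (hx : form n x (canonicalClass n) = 0) (hx0 : x ≠ 0) : form n x x < 0 := by
  have hK : (0 : ℤ) < 9 - n := by omega
  obtain ⟨h1, h2, -⟩ := form_self_nonpos_of_orthogonal
    (by rw [form_canonicalClass_self]; exact hK.le) (canonicalClass_ne_zero n) hx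
  refine lt_of_le_of_ne h1 fun h => hx0 ?_
  have h3 := h2 h
  have h4 := congrArg (fun v => form n v (canonicalClass n)) h3
  simp only [map_smul, LinearMap.smul_apply, hx, form_canonicalClass_self, smul_eq_mul,
    mul_zero] at h4
  have h5 : x 0 = 0 := by
    rcases mul_eq_zero.1 h4.symm with h | h
    · exact h
    · omega
  rw [h5, canonicalClass_zero, zero_smul] at h3
  exact (smul_eq_zero.1 h3).resolve_left (by norm_num)

/-! ### Exceptional classes -/

/-- Exceptional classes: `e² = K·e = -1`. -/
def IsExc {n : ℕ} (e : H2 n) : Prop := form n e e = -1 ∧ form n e (canonicalClass n) = -1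

theorem isExc_exc {n : ℕ} (i : Fin n) : IsExc (exc i) := by
  refine ⟨?_, ?_⟩
  · rw [form_exc]; simp [exc]
  · rw [form_symm, form_exc, canonicalClass_succ]

theorem form_exc_exc {n : ℕ} {i j : Fin n} (h : i ≠ j) : form n (exc i) (exc j) = 0 := by
  rw [form_exc]; simp [exc, h.symm]

/-- The difference e - f is a nonzero element of K^⊥, so -2 - 2 e·f < 0. -/
theorem IsExc.form_nonneg {n : ℕ} (hn : n ≤ 8) {e f : H2 n} (he : IsExc e) (hf : IsExc f)
    (h : e ≠ f) : 0 ≤ form n e f := by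
  have h1 := form_self_neg_of_orthogonal_canonicalClass hn (x := e - f)
    (by simp [he.2, hf.2]) (sub_ne_zero.2 h)
  simp only [map_sub, LinearMap.sub_apply, he.1, hf.1, form_symm n f e] at h1
  omega

/-- The class `H - E_{i+1} - E_{j+1}`. -/
theorem isExc_line {n : ℕ} {i j : Fin n} (h : i ≠ j) :
    IsExc (Pi.single 0 1 - exc i - exc j : H2 n) := by
  constructor
  · simp only [map_sub, LinearMap.sub_apply, form_single_zero, form_exc]
    simp [exc, h, h.symm, (Fin.succ_ne_zero _).symm]
  · rw [form_symm]
    simp [form_single_zero, form_exc, canonicalClass_succ, canonicalClass_zero]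

/-! ### The Weyl group -/

theorem weyl_form {n : ℕ} (w : Weyl n) (x y : H2 n) :
    form n (w.1.1 x) (w.1.1 y) = form n x y := w.1.2 x y

theorem weyl_canonicalClass {n : ℕ} (w : Weyl n) :
    w.1.1 (canonicalClass n) = canonicalClass n := w.2

theorem weyl_mul_apply {n : ℕ} (v w : Weyl n) (x : H2 n) :
    (v * w).1.1 x = v.1.1 (w.1.1 x) := rfl

theorem weyl_one_apply {n : ℕ} (x : H2 n) : (1 : Weyl n).1.1 x = x := rfl

theorem weyl_inv_apply_self {n : ℕ} (w : Weyl n) (x : H2 n) : (w⁻¹).1.1 (w.1.1 x) = x := by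
  rw [← weyl_mul_apply, inv_mul_cancel, weyl_one_apply]

theorem weyl_apply_inv_self {n : ℕ} (w : Weyl n) (x : H2 n) : w.1.1 ((w⁻¹).1.1 x) = x := by
  rw [← weyl_mul_apply, mul_inv_cancel, weyl_one_apply]

theorem weyl_ext {n : ℕ} {v w : Weyl n} (h : ∀ x, v.1.1 x = w.1.1 x) : v = w :=
  Subtype.ext (Subtype.ext (LinearEquiv.ext h))

theorem weyl_form_left {n : ℕ} (w : Weyl n) (x y : H2 n) :
    form n (w.1.1 x) y = form n x ((w⁻¹).1.1 y) := by
  rw [← weyl_form w x, weyl_apply_inv_self]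

theorem weyl_form_canonicalClass {n : ℕ} (w : Weyl n) (x : H2 n) :
    form n (w.1.1 x) (canonicalClass n) = form n x (canonicalClass n) := by
  conv_lhs => rw [← weyl_canonicalClass w]
  exact weyl_form w _ _

theorem IsExc.map {n : ℕ} {e : H2 n} (he : IsExc e) (w : Weyl n) : IsExc (w.1.1 e) :=
  ⟨by rw [weyl_form, he.1], by rw [weyl_form_canonicalClass, he.2]⟩

/-- An isometry fixing the canonical class, as an element of the Weyl group. -/
def mkWeyl {n : ℕ} (u : H2 n ≃ₗ[ℤ] H2 n) (hu : ∀ x y, form n (u x) (u y) = form n x y)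
    (hK : u (canonicalClass n) = canonicalClass n) : Weyl n := ⟨⟨u, hu⟩, hK⟩

/-- The reflection in a root, as an element of the Weyl group. -/
def rootReflection {n : ℕ} (v : H2 n) (hv : form n v v = -2)
    (hK : form n v (canonicalClass n) = 0) : Weyl n :=
  mkWeyl (reflection v hv) (reflection_mem v hv)
    (by rw [reflection_apply, form_symm, hK, zero_smul, add_zero])

theorem rootReflection_apply {n : ℕ} (v : H2 n) (hv : form n v v = -2)
    (hK : form n v (canonicalClass n) = 0) (x : H2 n) :
    (rootReflection v hv hK).1.1 x = x + form n x v • v := reflection_apply v hv x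

/-- The Weyl group acts transitively on `E_1, …, E_n`. -/
theorem exists_map_exc {n : ℕ} (i j : Fin n) : ∃ w : Weyl n, w.1.1 (exc i) = exc j := by
  by_cases h : i = j
  · exact ⟨1, by rw [h, weyl_one_apply]⟩
  have e1 := form_exc_exc h
  have e2 := form_exc_exc (Ne.symm h)
  refine ⟨rootReflection (exc i - exc j) ?_ ?_, ?_⟩
  · simp [(isExc_exc i).1, (isExc_exc j).1, e1, e2]
  · simp [(isExc_exc i).2, (isExc_exc j).2]
  · rw [rootReflection_apply]
    simp [(isExc_exc i).1, e1]

/-- The quadratic transformation centred at three distinct points lowers the degree of any class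
whose multiplicities at these points add up to more than its degree. -/
theorem exists_quadratic {n : ℕ} {i j k : Fin n} (hij : i ≠ j) (hik : i ≠ k) (hjk : j ≠ k) :
    ∃ w : Weyl n, ∀ x : H2 n,
      w.1.1 x 0 = 2 * x 0 + x i.succ + x j.succ + x k.succ := by
  have e1 := (isExc_line hij (n := n)).1
  have e2 := (isExc_line hij (n := n)).2
  have e3 : form n (Pi.single 0 1 - exc i - exc j) (exc k) = 0 := by
    rw [form_exc]
    simp [exc, hik.symm, hjk.symm, Fin.succ_ne_zero]
  refine ⟨rootReflection (Pi.single 0 1 - exc i - exc j - exc k) ?_ ?_, fun x => ?_⟩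
  · generalize (Pi.single 0 1 - exc i - exc j : H2 n) = l at e1 e3
    rw [map_sub, map_sub, LinearMap.sub_apply, LinearMap.sub_apply, e1, e3, form_symm n (exc k),
      e3, (isExc_exc k).1]
    norm_num
  · rw [map_sub, LinearMap.sub_apply, e2, (isExc_exc k).2]
    norm_num
  · rw [rootReflection_apply]
    simp only [map_sub, form_single_zero, form_exc]
    simp [exc, (Fin.succ_ne_zero _).symm]
    ring


/-! ### Reduction of classes by quadratic transformations -/

/-- Let a ≥ b ≥ c be the three largest multiplicities. The other n - 3 ≤ 5 are at most c, so the sum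
of squares is at most a² + b² + 6c² ≤ (a + b + c)² ≤ d². -/
theorem sum_sq_le_sq_of_reduced {n : ℕ} (hn3 : 3 ≤ n) (hn : n ≤ 8) {d : ℤ} {m : Fin n → ℤ}
    (hm : ∀ i, 0 ≤ m i)
    (h : ∀ i j k, i ≠ j → i ≠ k → j ≠ k → m i + m j + m k ≤ d) : ∑ i, m i ^ 2 ≤ d ^ 2 := by
  classical
  obtain ⟨i, -, hi⟩ := Finset.exists_max_image (Finset.univ : Finset (Fin n)) m
    ⟨⟨0, by omega⟩, Finset.mem_univ _⟩
  have c1 : (Finset.univ.erase i).card = n - 1 := by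
    rw [Finset.card_erase_of_mem (Finset.mem_univ _), Finset.card_univ, Fintype.card_fin]
  obtain ⟨j, hj', hj⟩ := Finset.exists_max_image (Finset.univ.erase i) m
    (Finset.card_pos.1 (by omega))
  have c2 : ((Finset.univ.erase i).erase j).card = n - 2 := by
    rw [Finset.card_erase_of_mem hj', c1]; omega
  obtain ⟨k, hk', hk⟩ := Finset.exists_max_image ((Finset.univ.erase i).erase j) m
    (Finset.card_pos.1 (by omega))
  have c3 : (((Finset.univ.erase i).erase j).erase k).card = n - 3 := by
    rw [Finset.card_erase_of_mem hk', c2]; omega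
  have hd := h i j k (Finset.ne_of_mem_erase hj').symm
    (Finset.ne_of_mem_erase (Finset.mem_of_mem_erase hk')).symm (Finset.ne_of_mem_erase hk').symm
  rw [← Finset.add_sum_erase _ _ (Finset.mem_univ i), ← Finset.add_sum_erase _ _ hj',
    ← Finset.add_sum_erase _ _ hk']
  have hr : ∑ l ∈ ((Finset.univ.erase i).erase j).erase k, m l ^ 2 ≤ (n - 3 : ℕ) • m k ^ 2 := by
    rw [← c3]
    exact Finset.sum_le_card_nsmul _ _ _ fun l hl =>
      pow_le_pow_left₀ (hm l) (hk l (Finset.mem_of_mem_erase hl)) 2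
  have hr2 : (n - 3 : ℕ) • m k ^ 2 ≤ 5 * m k ^ 2 := by
    rw [nsmul_eq_mul]
    exact mul_le_mul_of_nonneg_right (by norm_cast; omega) (sq_nonneg _)
  have hji := hi j (Finset.mem_univ j)
  have hkj := hj k (Finset.mem_of_mem_erase hk')
  have := hm i
  have := hm j
  have hk0 := hm k
  have h1 : (m i + m j + m k) ^ 2 ≤ d ^ 2 := pow_le_pow_left₀ (by positivity) hd 2
  nlinarith [mul_le_mul hji hkj hk0 (hm i), mul_nonneg (hm j) hk0, mul_le_mul_of_nonneg_right hkj hk0,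
    mul_le_mul_of_nonneg_right (hkj.trans hji) hk0]

/-- A class of negative square meeting all `E_i` nonnegatively can be lowered in degree. -/
theorem exists_degree_lt {n : ℕ} (hn3 : 3 ≤ n) (hn : n ≤ 8) {x : H2 n}
    (hx : ∀ i, 0 ≤ form n x (exc i)) (hneg : form n x x < 0) :
    ∃ w : Weyl n, w.1.1 x 0 < x 0 := by
  by_contra hcon
  push Not at hcon
  -- A quadratic transformation replaces the degree d by 2d - m_i - m_j - m_k. If none lowers it,
  -- the multiplicities satisfy the reducedness inequality, and x² ≥ 0.
  have := sum_sq_le_sq_of_reduced hn3 hn (d := x 0) (m := fun i => form n x (exc i)) hx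
    (fun i j k hij hik hjk => by
      obtain ⟨w, hw⟩ := exists_quadratic hij hik hjk
      have := hcon w
      rw [hw] at this
      simp only [form_exc]
      omega)
  rw [sum_smul_self] at hneg
  simp only [form_exc, neg_sq] at this
  omega

/-- Classes meeting every exceptional class nonnegatively. -/
def IsNef {n : ℕ} (x : H2 n) : Prop := ∀ e, IsExc e → 0 ≤ form n x e

theorem IsNef.map {n : ℕ} {x : H2 n} (hx : IsNef x) (w : Weyl n) : IsNef (w.1.1 x) :=
  fun e he => by rw [weyl_form_left]; exact hx _ (he.map _)

/-- Writing H as a sum of three exceptional classes bounds degrees from below: a class nonnegative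
on these three has degree at least 0. -/
theorem single_zero_eq {n : ℕ} (i j : Fin n) :
    (Pi.single 0 1 : H2 n) = (Pi.single 0 1 - exc i - exc j) + exc i + exc j := by abel

theorem IsNef.degree_nonneg {n : ℕ} (hn3 : 3 ≤ n) {x : H2 n} (hx : IsNef x) : 0 ≤ x 0 := by
  have h01 : (⟨0, by omega⟩ : Fin n) ≠ ⟨1, by omega⟩ := by simp
  rw [← form_single_zero x, single_zero_eq ⟨0, by omega⟩ ⟨1, by omega⟩, map_add, map_add]
  have := hx _ (isExc_line h01)
  have := hx _ (isExc_exc ⟨0, by omega⟩)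
  have := hx _ (isExc_exc ⟨1, by omega⟩)
  omega

/-- Descent on the degree: a nef class of negative square could be moved to one of smaller degree,
still nef and of the same square, but nef classes have degree at least 0. -/
theorem IsNef.form_self_nonneg {n : ℕ} (hn3 : 3 ≤ n) (hn : n ≤ 8) {x : H2 n} (hx : IsNef x) :
    0 ≤ form n x x := by
  generalize hd : (x 0).toNat = d
  induction d using Nat.strong_induction_on generalizing x with
  | _ d ih =>
    by_contra hneg
    obtain ⟨w, hw⟩ := exists_degree_lt hn3 hn (fun i => hx _ (isExc_exc i)) (not_le.1 hneg)
    have h1 := hx.degree_nonneg hn3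
    have h2 := (hx.map w).degree_nonneg hn3
    have := ih _ (by omega) (hx.map w) rfl
    rw [weyl_form] at this
    exact hneg this

theorem IsExc.degree_nonneg {n : ℕ} (hn3 : 3 ≤ n) (hn : n ≤ 8) {x : H2 n} (hx : IsExc x) :
    0 ≤ x 0 := by
  have h01 : (⟨0, by omega⟩ : Fin n) ≠ ⟨1, by omega⟩ := by simp
  by_cases h1 : x = exc ⟨0, by omega⟩
  · rw [h1]; simp [exc]
  by_cases h2 : x = exc ⟨1, by omega⟩
  · rw [h2]; simp [exc]
  by_cases h3 : x = Pi.single 0 1 - exc ⟨0, by omega⟩ - exc ⟨1, by omega⟩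
  · rw [h3]; simp [exc]
  rw [← form_single_zero x, single_zero_eq ⟨0, by omega⟩ ⟨1, by omega⟩, map_add, map_add]
  have := hx.form_nonneg hn (isExc_line h01) h3
  have := hx.form_nonneg hn (isExc_exc ⟨0, by omega⟩) h1
  have := hx.form_nonneg hn (isExc_exc ⟨1, by omega⟩) h2
  omega

/-- The Weyl group acts transitively on the exceptional classes. -/
theorem IsExc.exists_map_eq {n : ℕ} (hn3 : 3 ≤ n) (hn : n ≤ 8) {x : H2 n} (hx : IsExc x)
    (l : Fin n) : ∃ w : Weyl n, w.1.1 x = exc l := by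
  generalize hd : (x 0).toNat = d
  induction d using Nat.strong_induction_on generalizing x with
  | _ d ih =>
    by_cases hE : ∃ i, x = exc i
    · obtain ⟨i, rfl⟩ := hE
      exact exists_map_exc i l
    push Not at hE
    obtain ⟨w, hw⟩ := exists_degree_lt hn3 hn
      (fun i => hx.form_nonneg hn (isExc_exc i) (hE i)) (by rw [hx.1]; norm_num)
    have h1 := hx.degree_nonneg hn3 hn
    have h2 := (hx.map w).degree_nonneg hn3 hn
    obtain ⟨v, hv⟩ := ih _ (by omega) (hx.map w) rfl
    exact ⟨v * w, by rw [weyl_mul_apply, hv]⟩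

theorem not_isExc_zero (x : H2 0) : ¬ IsExc x := by
  rintro ⟨h, -⟩
  rw [form_eq] at h
  simp only [Finset.univ_eq_empty, Finset.sum_empty, sub_zero] at h
  nlinarith [mul_self_nonneg (x 0)]

theorem IsExc.eq_exc_one {x : H2 1} (hx : IsExc x) : x = exc 0 := by
  obtain ⟨h1, h2⟩ := hx
  rw [form_eq] at h1
  rw [form_canonicalClass] at h2
  simp only [Fin.sum_univ_succ, Finset.univ_eq_empty, Finset.sum_empty, add_zero] at h1 h2
  have e : x (Fin.succ 0) = 1 - 3 * x 0 := by omega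
  rw [e] at h1
  have h0 : x 0 = 0 := by
    have : x 0 * (3 - 4 * x 0) = 0 := by linarith
    rcases mul_eq_zero.1 this with h | h <;> omega
  ext j
  refine Fin.cases ?_ (fun i => ?_) j
  · simp [h0, exc]
  · rw [Subsingleton.elim i 0, e, h0]; simp [exc]

/-- Quadratic transformations need three centres, so the exceptional classes for n ≤ 2 are found by
solving the two defining equations directly. -/
theorem IsExc.cases_two {x : H2 2} (hx : IsExc x) :
    x = exc 0 ∨ x = exc 1 ∨ x = Pi.single 0 1 - exc 0 - exc 1 := by
  obtain ⟨h1, h2⟩ := hx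
  rw [form_eq] at h1
  rw [form_canonicalClass] at h2
  simp only [Fin.sum_univ_two] at h1 h2
  -- With a + b = 1 - 3d and a² + b² = d² + 1, the inequality (a + b)² ≤ 2(a² + b²) becomes (7d +
  -- 1)(d - 1) ≤ 0.
  have hd : x 0 = 0 ∨ x 0 = 1 := by
    have : 0 ≤ x 0 ∧ x 0 ≤ 1 := by
      constructor <;> nlinarith [sq_nonneg (x (Fin.succ 0) - x (Fin.succ 1))]
    omega
  have key : ∀ y : H2 2, x 0 = y 0 → x (Fin.succ 0) = y (Fin.succ 0) →
      x (Fin.succ 1) = y (Fin.succ 1) → x = y := by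
    intro y a b c
    ext j
    fin_cases j
    · exact a
    · exact b
    · exact c
  have e : x (Fin.succ 1) = 1 - 3 * x 0 - x (Fin.succ 0) := by omega
  rcases hd with hd | hd
  · rw [e, hd] at h1
    have : x (Fin.succ 0) * (x (Fin.succ 0) - 1) = 0 := by linarith
    rcases mul_eq_zero.1 this with h | h
    · right; left
      apply key <;> simp only [exc, hd, h, e] <;> simp
    · left
      have h' : x (Fin.succ 0) = 1 := by omega
      apply key <;> simp only [exc, hd, h', e] <;> simp
  · rw [e, hd] at h1
    right; right
    have : (x (Fin.succ 0) + 1) ^ 2 = 0 := by linarith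
    have h' : x (Fin.succ 0) = -1 := by
      have := pow_eq_zero_iff (two_ne_zero) |>.1 this
      omega
    apply key <;> simp only [exc, hd, h', e] <;> simp


/-! ### The lattice `H2 n` inside `H2 (n + 1)` -/

/-- Extension of a class by zero. -/
def extend {n : ℕ} (x : H2 n) : H2 (n + 1) := Fin.snoc (α := fun _ => ℤ) x 0

/-- Forgetting the last coordinate of a class. -/
def restrict {n : ℕ} (x : H2 (n + 1)) : H2 n := fun i => x i.castSucc

@[simp] theorem restrict_extend {n : ℕ} (x : H2 n) : restrict (extend x) = x := by
  ext i; simp [restrict, extend]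

theorem extend_last {n : ℕ} (x : H2 n) : extend x (Fin.last (n + 1)) = 0 := by simp [extend]

theorem form_restrict {n : ℕ} (x y : H2 (n + 1)) :
    form (n + 1) x y = form n (restrict x) (restrict y) -
      x (Fin.last (n + 1)) * y (Fin.last (n + 1)) := by
  have h : Fin.last (n + 1) ≠ 0 := by simp [Fin.ext_iff]
  rw [form_apply, Fin.sum_univ_castSucc, form_apply]
  simp [restrict, h, sub_eq_add_neg]

theorem form_extend_left {n : ℕ} (x : H2 n) (y : H2 (n + 1)) :
    form (n + 1) (extend x) y = form n x (restrict y) := by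
  rw [form_restrict, restrict_extend, extend_last]; ring

theorem form_extend {n : ℕ} (x y : H2 n) : form (n + 1) (extend x) (extend y) = form n x y := by
  rw [form_extend_left, restrict_extend]

theorem restrict_canonicalClass (n : ℕ) : restrict (canonicalClass (n + 1)) = canonicalClass n := by
  ext i
  refine Fin.cases ?_ (fun i => ?_) i <;> simp [restrict, canonicalClass, Fin.ext_iff]

theorem form_exc_last {n : ℕ} (x : H2 (n + 1)) :
    form (n + 1) x (exc (Fin.last n)) = - x (Fin.last (n + 1)) := by
  rw [form_exc, Fin.succ_last]

theorem extend_restrict {n : ℕ} {x : H2 (n + 1)} (hx : form (n + 1) x (exc (Fin.last n)) = 0) :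
    extend (restrict x) = x := by
  rw [form_exc_last, neg_eq_zero] at hx
  ext i
  refine Fin.lastCases ?_ (fun i => ?_) i
  · rw [extend_last, hx]
  · simp [extend, restrict]

theorem isExc_extend_iff {n : ℕ} {x : H2 n} : IsExc (extend x) ↔ IsExc x := by
  unfold IsExc
  rw [form_extend, form_extend_left, restrict_canonicalClass]

theorem extend_exc {n : ℕ} (i : Fin n) : extend (exc i) = exc i.castSucc := by
  ext j
  refine Fin.lastCases ?_ (fun j => ?_) j
  · rw [extend_last]
    simp [exc, Pi.single_apply, Fin.ext_iff]
    omega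
  · simp [extend, exc, Pi.single_apply, Fin.ext_iff]

theorem form_extend_exc_last {n : ℕ} (x : H2 n) :
    form (n + 1) (extend x) (exc (Fin.last n)) = 0 := by
  rw [form_exc_last, extend_last, neg_zero]

theorem extend_add {n : ℕ} (x y : H2 n) : extend (x + y) = extend x + extend y := by
  ext j
  refine Fin.lastCases ?_ (fun j => ?_) j <;> simp [extend]

theorem extend_smul {n : ℕ} (a : ℤ) (x : H2 n) : extend (a • x) = a • extend x := by
  ext j
  refine Fin.lastCases ?_ (fun j => ?_) j <;> simp [extend]

theorem restrict_add {n : ℕ} (x y : H2 (n + 1)) : restrict (x + y) = restrict x + restrict y := rfl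

theorem restrict_smul {n : ℕ} (a : ℤ) (x : H2 (n + 1)) : restrict (a • x) = a • restrict x := rfl

theorem eq_extend_add {n : ℕ} (x : H2 (n + 1)) :
    x = extend (restrict x) + x (Fin.last (n + 1)) • exc (Fin.last n) := by
  ext j
  refine Fin.lastCases ?_ (fun j => ?_) j
  · simp [extend, exc]
  · simp [extend, exc, restrict, Fin.ext_iff, Pi.single_apply]
    omega

theorem restrict_exc_last (n : ℕ) : restrict (exc (Fin.last n)) = 0 := by
  ext j
  simp [exc, restrict, Fin.ext_iff, Pi.single_apply]
  omega

theorem extend_zero (n : ℕ) : extend (0 : H2 n) = 0 := by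
  ext j
  refine Fin.lastCases ?_ (fun j => ?_) j <;> simp [extend]

theorem canonicalClass_succ_eq (n : ℕ) :
    canonicalClass (n + 1) = extend (canonicalClass n) + exc (Fin.last n) := by
  conv_lhs => rw [eq_extend_add (canonicalClass (n + 1)), restrict_canonicalClass]
  rw [← Fin.succ_last, canonicalClass_succ, one_smul]

/-- The linear endomorphism of `H2 (n + 1)` given by an endomorphism of `H2 n`, fixing the last
basis vector. -/
def liftLinear {n : ℕ} (u : H2 n →ₗ[ℤ] H2 n) : H2 (n + 1) →ₗ[ℤ] H2 (n + 1) where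
  toFun x := extend (u (restrict x)) + x (Fin.last (n + 1)) • exc (Fin.last n)
  map_add' x y := by
    simp only [restrict_add, map_add, extend_add, Pi.add_apply, add_smul]; abel
  map_smul' a x := by
    simp only [restrict_smul, map_smul, extend_smul, Pi.smul_apply, smul_add, smul_smul, smul_eq_mul,
      RingHom.id_apply]

theorem liftLinear_apply {n : ℕ} (u : H2 n →ₗ[ℤ] H2 n) (x : H2 (n + 1)) :
    liftLinear u x = extend (u (restrict x)) + x (Fin.last (n + 1)) • exc (Fin.last n) := rfl

theorem restrict_liftLinear {n : ℕ} (u : H2 n →ₗ[ℤ] H2 n) (x : H2 (n + 1)) :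
    restrict (liftLinear u x) = u (restrict x) := by
  rw [liftLinear_apply, restrict_add, restrict_extend, restrict_smul, restrict_exc_last, smul_zero,
    add_zero]

theorem liftLinear_last {n : ℕ} (u : H2 n →ₗ[ℤ] H2 n) (x : H2 (n + 1)) :
    liftLinear u x (Fin.last (n + 1)) = x (Fin.last (n + 1)) := by
  rw [liftLinear_apply, Pi.add_apply, extend_last]
  simp [exc]

theorem liftLinear_liftLinear {n : ℕ} (u v : H2 n →ₗ[ℤ] H2 n) (x : H2 (n + 1)) :
    liftLinear u (liftLinear v x) = liftLinear (u ∘ₗ v) x := by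
  rw [liftLinear_apply u, restrict_liftLinear, liftLinear_last]; rfl

theorem liftLinear_id {n : ℕ} (x : H2 (n + 1)) : liftLinear LinearMap.id x = x :=
  (eq_extend_add x).symm

/-- The inclusion of the Weyl group `W_n` into `W_{n+1}` as a stabilizer of the last
exceptional class. -/
def lift {n : ℕ} : Weyl n →* Weyl (n + 1) where
  toFun w := mkWeyl
    (LinearEquiv.ofLinearMap (liftLinear w.1.1.toLinearMap) (liftLinear w⁻¹.1.1.toLinearMap)
      (LinearMap.ext fun x => by
        rw [LinearMap.comp_apply, liftLinear_liftLinear, show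
          w.1.1.toLinearMap ∘ₗ w⁻¹.1.1.toLinearMap = LinearMap.id from
            LinearMap.ext (weyl_apply_inv_self w), liftLinear_id]; rfl)
      (LinearMap.ext fun x => by
        rw [LinearMap.comp_apply, liftLinear_liftLinear, show
          w⁻¹.1.1.toLinearMap ∘ₗ w.1.1.toLinearMap = LinearMap.id from
            LinearMap.ext (weyl_inv_apply_self w), liftLinear_id]; rfl))
    (fun x y => by
      rw [LinearEquiv.coe_ofLinearMap, form_restrict,
        restrict_liftLinear, restrict_liftLinear, liftLinear_last, liftLinear_last,
        form_restrict x y]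
      exact congrArg (· - _) (weyl_form w _ _))
    (by
      rw [LinearEquiv.coe_ofLinearMap, liftLinear_apply, restrict_canonicalClass]
      have h : w.1.1.toLinearMap (canonicalClass n) = canonicalClass n := weyl_canonicalClass w
      rw [h, ← restrict_canonicalClass, ← eq_extend_add])
  map_one' := weyl_ext fun x => liftLinear_id x
  map_mul' v w := weyl_ext fun x =>
    (liftLinear_liftLinear v.1.1.toLinearMap w.1.1.toLinearMap x).symm

theorem lift_apply {n : ℕ} (w : Weyl n) (x : H2 (n + 1)) :
    (lift w).1.1 x = extend (w.1.1 (restrict x)) + x (Fin.last (n + 1)) • exc (Fin.last n) := rfl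

theorem lift_extend {n : ℕ} (w : Weyl n) (x : H2 n) :
    (lift w).1.1 (extend x) = extend (w.1.1 x) := by
  rw [lift_apply, restrict_extend, extend_last, zero_smul, add_zero]

theorem lift_exc_last {n : ℕ} (w : Weyl n) :
    (lift w).1.1 (exc (Fin.last n)) = exc (Fin.last n) := by
  rw [lift_apply, restrict_exc_last, map_zero, extend_zero, zero_add]
  simp [exc]

theorem extend_injective {n : ℕ} : Function.Injective (extend (n := n)) :=
  Function.LeftInverse.injective restrict_extend

theorem extend_restrict_map {n : ℕ} (w : Weyl (n + 1))
    (hw : w.1.1 (exc (Fin.last n)) = exc (Fin.last n)) (x : H2 n) :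
    extend (restrict (w.1.1 (extend x))) = w.1.1 (extend x) := by
  refine extend_restrict ?_
  rw [← hw, weyl_form, form_extend_exc_last]

/-- An element of `W_{n+1}` fixing the last exceptional class comes from `W_n`. -/
theorem exists_lift_eq {n : ℕ} (w : Weyl (n + 1))
    (hw : w.1.1 (exc (Fin.last n)) = exc (Fin.last n)) : ∃ v : Weyl n, lift v = w := by
  have hw' : w⁻¹.1.1 (exc (Fin.last n)) = exc (Fin.last n) := by
    conv_lhs => rw [← hw]
    exact weyl_inv_apply_self w _
  let R : Weyl (n + 1) → H2 n →ₗ[ℤ] H2 n := fun w =>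
    { toFun := fun x => restrict (w.1.1 (extend x))
      map_add' := fun x y => by rw [extend_add, map_add, restrict_add]
      map_smul' := fun a x => by rw [extend_smul, map_smul, restrict_smul]; rfl }
  have hR : ∀ w x, R w x = restrict (w.1.1 (extend x)) := fun _ _ => rfl
  refine ⟨mkWeyl (LinearEquiv.ofLinearMap (R w) (R w⁻¹) (LinearMap.ext fun x => ?_)
    (LinearMap.ext fun x => ?_)) (fun x y => ?_) ?_, weyl_ext fun x => ?_⟩
  · rw [LinearMap.comp_apply, hR, hR, extend_restrict_map _ hw', weyl_apply_inv_self,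
      restrict_extend]; rfl
  · rw [LinearMap.comp_apply, hR, hR, extend_restrict_map _ hw, weyl_inv_apply_self,
      restrict_extend]; rfl
  · rw [LinearEquiv.coe_ofLinearMap, hR, hR, ← form_extend,
      extend_restrict_map _ hw, extend_restrict_map _ hw, weyl_form, form_extend]
  · rw [LinearEquiv.coe_ofLinearMap, hR]
    have h := weyl_canonicalClass w
    rw [canonicalClass_succ_eq, map_add, hw, add_left_inj] at h
    rw [h, restrict_extend]
  · rw [lift_apply]
    change extend (restrict (w.1.1 (extend (restrict x)))) + _ = _
    rw [extend_restrict_map _ hw]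
    conv_rhs => rw [eq_extend_add x, map_add, map_smul, hw]

/-! ### Unimodular frames -/

theorem det_gram (n : ℕ) : (gram n).det = (-1) ^ n := by
  rw [gram, Matrix.det_diagonal, Fin.prod_univ_succ]
  simp [Fin.succ_ne_zero]

/-- The Gram matrix of v is V·gram·Vᵗ, so det V divides a unit. -/
theorem exists_basis_of_isUnit_det {n : ℕ} {ι : Type*} [Fintype ι] [DecidableEq ι]
    (hι : Fintype.card ι = n + 1) (v : ι → H2 n)
    (hv : IsUnit (Matrix.of fun i j => form n (v i) (v j)).det) :
    ∃ b : Module.Basis ι ℤ (H2 n), ∀ i, b i = v i := by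
  let e : ι ≃ Fin (n + 1) := Fintype.equivFinOfCardEq hι
  let V : Matrix (Fin (n + 1)) (Fin (n + 1)) ℤ := Matrix.of fun i j => v (e.symm i) j
  have hG : (Matrix.of fun i j => form n (v i) (v j)).submatrix e.symm e.symm =
      V * gram n * V.transpose := by
    ext i j
    rw [Matrix.mul_apply]
    simp only [Matrix.submatrix_apply, Matrix.of_apply, form_apply, gram,
      Matrix.mul_diagonal, Matrix.transpose_apply, V]
    exact Finset.sum_congr rfl fun _ _ => by ring
  have hu : IsUnit V.det := by
    rw [← Matrix.det_submatrix_equiv_self e.symm, hG, Matrix.det_mul, Matrix.det_mul] at hv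
    exact isUnit_of_mul_isUnit_right (by rwa [Matrix.det_transpose] at hv)
  have hb := (Module.Basis.is_basis_iff_det (Pi.basisFun ℤ (Fin (n + 1)))
    (v := fun i => v (e.symm i))).2 (by rw [Pi.basisFun_det]; exact hu)
  exact ⟨(Module.Basis.mk hb.1 hb.2.ge).reindex e.symm, fun i => by simp⟩


/-! ### Reducibility -/

/-- The exception is H - E_1 - E_2 on M_2, recorded here through its products with the basis. It is
the source of ℂP¹ × ℂP¹ among the complements. -/
theorem isExc_or_two {m : ℕ} (hm : m + 1 ≤ 8) {x : H2 (m + 1)} (hx : IsExc x) :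
    (∃ w : Weyl (m + 1), w.1.1 x = exc (Fin.last m)) ∨
      m = 1 ∧ form (m + 1) x (Pi.single 0 1) = 1 ∧ ∀ i, form (m + 1) x (exc i) = 1 := by
  match m, hm, x, hx with
  | 0, _, x, hx => exact Or.inl ⟨1, by rw [weyl_one_apply, hx.eq_exc_one]; rfl⟩
  | 1, _, x, hx =>
    rcases hx.cases_two with h | h | h
    · left; rw [h]; exact exists_map_exc _ _
    · left; rw [h]; exact exists_map_exc _ _
    · right
      refine ⟨rfl, ?_, fun i => ?_⟩
      · rw [form_single_zero, h]; simp [exc]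
      · rw [form_exc, h]
        fin_cases i <;> simp [exc]
  | k + 2, hm, x, hx => exact Or.inl (hx.exists_map_eq (by omega) hm _)

theorem det_manifold_gram (M : Manifold) : IsUnit M.gram.det := by
  cases M with
  | blowup m =>
    change IsUnit (gram m.val).det
    rw [det_gram]
    exact (isUnit_one.neg).pow _
  | quadric =>
    change IsUnit (Matrix.det !![0, 1; 1, 0])
    rw [Matrix.det_fin_two_of]
    norm_num

theorem form_single (n : ℕ) (i j : Fin (n + 1)) :
    form n (Pi.single i 1) (Pi.single j 1) = gram n i j := by
  rw [form, Matrix.toBilin'_single]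

/-- The classes H - E_1 and H - E_2 are those of the two rulings of the quadric obtained by
contracting H - E_1 - E_2. -/
theorem form_ruling (i j : Fin 2) :
    form 2 (Pi.single 0 1 - exc i) (Pi.single 0 1 - exc j) =
      (!![0, 1; 1, 0] : Matrix (Fin 2) (Fin 2) ℤ) i j := by
  simp only [map_sub, LinearMap.sub_apply, form_single_zero, form_exc]
  fin_cases i <;> fin_cases j <;> simp [exc]

/-- The orthogonal complement of a tuple of orthogonal exceptional classes is the lattice of a
del Pezzo manifold. -/
theorem exists_complement (k : ℕ) : ∀ (n : ℕ), n ≤ 8 → ∀ e : Fin k → H2 n, (∀ i, IsExc (e i)) →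
    (∀ i j, i ≠ j → form n (e i) (e j) = 0) →
    ∃ (M : Manifold) (b : Fin M.rank → H2 n),
      (∀ i j, form n (b i) (b j) = M.gram i j) ∧ (∀ i j, form n (b i) (e j) = 0) ∧
      M.rank + k = n + 1 := by
  induction k with
  | zero =>
    intro n hn e _ _
    refine ⟨.blowup ⟨n, by omega⟩, fun i => Pi.single (i : Fin (n + 1)) 1, fun i j => ?_,
      fun _ j => j.elim0, rfl⟩
    exact form_single n i j
  | succ k ih =>
    intro n hn e he ho
    cases n with
    | zero => exact (not_isExc_zero _ (he 0)).elim
    | succ m =>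
    rcases isExc_or_two hn (he 0) with ⟨w, hw⟩ | ⟨hm, h0, h1⟩
    -- Once the first class has been moved to the last E_i, the others are orthogonal to it and live
    -- on one blow-up fewer.
    · have hr : ∀ i : Fin k, extend (restrict (w.1.1 (e i.succ))) = w.1.1 (e i.succ) := fun i =>
        extend_restrict (by rw [← hw, weyl_form]; exact ho _ _ (Fin.succ_ne_zero i))
      obtain ⟨M, b, hb1, hb2, hb3⟩ := ih m (by omega) (fun i => restrict (w.1.1 (e i.succ)))
        (fun i => by rw [← isExc_extend_iff, hr]; exact (he _).map w)
        (fun i j hij => by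
          rw [← form_extend, hr, hr, weyl_form]
          exact ho _ _ (fun h => hij (Fin.succ_injective _ h)))
      refine ⟨M, fun i => w⁻¹.1.1 (extend (b i)), fun i j => ?_, fun i j => ?_, by omega⟩
      · rw [weyl_form, form_extend, hb1]
      · rw [weyl_form_left, inv_inv]
        refine Fin.cases ?_ (fun j => ?_) j
        · rw [hw, form_extend_exc_last]
        · rw [← hr, form_extend, hb2]
    · subst hm
      -- No exceptional class of M_2 is orthogonal to H - E_1 - E_2: its products with the three of
      -- them are 1, 1 and -1.
      have hk : k = 0 := by
        by_contra hk
        obtain ⟨l, rfl⟩ := Nat.exists_eq_succ_of_ne_zero hk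
        have h01 := ho 0 1 (by simp)
        rcases (he 1).cases_two with h | h | h
        · rw [h, h1] at h01; omega
        · rw [h, h1] at h01; omega
        · rw [h, map_sub, map_sub, h0, h1, h1] at h01; omega
      subst hk
      refine ⟨.quadric, fun i => Pi.single 0 1 - exc (i : Fin 2), fun i j => ?_, fun i j => ?_, rfl⟩
      · exact form_ruling i j
      · have key : ∀ i : Fin 2, form (1 + 1) (e 0) (Pi.single 0 1 - exc i) = 0 := fun i => by
          rw [map_sub, h0, h1, sub_self]
        rw [show j = 0 from Fin.ext (by omega)]
        exact (form_symm _ _ _).trans (key i)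

theorem toBilin'_apply_sum {m : ℕ} (G : Matrix (Fin m) (Fin m) ℤ) (x y : Fin m → ℤ) :
    Matrix.toBilin' G x y = ∑ i, ∑ j, x i * G i j * y j := by
  rw [Matrix.toBilin'_apply]

/-- A linear automorphism of a product such that it and its inverse preserve both factors. -/
theorem exists_prod_equiv {V W : Type*} [AddCommGroup V] [AddCommGroup W]
    (A : (V × W) ≃ₗ[ℤ] (V × W)) (h1 : ∀ x, (A (x, 0)).2 = 0) (h2 : ∀ y, (A (0, y)).1 = 0)
    (h3 : ∀ x, (A.symm (x, 0)).2 = 0) (h4 : ∀ y, (A.symm (0, y)).1 = 0) :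
    ∃ (g₁ : V ≃ₗ[ℤ] V) (g₂ : W ≃ₗ[ℤ] W), ∀ x y, A (x, y) = (g₁ x, g₂ y) := by
  have a1 : ∀ x, A (x, 0) = ((A (x, 0)).1, 0) := fun x => Prod.ext rfl (h1 x)
  have a2 : ∀ y, A (0, y) = (0, (A (0, y)).2) := fun y => Prod.ext (h2 y) rfl
  have a3 : ∀ x, A.symm (x, 0) = ((A.symm (x, 0)).1, 0) := fun x => Prod.ext rfl (h3 x)
  have a4 : ∀ y, A.symm (0, y) = (0, (A.symm (0, y)).2) := fun y => Prod.ext (h4 y) rfl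
  refine ⟨LinearEquiv.ofLinearMap
    (LinearMap.fst ℤ V W ∘ₗ A.toLinearMap ∘ₗ LinearMap.inl ℤ V W)
    (LinearMap.fst ℤ V W ∘ₗ A.symm.toLinearMap ∘ₗ LinearMap.inl ℤ V W)
    (LinearMap.ext fun x => ?_) (LinearMap.ext fun x => ?_),
    LinearEquiv.ofLinearMap
    (LinearMap.snd ℤ V W ∘ₗ A.toLinearMap ∘ₗ LinearMap.inr ℤ V W)
    (LinearMap.snd ℤ V W ∘ₗ A.symm.toLinearMap ∘ₗ LinearMap.inr ℤ V W)
    (LinearMap.ext fun y => ?_) (LinearMap.ext fun y => ?_), fun x y => ?_⟩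
  · change (A ((A.symm (x, 0)).1, 0)).1 = x
    rw [← a3, A.apply_symm_apply]
  · change (A.symm ((A (x, 0)).1, 0)).1 = x
    rw [← a1, A.symm_apply_apply]
  · change (A (0, (A.symm (0, y)).2)).2 = y
    rw [← a4, A.apply_symm_apply]
  · change (A.symm (0, (A (0, y)).2)).2 = y
    rw [← a2, A.symm_apply_apply]
  · change A (x, y) = ((A (x, 0)).1, (A (0, y)).2)
    have : ((x, y) : V × W) = (x, 0) + (0, y) := by simp
    rw [this, map_add, a1, a2]
    simp

theorem directSum_apply {V W : Type*} [AddCommGroup V] [AddCommGroup W]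
    (B₁ : LinearMap.BilinForm ℤ V) (B₂ : LinearMap.BilinForm ℤ W) (x y : V × W) :
    directSum B₁ B₂ x y = B₁ x.1 y.1 + B₂ x.2 y.2 := rfl

theorem negForm_apply (k : ℕ) (x y : Fin k → ℤ) : negForm k x y = - ∑ i, x i * y i := by
  rw [negForm, Matrix.toBilin'_apply, ← Finset.sum_neg_distrib]
  refine Finset.sum_congr rfl fun i _ => ?_
  rw [Finset.sum_eq_single i]
  · simp
  · intro j _ hj; simp [Matrix.diagonal_apply_ne _ hj.symm]
  · simp

/-- An isometry permuting a nonempty tuple of orthogonal exceptional classes is reducible. -/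
theorem isReducible_of_perm {n : ℕ} (hn : n ≤ 8) {k : ℕ} (hk : 0 < k) (e : Fin k → H2 n)
    (he : ∀ i, IsExc (e i)) (ho : ∀ i j, i ≠ j → form n (e i) (e j) = 0) (g : MCG n)
    (π : Equiv.Perm (Fin k)) (hg : ∀ i, g.1 (e i) = e (π i)) : IsReducible g := by
  classical
  obtain ⟨M, b, hb1, hb2, hb3⟩ := exists_complement k n hn e he ho
  have hee : ∀ i j, form n (e i) (e j) = if i = j then -1 else 0 := by
    intro i j
    split_ifs with h
    · rw [h, (he j).1]
    · exact ho i j h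
  -- The joint Gram matrix is block diagonal with unimodular blocks, so the complement and the span
  -- of the e_i fill the whole lattice.
  obtain ⟨B, hB⟩ := exists_basis_of_isUnit_det (n := n) (ι := Fin M.rank ⊕ Fin k)
    (by rw [Fintype.card_sum, Fintype.card_fin, Fintype.card_fin, hb3]) (Sum.elim b e) (by
      have : (Matrix.of fun i j => form n (Sum.elim b e i) (Sum.elim b e j)) =
          Matrix.fromBlocks M.gram 0 0 (Matrix.diagonal fun _ => -1) := by
        ext i j
        rcases i with i | i <;> rcases j with j | j
        · exact hb1 i j
        · exact hb2 i j
        · exact (form_symm n _ _).trans (hb2 j i)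
        · simp [hee, Matrix.diagonal_apply]
      rw [this, Matrix.det_fromBlocks_zero₂₁, Matrix.det_diagonal, Finset.prod_const]
      exact (det_manifold_gram M).mul ((isUnit_one.neg).pow _))
  let ι : ((Fin M.rank → ℤ) × (Fin k → ℤ)) ≃ₗ[ℤ] H2 n :=
    (LinearEquiv.sumArrowLequivProdArrow (Fin M.rank) (Fin k) ℤ ℤ).symm.trans B.equivFun.symm
  have hι : ∀ x y, ι (x, y) = ∑ i, x i • b i + ∑ j, y j • e j := by
    intro x y
    change B.equivFun.symm _ = _
    rw [Module.Basis.equivFun_symm_apply, Fintype.sum_sum_type]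
    simp [hB]
  have hιe : ∀ x y i, form n (ι (x, y)) (e i) = - y i := by
    intro x y i
    simp only [hι, map_add, LinearMap.add_apply, map_sum, LinearMap.sum_apply, map_smul,
      LinearMap.smul_apply, hb2, hee, smul_eq_mul]
    simp
  have hform : ∀ x y, form n (ι x) (ι y) = directSum M.form (negForm k) x y := by
    rintro ⟨x, y⟩ ⟨x', y'⟩
    have hbe : ∀ i j, form n (e i) (b j) = 0 := fun i j => (form_symm n _ _).trans (hb2 j i)
    rw [directSum_apply, negForm_apply, Manifold.form, toBilin'_apply_sum, hι, hι]
    simp only [map_add, map_sum, map_smul, LinearMap.add_apply, LinearMap.sum_apply,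
      LinearMap.smul_apply, hb1, hb2, hbe, hee, smul_eq_mul]
    simp only [mul_zero, Finset.sum_const_zero, add_zero, zero_add, mul_ite, mul_neg, mul_one]
    congr 1
    · rw [Finset.sum_comm]
      refine Finset.sum_congr rfl fun _ _ => ?_
      rw [Finset.mul_sum]
      exact Finset.sum_congr rfl fun _ _ => by ring
    · simp [mul_comm]
  have hzero : ∀ z, (∀ i, form n z (e i) = 0) → (ι.symm z).2 = 0 := by
    intro z hz
    ext i
    have := hz i
    rw [← ι.apply_symm_apply z] at this
    rw [hιe _ (ι.symm z).2] at this
    simpa using this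
  have hspan : ∀ y : Fin k → ℤ, (ι.symm (∑ j, y j • e j)).1 = 0 := by
    intro y
    have : ∑ j, y j • e j = ι (0, y) := by simp [hι]
    rw [this, ι.symm_apply_apply]
  have hg' : ∀ i, g.1.symm (e i) = e (π.symm i) := by
    intro i
    rw [LinearEquiv.symm_apply_eq, hg, Equiv.apply_symm_apply]
  have hperm : ∀ (u : H2 n ≃ₗ[ℤ] H2 n) (σ : Equiv.Perm (Fin k)), (∀ i, u (e i) = e (σ i)) →
      ∀ y, (ι.symm (u (ι (0, y)))).1 = 0 := by
    intro u σ hu y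
    have : u (ι (0, y)) = ∑ j, y (σ.symm j) • e j := by
      rw [hι]
      simp only [Pi.zero_apply, zero_smul, Finset.sum_const_zero, zero_add, map_sum, map_smul, hu]
      exact Fintype.sum_equiv σ _ _ fun i => by simp
    rw [this, hspan]
  have hperp : ∀ (u : H2 n ≃ₗ[ℤ] H2 n), (∀ x y, form n (u x) (u y) = form n x y) →
      ∀ σ : Equiv.Perm (Fin k), (∀ i, u (e i) = e (σ i)) →
      ∀ x, (ι.symm (u (ι (x, 0)))).2 = 0 := by
    intro u huf σ hu x
    refine hzero _ fun i => ?_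
    have : e i = u (e (σ.symm i)) := by rw [hu, Equiv.apply_symm_apply]
    rw [this, huf, hιe]
    simp
  have hgi : ∀ x y, form n (g.1.symm x) (g.1.symm y) = form n x y := fun x y => by
    rw [← g.2, LinearEquiv.apply_symm_apply, LinearEquiv.apply_symm_apply]
  obtain ⟨g₁, g₂, h⟩ := exists_prod_equiv ((ι.trans g.1).trans ι.symm)
    (hperp g.1 g.2 π hg) (hperm g.1 π hg) (hperp g.1.symm hgi π.symm hg')
    (hperm g.1.symm π.symm hg')
  have h' : ∀ x y, g.1 (ι (x, y)) = ι (g₁ x, g₂ y) := fun x y => by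
    rw [← h]; simp
  have hsum : ∀ x y x' y', M.form (g₁ x) (g₁ x') + negForm k (g₂ y) (g₂ y') =
      M.form x x' + negForm k y y' := by
    intro x y x' y'
    have := hform (g₁ x, g₂ y) (g₁ x', g₂ y')
    rw [← h', ← h', g.2, hform, directSum_apply, directSum_apply] at this
    exact this.symm
  refine ⟨M, k, hk, ι, hform, ⟨g₁, fun x y => ?_⟩, ⟨g₂, fun x y => ?_⟩, h'⟩
  · simpa using hsum x 0 y 0
  · simpa using hsum 0 x 0 y

/-- A reducible isometry of odd finite order fixes a class of negative square. -/
theorem IsReducible.exists_fixed {n : ℕ} {g : MCG n} (hg : IsReducible g) {p : ℕ} (hp : Odd p)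
    (hgp : g ^ p = 1) : ∃ x, g.1 x = x ∧ form n x x < 0 := by
  obtain ⟨M, k, hk, ι, hι, g₁, g₂, h⟩ := hg
  have h0 : ∀ y, g.1 (ι (0, y)) = ι (0, g₂.1 y) := fun y => by rw [h, map_zero]
  have hpow : ∀ (i : ℕ) y, (g ^ i).1 (ι (0, y)) = ι (0, (g₂ ^ i).1 y) := by
    intro i
    induction i with
    | zero => intro y; rfl
    | succ i ih => intro y; rw [pow_succ, pow_succ]; exact (congrArg _ (h0 y)).trans (ih _)
  have hg₂ : g₂ ^ p = 1 := by
    refine Subtype.ext (LinearEquiv.ext fun y => ?_)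
    have := hpow p y
    rw [hgp] at this
    have h2 := ι.injective this
    exact (congrArg Prod.snd h2).symm
  obtain ⟨m, hm⟩ := hp
  set b : Fin k → ℤ := Pi.single ⟨0, hk⟩ 1 with hb
  have hbb : negForm k b b = -1 := by rw [negForm_apply]; simp [hb, Pi.single_apply]
  have hneg : ∀ y : Fin k → ℤ, y ≠ 0 → negForm k y y < 0 := by
    intro y hy
    rw [negForm_apply, neg_lt_zero]
    refine lt_of_le_of_ne (Finset.sum_nonneg fun i _ => mul_self_nonneg _) fun hs => hy ?_
    rw [eq_comm, Finset.sum_eq_zero_iff_of_nonneg fun i _ => mul_self_nonneg _] at hs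
    ext i
    simpa using hs i (Finset.mem_univ i)
  have hsymm : ∀ x y, negForm k x y = negForm k y x := fun x y => by
    simp only [negForm_apply, mul_comm]
  -- A positive product would give (g₂^i b + b)² ≥ 0, hence g₂^i b = -b by definiteness. Since g₂^p
  -- = 1 with p odd, raising g₂^i to the power p would give b = -b.
  have hle : ∀ i : ℕ, negForm k ((g₂ ^ i).1 b) b ≤ 0 := by
    intro i
    by_contra hcon
    have hne : (g₂ ^ i).1 b + b = 0 := by
      by_contra hne
      have := hneg _ hne
      simp only [map_add, LinearMap.add_apply, (g₂ ^ i).2 b b, hbb,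
        hsymm b] at this
      omega
    have hi : (g₂ ^ i).1 b = -b := eq_neg_of_add_eq_zero_left hne
    have hodd : ∀ j : ℕ, ((g₂ ^ i) ^ (2 * j + 1)).1 b = -b := by
      intro j
      induction j with
      | zero => simpa using hi
      | succ j ih =>
        have : (g₂ ^ i) ^ (2 * (j + 1) + 1) = (g₂ ^ i) * (g₂ ^ i) * (g₂ ^ i) ^ (2 * j + 1) := by
          rw [← pow_two, ← pow_add]; congr 1; omega
        rw [this]
        change (g₂ ^ i).1 ((g₂ ^ i).1 (((g₂ ^ i) ^ (2 * j + 1)).1 b)) = -b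
        rw [ih, map_neg, hi, neg_neg, hi]
    have h1 := hodd m
    rw [← hm, ← pow_mul, mul_comm, pow_mul, hg₂, one_pow] at h1
    have h2 : b = -b := h1
    have h3 := congrFun h2 ⟨0, hk⟩
    simp [hb] at h3
  set N : Fin k → ℤ := ∑ i ∈ Finset.range p, (g₂ ^ i).1 b with hN
  -- The term i = 0 contributes -1 and no other term is positive, so the orbit sum N cannot vanish.
  have hNb : negForm k N b < 0 := by
    rw [hN, map_sum, LinearMap.sum_apply, hm, Finset.sum_range_succ']
    have h1 : negForm k ((g₂ ^ 0).1 b) b = -1 := hbb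
    rw [h1]
    have := Finset.sum_nonpos fun i (_ : i ∈ Finset.range (2 * m)) => hle (i + 1)
    omega
  have hN0 : N ≠ 0 := by
    intro h0
    rw [h0, map_zero, LinearMap.zero_apply] at hNb
    exact lt_irrefl _ hNb
  have hNfix : g₂.1 N = N := by
    have h1 : g₂.1 N = ∑ i ∈ Finset.range p, (g₂ ^ (i + 1)).1 b := by
      rw [hN, map_sum]
      refine Finset.sum_congr rfl fun i _ => ?_
      rw [pow_succ']; rfl
    have h2 := Finset.sum_range_succ' (fun i => (g₂ ^ i).1 b) p
    rw [Finset.sum_range_succ, hg₂, pow_zero, add_left_inj] at h2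
    rw [h1, ← h2]
  refine ⟨ι (0, N), by rw [h0, hNfix], ?_⟩
  rw [hι, directSum_apply]
  change M.form 0 0 + negForm k N N < 0
  rw [map_zero, zero_add]
  exact hneg N hN0


/-! ### Elliptic elements -/

/-- An element of the Weyl group is elliptic if it fixes no classes but multiples of `K`. -/
def IsElliptic {n : ℕ} (w : Weyl n) : Prop :=
  ∀ x, w.1.1 x = x → ∃ a : ℤ, x = a • canonicalClass n

theorem weyl_pow_succ_apply {n : ℕ} (w : Weyl n) (i : ℕ) (x : H2 n) :
    (w ^ (i + 1)).1.1 x = w.1.1 ((w ^ i).1.1 x) := by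
  rw [pow_succ', weyl_mul_apply]

theorem weyl_pow_add_apply {n : ℕ} (w : Weyl n) (i j : ℕ) (x : H2 n) :
    (w ^ (i + j)).1.1 x = (w ^ i).1.1 ((w ^ j).1.1 x) := by
  rw [pow_add, weyl_mul_apply]

theorem weyl_pow_mul_fixed {n : ℕ} {w : Weyl n} {j : ℕ} {x : H2 n} (h : (w ^ j).1.1 x = x)
    (k : ℕ) : (w ^ (j * k)).1.1 x = x := by
  induction k with
  | zero => rfl
  | succ k ih => rw [Nat.mul_succ, weyl_pow_add_apply, h, ih]

theorem weyl_pow_fixed {n : ℕ} {w : Weyl n} {x : H2 n} (h : w.1.1 x = x)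
    (k : ℕ) : (w ^ k).1.1 x = x := by
  have := weyl_pow_mul_fixed (w := w) (j := 1) (by rwa [pow_one]) k
  rwa [one_mul] at this

/-- If `w ^ p = 1` with `p` prime, a class fixed by `w ^ j` with `p ∤ j` is fixed by `w`. -/
theorem weyl_fixed_of_pow_fixed {n : ℕ} {w : Weyl n} {p : ℕ} (hp : p.Prime) (hw : w ^ p = 1)
    {j : ℕ} (hj : ¬ p ∣ j) {x : H2 n} (h : (w ^ j).1.1 x = x) : w.1.1 x = x := by
  obtain ⟨k, hk⟩ := Nat.exists_mul_mod_eq_one_of_coprime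
    (((Nat.Prime.coprime_iff_not_dvd hp).2 hj).symm) hp.one_lt
  have h1 := weyl_pow_mul_fixed h k
  have h2 : w ^ (j * k) = w := by
    rw [← Nat.mod_add_div (j * k) p, hk.2, pow_add, pow_mul, hw, one_pow, mul_one, pow_one]
  rwa [h2] at h1

/-- The sum of an orbit of an element of order dividing `p`. -/
def orbitSum {n : ℕ} (w : Weyl n) (p : ℕ) (x : H2 n) : H2 n :=
  ∑ i ∈ Finset.range p, (w ^ i).1.1 x

theorem map_orbitSum {n : ℕ} {w : Weyl n} {p : ℕ} (hw : w ^ p = 1) (x : H2 n) :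
    w.1.1 (orbitSum w p x) = orbitSum w p x := by
  have h1 : w.1.1 (orbitSum w p x) = ∑ i ∈ Finset.range p, (w ^ (i + 1)).1.1 x := by
    rw [orbitSum, map_sum]
    exact Finset.sum_congr rfl fun i _ => (weyl_pow_succ_apply w i x).symm
  have h2 := Finset.sum_range_succ' (fun i => (w ^ i).1.1 x) p
  rw [Finset.sum_range_succ, hw, pow_zero, add_left_inj] at h2
  rw [h1, ← h2, orbitSum]

theorem orbitSum_of_fixed {n : ℕ} {w : Weyl n} (p : ℕ) {x : H2 n} (hx : w.1.1 x = x) :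
    orbitSum w p x = (p : ℤ) • x := by
  rw [orbitSum, Finset.sum_congr rfl fun i _ => weyl_pow_fixed hx i, Finset.sum_const,
    Finset.card_range, natCast_zsmul]

theorem form_orbitSum_canonicalClass {n : ℕ} (w : Weyl n) (p : ℕ) (x : H2 n) :
    form n (orbitSum w p x) (canonicalClass n) = p * form n x (canonicalClass n) := by
  rw [orbitSum, map_sum, LinearMap.sum_apply,
    Finset.sum_congr rfl fun i _ => weyl_form_canonicalClass (w ^ i) x, Finset.sum_const,
    Finset.card_range, nsmul_eq_mul]

/-- The orbit sum is fixed, hence a multiple of K; pairing with K determines the multiple. -/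
theorem IsElliptic.orbitSum_eq {n : ℕ} {w : Weyl n} (he : IsElliptic w) {p : ℕ} (hw : w ^ p = 1)
    (x : H2 n) : ∃ a : ℤ, orbitSum w p x = a • canonicalClass n ∧
      p * form n x (canonicalClass n) = a * (9 - n) := by
  obtain ⟨a, ha⟩ := he _ (map_orbitSum hw x)
  refine ⟨a, ha, ?_⟩
  rw [← form_orbitSum_canonicalClass w, ha, map_smul, LinearMap.smul_apply,
    form_canonicalClass_self, smul_eq_mul]

theorem IsElliptic.isIrreducible {n : ℕ} (hn : n ≤ 8) {w : Weyl n} (he : IsElliptic w) {p : ℕ}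
    (hp : Odd p) (hw : w ^ p = 1) : IsIrreducible (w : MCG n) := by
  intro hr
  obtain ⟨x, hx, hneg⟩ := hr.exists_fixed hp (by rw [← Subgroup.coe_pow, hw]; rfl)
  obtain ⟨a, rfl⟩ := he x hx
  rw [map_smul, map_smul, LinearMap.smul_apply, form_canonicalClass_self, smul_eq_mul,
    smul_eq_mul] at hneg
  have : (0 : ℤ) ≤ 9 - n := by omega
  nlinarith [mul_nonneg (mul_self_nonneg a) this]

/-- The products of a class orthogonal to `K` with the exceptional classes attain a minimum. -/
theorem exists_min_form {n : ℕ} (hn3 : 3 ≤ n) (hn : n ≤ 8) {x : H2 n}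
    (hx : form n x (canonicalClass n) = 0) :
    ∃ e, IsExc e ∧ ∀ f, IsExc f → form n x e ≤ form n x f := by
  have hbdd : ∀ z : ℤ, (∃ f, IsExc f ∧ form n x f = z) →
      -(form n x x).natAbs - 100 ≤ z := by
    rintro z ⟨f, hf, rfl⟩
    -- The class (9 - n)f + K is the projection of f to K^⊥, scaled by 9 - n, and has square -(9 -
    -- n)(10 - n). Definiteness of K^⊥ then bounds x·f from below; 100 is a generous allowance for
    -- the constant.
    have h0 : form n (x - ((9 - n : ℤ) • f + canonicalClass n)) (canonicalClass n) = 0 := by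
      simp only [map_add, map_sub, map_smul, LinearMap.sub_apply, LinearMap.add_apply,
        LinearMap.smul_apply, hx, hf.2,
        form_canonicalClass_self, smul_eq_mul]
      ring
    have h1 : form n (x - ((9 - n : ℤ) • f + canonicalClass n))
        (x - ((9 - n : ℤ) • f + canonicalClass n)) ≤ 0 := by
      by_cases h : x - ((9 - n : ℤ) • f + canonicalClass n) = 0
      · rw [h]; simp
      · exact (form_self_neg_of_orthogonal_canonicalClass hn h0 h).le
    simp only [map_add, map_sub, map_smul, LinearMap.sub_apply, LinearMap.add_apply,
      LinearMap.smul_apply, hx, hf.2, hf.1,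
      form_canonicalClass_self, smul_eq_mul, form_symm n f x, form_symm n (canonicalClass n)] at h1
    have hd : -(form n x x) ≤ (form n x x).natAbs := by omega
    have hs : (0 : ℤ) ≤ (form n x x).natAbs := Int.natCast_nonneg _
    generalize form n x f = t at *
    generalize ((form n x x).natAbs : ℤ) = s at *
    interval_cases n <;> norm_num at h1 <;> omega
  obtain ⟨z, ⟨e, he, rfl⟩, hz⟩ := Int.exists_least_of_bdd
    (P := fun z => ∃ f, IsExc f ∧ form n x f = z) ⟨_, hbdd⟩ ⟨_, exc ⟨0, by omega⟩, isExc_exc _, rfl⟩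
  exact ⟨e, he, fun f hf => hz _ ⟨f, hf, rfl⟩⟩

/-- A non-elliptic element of odd prime order is reducible. -/
theorem isReducible_of_not_isElliptic {n : ℕ} (hn3 : 3 ≤ n) (hn : n ≤ 8) {w : Weyl n} {p : ℕ}
    (hp : p.Prime) (hodd : Odd p) (hw : w ^ p = 1) (he : ¬ IsElliptic w) :
    IsReducible (w : MCG n) := by
  have hK : (0 : ℤ) < 9 - n := by omega
  unfold IsElliptic at he
  push Not at he
  obtain ⟨x₀, hx₀, hne⟩ := he
  -- This is the scaled projection of x₀ to K^⊥; it is still fixed, and nonzero because x₀ is not a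
  -- multiple of K.
  set x : H2 n := (9 - n : ℤ) • x₀ - form n x₀ (canonicalClass n) • canonicalClass n with hxdef
  have hwx : w.1.1 x = x := by
    rw [hxdef, map_sub, map_smul, map_smul, hx₀, weyl_canonicalClass]
  have hxK : form n x (canonicalClass n) = 0 := by
    rw [hxdef]
    simp only [map_sub, map_smul, LinearMap.sub_apply, LinearMap.smul_apply,
      form_canonicalClass_self, smul_eq_mul]
    ring
  have hx0 : x ≠ 0 := by
    intro h
    have h1 : (9 - n : ℤ) • x₀ = form n x₀ (canonicalClass n) • canonicalClass n :=
      sub_eq_zero.1 h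
    have h2 := congrFun h1 (Fin.succ ⟨0, by omega⟩)
    rw [Pi.smul_apply, Pi.smul_apply, canonicalClass_succ, smul_eq_mul, smul_eq_mul, mul_one] at h2
    rw [← h2, mul_smul] at h1
    exact hne _ (smul_right_injective _ hK.ne' h1)
  have hneg := form_self_neg_of_orthogonal_canonicalClass hn hxK hx0
  obtain ⟨e, hexc, hmin⟩ := exists_min_form hn3 hn hxK
  set m := form n x e with hm
  -- Exceptional classes have product -1 with K, so adding mK lowers every product by m: y is nef,
  -- and y·e = 0.
  obtain ⟨y, hy⟩ : ∃ y : H2 n, y = x + m • canonicalClass n := ⟨_, rfl⟩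
  have hyf : ∀ f, IsExc f → form n y f = form n x f - m := by
    intro f hf
    rw [hy, map_add, LinearMap.add_apply, map_smul, LinearMap.smul_apply,
      form_symm n (canonicalClass n), hf.2, smul_eq_mul]
    ring
  have hnef : IsNef y := fun f hf => by
    rw [hyf f hf]; exact sub_nonneg.2 (hmin f hf)
  have hyy := hnef.form_self_nonneg hn3 hn
  have hy0 : y ≠ 0 := by
    intro h
    have h1 : form n y y = form n x x + m ^ 2 * (9 - n) := by
      rw [hy]
      simp only [map_add, map_smul, LinearMap.add_apply, LinearMap.smul_apply, hxK,
        form_symm n (canonicalClass n) x, form_canonicalClass_self, smul_eq_mul]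
      ring
    have h2 : form n y (canonicalClass n) = m * (9 - n) := by
      rw [hy]
      simp only [map_add, map_smul, LinearMap.add_apply, LinearMap.smul_apply, hxK,
        form_canonicalClass_self, smul_eq_mul, zero_add]
    rw [h, map_zero, LinearMap.zero_apply, zero_eq_mul] at h2
    rw [h2.resolve_right hK.ne', h, map_zero] at h1
    linarith
  have hwy : w.1.1 y = y := by rw [hy, map_add, map_smul, hwx, weyl_canonicalClass]
  have hye : ∀ i : ℕ, form n ((w ^ i).1.1 e) y = 0 := by
    intro i
    have h := weyl_form (w ^ i) e y
    rw [weyl_pow_fixed hwy] at h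
    rw [h, form_symm, hyf e hexc, sub_self]
  by_cases hfix : w.1.1 e = e
  · refine isReducible_of_perm hn Nat.one_pos (fun _ => e) (fun _ => hexc) (fun i j hij => ?_)
      (w : MCG n) 1 (fun _ => hfix)
    exact (hij (Subsingleton.elim i j)).elim
  have hpos : 0 < p := hp.pos
  have hmod : ∀ i : ℕ, w ^ (i % p) = w ^ i := fun i => by
    conv_rhs => rw [← Nat.mod_add_div i p, pow_add, pow_mul, hw, one_pow, mul_one]
  -- The class e + w^j e lies in y^⊥, so its square -2 + 2 e·w^j e is at most 0. If e·w^j e were 1,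
  -- it would be isotropic, hence proportional to y and fixed by w. Then w^(2j) e = e, and as p is
  -- odd w would fix e.
  have horth : ∀ j : ℕ, ¬ p ∣ j → form n e ((w ^ j).1.1 e) = 0 := by
    intro j hj
    have hne : e ≠ (w ^ j).1.1 e := fun h => hfix (weyl_fixed_of_pow_fixed hp hw hj h.symm)
    have h0 := hexc.form_nonneg hn (hexc.map (w ^ j)) hne
    obtain ⟨h1, h2, h3⟩ := form_self_nonpos_of_orthogonal hyy hy0
      (z := e + (w ^ j).1.1 e) (by
        have := hye 0
        rw [pow_zero, weyl_one_apply] at this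
        rw [map_add, LinearMap.add_apply, this, hye, add_zero])
    have h4 : form n (e + (w ^ j).1.1 e) (e + (w ^ j).1.1 e) =
        -2 + 2 * form n e ((w ^ j).1.1 e) := by
      simp only [map_add, LinearMap.add_apply, hexc.1, (hexc.map (w ^ j)).1,
        form_symm n ((w ^ j).1.1 e) e]
      ring
    by_contra hcon
    have h5 := h2 (by omega)
    have h6 : w.1.1 (e + (w ^ j).1.1 e) = e + (w ^ j).1.1 e := by
      apply smul_right_injective _ h3
      change y 0 • w.1.1 _ = y 0 • _
      rw [← map_smul, h5, map_smul, hwy]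
    have h7 := weyl_pow_fixed h6 j
    rw [map_add, ← weyl_pow_add_apply, add_comm e, add_right_inj] at h7
    refine hfix (weyl_fixed_of_pow_fixed hp hw (j := j + j) (fun hd => ?_) h7)
    rw [← two_mul] at hd
    rcases hp.dvd_mul.1 hd with h | h
    · have := Nat.le_of_dvd (by norm_num) h
      have := hp.two_le
      obtain rfl : p = 2 := by omega
      exact absurd hodd (by decide)
    · exact hj h
  have horth' : ∀ i j : Fin p, i ≠ j → form n ((w ^ i.val).1.1 e) ((w ^ j.val).1.1 e) = 0 := by
    have key : ∀ i j : Fin p, i < j → form n ((w ^ i.val).1.1 e) ((w ^ j.val).1.1 e) = 0 := by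
      intro i j hij
      have hij' : i.val < j.val := hij
      obtain ⟨d, hd⟩ := Nat.exists_eq_add_of_lt hij'
      rw [hd, add_assoc, weyl_pow_add_apply, weyl_form]
      refine horth _ fun h => ?_
      have := Nat.le_of_dvd (Nat.succ_pos d) h
      have := j.isLt
      omega
    intro i j hij
    rcases lt_or_gt_of_ne hij with h | h
    · exact key i j h
    · rw [form_symm]; exact key j i h
  have : NeZero p := ⟨hpos.ne'⟩
  refine isReducible_of_perm hn hpos (fun i => (w ^ i.val).1.1 e) (fun i => hexc.map _) horth'
    (w : MCG n) (finRotate p) (fun i => ?_)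
  obtain ⟨q, rfl⟩ : ∃ q, p = q + 1 := ⟨p - 1, by omega⟩
  rw [← weyl_pow_succ_apply, finRotate_apply, Fin.val_add, hmod]
  rw [pow_add, pow_add, Fin.val_one', hmod]

theorem mem_oddPrimeIrreducibles_iff {n : ℕ} (hn3 : 3 ≤ n) (hn : n ≤ 8) {w : Weyl n} :
    w ∈ oddPrimeIrreducibles n ↔ (orderOf w).Prime ∧ Odd (orderOf w) ∧ IsElliptic w := by
  refine and_congr_right fun hp => and_congr_right fun ho => ⟨fun h => ?_, fun h => ?_⟩
  · by_contra he
    exact h (isReducible_of_not_isElliptic hn3 hn hp ho (pow_orderOf_eq_one w) he)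
  · exact h.isIrreducible hn ho (pow_orderOf_eq_one w)

/-- Pairing the orbit sum aK of E_1 with K gives -p = a(9 - n). -/
theorem IsElliptic.dvd {n : ℕ} (hn : 1 ≤ n) {w : Weyl n} (he : IsElliptic w) {p : ℕ}
    (hw : w ^ p = 1) : (9 - n : ℤ) ∣ p := by
  obtain ⟨a, -, ha⟩ := he.orbitSum_eq hw (exc ⟨0, hn⟩)
  rw [(isExc_exc _).2] at ha
  exact ⟨-a, by linarith⟩

/-- Rationally, the orbit sum is p times the projection to the line of K. This identity
characterises ellipticity together with w^p = 1; see `IsElliptic.of_smul_orbitSum` and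
`pow_eq_one_of_smul_orbitSum`. -/
theorem IsElliptic.smul_orbitSum {n : ℕ} {w : Weyl n} (he : IsElliptic w) {p : ℕ} (hw : w ^ p = 1)
    (x : H2 n) : (9 - n : ℤ) • orbitSum w p x =
      (p * form n x (canonicalClass n)) • canonicalClass n := by
  obtain ⟨a, h1, h2⟩ := he.orbitSum_eq hw x
  rw [h1, h2, smul_smul, mul_comm]


/-! ### Conjugacy of elliptic elements -/

/-- Two frames with the same unimodular Gram matrix differ by an isometry u; the matrix G' only
witnesses invertibility. What remains for a conjugation is that u fixes K and intertwines w and w'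
on the frame, and the second check may use the first. -/
theorem isConj_of_frames {n : ℕ} {ι : Type*} [Fintype ι] [DecidableEq ι]
    (hι : Fintype.card ι = n + 1) {w w' : Weyl n} (v v' : ι → H2 n) (G G' : Matrix ι ι ℤ)
    (hv : ∀ i j, form n (v i) (v j) = G i j) (hv' : ∀ i j, form n (v' i) (v' j) = G i j)
    (hG : G * G' = 1)
    (hu : ∀ u : H2 n →ₗ[ℤ] H2 n, (∀ i, u (v i) = v' i) →
      u (canonicalClass n) = canonicalClass n ∧
      (u (canonicalClass n) = canonicalClass n → ∀ i, u (w.1.1 (v i)) = w'.1.1 (v' i))) :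
    IsConj w w' := by
  have hdet : IsUnit G.det := Matrix.isUnit_det_of_right_inverse hG
  obtain ⟨b, hb⟩ := exists_basis_of_isUnit_det hι v (by
    rwa [show (Matrix.of fun i j => form n (v i) (v j)) = G from Matrix.ext hv])
  obtain ⟨b', hb'⟩ := exists_basis_of_isUnit_det hι v' (by
    rwa [show (Matrix.of fun i j => form n (v' i) (v' j)) = G from Matrix.ext hv'])
  let u : H2 n ≃ₗ[ℤ] H2 n := b.equiv b' (Equiv.refl ι)
  have huv : ∀ i, u (v i) = v' i := fun i => by
    rw [← hb, ← hb']; exact b.equiv_apply i b' (Equiv.refl ι)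
  have hiso : ∀ x y, form n (u x) (u y) = form n x y := by
    have : (form n).comp u.toLinearMap u.toLinearMap = form n := by
      refine LinearMap.BilinForm.ext_basis b fun i j => ?_
      rw [hb, hb]
      change form n (u (v i)) (u (v j)) = _
      rw [huv, huv, hv, hv']
    intro x y
    exact congrArg (fun B => B x y) this
  obtain ⟨hK, h⟩ := hu u.toLinearMap huv
  refine isConj_iff.2 ⟨mkWeyl u hiso hK, ?_⟩
  rw [mul_inv_eq_iff_eq_mul]
  have h2 : u.toLinearMap ∘ₗ w.1.1.toLinearMap = w'.1.1.toLinearMap ∘ₗ u.toLinearMap := by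
    refine b.ext fun i => ?_
    rw [hb]
    refine (h hK i).trans ?_
    change _ = w'.1.1 (u (v i))
    rw [huv]
  exact weyl_ext fun x => LinearMap.congr_fun h2 x

theorem IsElliptic.apply_ne {n : ℕ} (hn : n ≤ 8) {w : Weyl n} (hw : IsElliptic w) {e : H2 n}
    (he : IsExc e) : w.1.1 e ≠ e := by
  intro h
  obtain ⟨a, rfl⟩ := hw _ h
  have h1 := he.2
  rw [map_smul, LinearMap.smul_apply, form_canonicalClass_self, smul_eq_mul] at h1
  have h2 := he.1
  rw [map_smul, map_smul, LinearMap.smul_apply, form_canonicalClass_self, smul_eq_mul, smul_eq_mul,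
    h1] at h2
  have h3 : a = 1 := by omega
  rw [h3] at h1
  omega

theorem IsElliptic.form_pow_nonneg {n : ℕ} (hn : n ≤ 8) {w : Weyl n} (hw : IsElliptic w) {p : ℕ}
    (hp : p.Prime) (hwp : w ^ p = 1) {e : H2 n} (he : IsExc e) {j : ℕ} (hj : ¬ p ∣ j) :
    0 ≤ form n e ((w ^ j).1.1 e) :=
  he.form_nonneg hn (he.map _) fun h =>
    hw.apply_ne hn he (weyl_fixed_of_pow_fixed hp hwp hj h.symm)

/-! ### Order five in degree five: pentagons of exceptional classes -/

/-- In degree five, the orbit of an exceptional class under an elliptic element of order five can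
be chosen to be a pentagon. -/
theorem exists_pentagon {w : Weyl 4} (hw : IsElliptic w) (hw5 : w ^ 5 = 1) :
    ∃ e, IsExc e ∧ form 4 e (w.1.1 e) = 1 ∧ form 4 e (w.1.1 (w.1.1 e)) = 0 := by
  set v := w.1.1 with hv
  have hi : ∀ x y, form 4 (v x) (v y) = form 4 x y := weyl_form w
  have h5 : ∀ x, v (v (v (v (v x)))) = x := fun x => by
    have : (w ^ 5).1.1 x = x := by rw [hw5, weyl_one_apply]
    exact this
  set e : H2 4 := exc 0 with he0
  have he : IsExc e := isExc_exc 0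
  have hsum := hw.smul_orbitSum hw5 e
  have hs : orbitSum w 5 e = e + v e + v (v e) + v (v (v e)) + v (v (v (v e))) := by
    simp only [orbitSum, Finset.sum_range_succ, Finset.sum_range_zero, zero_add]
    rfl
  have h3 : form 4 e (v (v (v e))) = form 4 e (v (v e)) := by
    rw [← hi, ← hi (v e), h5, form_symm]
  have h4 : form 4 e (v (v (v (v e)))) = form 4 e (v e) := by
    rw [← hi, h5, form_symm]
  have n1 : 0 ≤ form 4 e (v e) := hw.form_pow_nonneg (by norm_num) Nat.prime_five hw5 he
    (j := 1) (by norm_num)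
  have n2 : 0 ≤ form 4 e (v (v e)) := hw.form_pow_nonneg (by norm_num) Nat.prime_five hw5 he
    (j := 2) (by norm_num)
  -- Pairing the orbit sum -K with e gives e·we + e·w²e = 1, so exactly one of the two products is
  -- 1.
  have key := congrArg (form 4 e) hsum
  rw [hs] at key
  simp only [map_smul, map_add, he.1, he.2, h3, h4, smul_eq_mul] at key
  norm_num at key
  by_cases h1 : form 4 e (v e) = 1
  · exact ⟨e, he, h1, by omega⟩
  have a1 : form 4 e (v e) = 0 := by omega
  have a2 : form 4 e (v (v e)) = 1 := by omega
  have hK : ∀ x, form 4 (v x) (canonicalClass 4) = form 4 x (canonicalClass 4) :=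
    weyl_form_canonicalClass w
  have s1 : ∀ x, form 4 (v x) e = form 4 e (v x) := fun x => form_symm _ _ _
  -- The ten exceptional classes form a Petersen graph. If the orbit of e is its pentagram, this
  -- class is the neighbour of e outside the orbit, and its orbit is the pentagon.
  refine ⟨-e + v e + v (v (v (v e))), ⟨?_, ?_⟩, ?_, ?_⟩
  · simp only [map_add, map_neg, LinearMap.add_apply, LinearMap.neg_apply, s1, hi, h3, h4, a1, a2,
      he.1]
    norm_num
  · simp only [map_add, map_neg, LinearMap.add_apply, LinearMap.neg_apply, hK, he.2]
    norm_num
  · simp only [map_add, map_neg, LinearMap.add_apply, LinearMap.neg_apply, s1, hi, h3, h4, a1, a2,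
      he.1, h5]
    norm_num
  · simp only [map_add, map_neg, LinearMap.add_apply, LinearMap.neg_apply, s1, hi, h3, a1, a2,
      he.1, h5]
    norm_num

/-- A pentagon orbit is a unimodular frame of rank five, its sum is -K, and w rotates it. Hence
matching two pentagons conjugates the elements. -/
theorem isConj_four {w w' : Weyl 4} (hw : IsElliptic w) (hw5 : w ^ 5 = 1) (hw' : IsElliptic w')
    (hw5' : w' ^ 5 = 1) : IsConj w w' := by
  have key : ∀ w : Weyl 4, IsElliptic w → w ^ 5 = 1 → ∃ e : H2 4,
      (∀ i j : Fin 5, form 4 ((w ^ i.val).1.1 e) ((w ^ j.val).1.1 e) =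
        (!![-1, 1, 0, 0, 1; 1, -1, 1, 0, 0; 0, 1, -1, 1, 0; 0, 0, 1, -1, 1; 1, 0, 0, 1, -1] :
          Matrix (Fin 5) (Fin 5) ℤ) i j) ∧
      orbitSum w 5 e = - canonicalClass 4 := by
    intro w hw hw5
    obtain ⟨e, he, a1, a2⟩ := exists_pentagon hw hw5
    refine ⟨e, fun i j => ?_, ?_⟩
    · have hi : ∀ x y, form 4 (w.1.1 x) (w.1.1 y) = form 4 x y := weyl_form w
      have h5 : ∀ x, w.1.1 (w.1.1 (w.1.1 (w.1.1 (w.1.1 x)))) = x := fun x => by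
        have : (w ^ 5).1.1 x = x := by rw [hw5, weyl_one_apply]
        exact this
      have h3 : form 4 e (w.1.1 (w.1.1 (w.1.1 e))) = 0 := by
        rw [← hi, ← hi (w.1.1 e), h5, form_symm, a2]
      have h4 : form 4 e (w.1.1 (w.1.1 (w.1.1 (w.1.1 e)))) = 1 := by
        rw [← hi, h5, form_symm, a1]
      have s1 : ∀ x, form 4 (w.1.1 x) e = form 4 e (w.1.1 x) := fun x => form_symm _ _ _
      have hpow : ∀ k : Fin 5, (w ^ k.val).1.1 e = ![e, w.1.1 e, w.1.1 (w.1.1 e),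
          w.1.1 (w.1.1 (w.1.1 e)), w.1.1 (w.1.1 (w.1.1 (w.1.1 e)))] k := by
        intro k
        fin_cases k <;> rfl
      rw [hpow, hpow]
      fin_cases i <;> fin_cases j <;> simp [s1, hi, h3, h4, a1, a2, he.1]
    · have h := hw.smul_orbitSum hw5 e
      rw [he.2] at h
      refine smul_right_injective _ (show ((9 : ℤ) - (4 : ℕ)) ≠ 0 by norm_num) (h.trans ?_)
      norm_num
  obtain ⟨e, h1, h2⟩ := key w hw hw5
  obtain ⟨e', h1', h2'⟩ := key w' hw' hw5'
  refine isConj_of_frames (by simp) (fun i : Fin 5 => (w ^ i.val).1.1 e)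
    (fun i : Fin 5 => (w' ^ i.val).1.1 e') _
    !![-1, 0, 1, 1, 0; 0, -1, 0, 1, 1; 1, 0, -1, 0, 1; 1, 1, 0, -1, 0; 0, 1, 1, 0, -1] h1 h1' ?_ ?_
  · decide
  · intro u hu
    refine ⟨?_, fun _ i => ?_⟩
    · have : u (orbitSum w 5 e) = orbitSum w' 5 e' := by
        rw [orbitSum, orbitSum, map_sum]
        exact Finset.sum_congr rfl fun i hi => hu ⟨i, Finset.mem_range.1 hi⟩
      rwa [h2, h2', map_neg, neg_inj] at this
    · rw [← weyl_pow_succ_apply, ← weyl_pow_succ_apply]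
      by_cases hi : i.val + 1 = 5
      · rw [hi, hw5, hw5']
        exact hu 0
      · exact hu ⟨i.val + 1, by omega⟩


/-! ### Order three on cubic surfaces: orbits of lines -/

/-- The sum of an orbit of exceptional classes of a cubic surface under an elliptic element of
order three. -/
theorem IsElliptic.add_add_eq {w : Weyl 6} (hw : IsElliptic w) (hw3 : w ^ 3 = 1) {e : H2 6}
    (he : IsExc e) : e + w.1.1 e + w.1.1 (w.1.1 e) = - canonicalClass 6 := by
  have h := hw.smul_orbitSum hw3 e
  have hs : orbitSum w 3 e = e + w.1.1 e + w.1.1 (w.1.1 e) := by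
    simp only [orbitSum, Finset.sum_range_succ, Finset.sum_range_zero, zero_add]
    rfl
  rw [he.2, hs] at h
  refine smul_right_injective _ (show ((9 : ℤ) - (6 : ℕ)) ≠ 0 by norm_num) (h.trans ?_)
  norm_num

theorem IsElliptic.form_add_add {w : Weyl 6} (hw : IsElliptic w) (hw3 : w ^ 3 = 1) {e x : H2 6}
    (he : IsExc e) (hx : IsExc x) :
    form 6 e x + form 6 e (w.1.1 x) + form 6 e (w.1.1 (w.1.1 x)) = 1 := by
  rw [← map_add, ← map_add, hw.add_add_eq hw3 hx, map_neg, he.2, neg_neg]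

theorem IsElliptic.form_apply_three {w : Weyl 6} (hw : IsElliptic w) (hw3 : w ^ 3 = 1) {e : H2 6}
    (he : IsExc e) : form 6 e (w.1.1 e) = 1 ∧ form 6 e (w.1.1 (w.1.1 e)) = 1 := by
  have h := hw.form_add_add hw3 he he
  have h3 : w.1.1 (w.1.1 (w.1.1 e)) = e := by
    have : (w ^ 3).1.1 e = e := by rw [hw3, weyl_one_apply]
    exact this
  have h2 : form 6 e (w.1.1 (w.1.1 e)) = form 6 e (w.1.1 e) := by
    rw [← weyl_form w, h3, form_symm]
  rw [he.1, h2] at h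
  rw [h2]
  omega

theorem weyl_pow_three_cases {n : ℕ} {w : Weyl n} (hw3 : w ^ 3 = 1) (i : ℕ) (x : H2 n) :
    (w ^ i).1.1 x = x ∨ (w ^ i).1.1 x = w.1.1 x ∨ (w ^ i).1.1 x = w.1.1 (w.1.1 x) := by
  have h : w ^ i = w ^ (i % 3) := by
    conv_lhs => rw [← Nat.mod_add_div i 3, pow_add, pow_mul, hw3, one_pow, mul_one]
  rw [h]
  have : i % 3 < 3 := Nat.mod_lt _ (by norm_num)
  interval_cases i % 3
  · exact Or.inl rfl
  · exact Or.inr (Or.inl rfl)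
  · exact Or.inr (Or.inr rfl)

/-- Each orbit is a triangle of mutually meeting lines, so disjoint lines lie in different orbits.
-/
theorem IsElliptic.form_ne_zero_of_orbit {w : Weyl 6} (hw : IsElliptic w) (hw3 : w ^ 3 = 1)
    {t : H2 6} (ht : IsExc t) (i j : ℕ) : form 6 ((w ^ i).1.1 t) ((w ^ j).1.1 t) ≠ 0 := by
  have key : ∀ k : ℕ, form 6 t ((w ^ k).1.1 t) ≠ 0 := by
    intro k
    obtain ⟨h1, h2⟩ := hw.form_apply_three hw3 ht
    rcases weyl_pow_three_cases hw3 k t with h | h | h <;> rw [h]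
    · rw [ht.1]; norm_num
    · rw [h1]; norm_num
    · rw [h2]; norm_num
  have h : form 6 ((w ^ i).1.1 t) ((w ^ j).1.1 t) = form 6 t ((w ^ (j + 2 * i)).1.1 t) := by
    rw [← weyl_form (w ^ (2 * i)), ← weyl_pow_add_apply, ← weyl_pow_add_apply,
      show 2 * i + i = 3 * i by ring, pow_mul, hw3, one_pow, weyl_one_apply, add_comm j]
  rw [h]
  exact key _

/-- An exceptional class outside an orbit has a unique translate meeting a given member of the
orbit. -/
theorem IsElliptic.exists_normalized {w : Weyl 6} (hw : IsElliptic w) (hw3 : w ^ 3 = 1)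
    {e x : H2 6} (he : IsExc e) (hx : IsExc x) (hex : ∀ i, x ≠ (w ^ i).1.1 e) :
    ∃ j : ℕ, form 6 e ((w ^ j).1.1 x) = 1 ∧ form 6 e (w.1.1 ((w ^ j).1.1 x)) = 0 ∧
      form 6 e (w.1.1 (w.1.1 ((w ^ j).1.1 x))) = 0 := by
  have hsum := hw.form_add_add hw3 he hx
  have h3 : ∀ x, w.1.1 (w.1.1 (w.1.1 x)) = x := fun x => by
    have : (w ^ 3).1.1 x = x := by rw [hw3, weyl_one_apply]
    exact this
  have hn : ∀ j : ℕ, 0 ≤ form 6 e ((w ^ j).1.1 x) := by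
    intro j
    refine he.form_nonneg (by norm_num) (hx.map _) fun h => hex (2 * j) ?_
    rw [h, ← weyl_pow_add_apply, show 2 * j + j = 3 * j by ring, pow_mul, hw3, one_pow,
      weyl_one_apply]
  have n0 : 0 ≤ form 6 e x := hn 0
  have n1 : 0 ≤ form 6 e (w.1.1 x) := hn 1
  have n2 : 0 ≤ form 6 e (w.1.1 (w.1.1 x)) := hn 2
  have hc : form 6 e x = 1 ∨ form 6 e (w.1.1 x) = 1 ∨ form 6 e (w.1.1 (w.1.1 x)) = 1 := by omega
  rcases hc with h | h | h
  · exact ⟨0, h, (show form 6 e (w.1.1 x) = 0 by omega),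
      (show form 6 e (w.1.1 (w.1.1 x)) = 0 by omega)⟩
  · refine ⟨1, h, (show form 6 e (w.1.1 (w.1.1 x)) = 0 by omega), ?_⟩
    change form 6 e (w.1.1 (w.1.1 (w.1.1 x))) = 0
    rw [h3]; omega
  · refine ⟨2, h, ?_, ?_⟩
    · change form 6 e (w.1.1 (w.1.1 (w.1.1 x))) = 0
      rw [h3]; omega
    · change form 6 e (w.1.1 (w.1.1 (w.1.1 (w.1.1 x)))) = 0
      rw [h3]; omega

/-- Three orbits of lines on a cubic surface in standard position with respect to an elliptic
element of order three. -/
structure IsLineTriple (w : Weyl 6) (e f q : H2 6) : Prop where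
  exc_e : IsExc e
  exc_f : IsExc f
  exc_q : IsExc q
  ef : form 6 e f = 1
  ewf : form 6 e (w.1.1 f) = 0
  ewwf : form 6 e (w.1.1 (w.1.1 f)) = 0
  eq : form 6 e q = 1
  ewq : form 6 e (w.1.1 q) = 0
  ewwq : form 6 e (w.1.1 (w.1.1 q)) = 0
  qf : form 6 q f = 0
  qwf : form 6 q (w.1.1 f) = 1
  qwwf : form 6 q (w.1.1 (w.1.1 f)) = 0

/-- Start from e = E_1 and normalised translates f of E_2 and q of E_3 or E_4. The class t = -K - e
- f is the third line of the triangle through e and f. Its orbit cannot contain both of the disjoint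
lines E_3 and E_4, so q can be chosen outside it. Then q·f = 1 is impossible, as it would give q·t =
-1. So q meets wf or w²f, and exchanging f and q reduces the second case to the first. -/
theorem IsElliptic.exists_lineTriple {w : Weyl 6} (hw : IsElliptic w) (hw3 : w ^ 3 = 1) :
    ∃ e f q, IsLineTriple w e f q := by
  have h3 : ∀ x, w.1.1 (w.1.1 (w.1.1 x)) = x := fun x => by
    have : (w ^ 3).1.1 x = x := by rw [hw3, weyl_one_apply]
    exact this
  have hinv : ∀ i x, (w ^ (2 * i)).1.1 ((w ^ i).1.1 x) = x := fun i x => by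
    rw [← weyl_pow_add_apply, show 2 * i + i = 3 * i by ring, pow_mul, hw3, one_pow,
      weyl_one_apply]
  have hE : ∀ i : Fin 6, IsExc (exc i) := isExc_exc
  have hd : ∀ i j : Fin 6, i ≠ j → ∀ k : ℕ, exc i ≠ (w ^ k).1.1 (exc j) := by
    intro i j hij k h
    have h1 := hw.form_ne_zero_of_orbit hw3 (hE j) k 0
    rw [← h] at h1
    exact h1 (form_exc_exc hij)
  set e : H2 6 := exc 0 with he
  obtain ⟨k, ef, ewf, ewwf⟩ := hw.exists_normalized hw3 (hE 0) (hE 1) (hd 1 0 (by decide))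
  set f := (w ^ k).1.1 (exc 1) with hf
  rw [← he] at ef ewf ewwf
  have hfe : IsExc f := (hE 1).map _
  have hdf : ∀ i : Fin 6, i ≠ 1 → ∀ l : ℕ, exc i ≠ (w ^ l).1.1 f := by
    intro i hi l h
    rw [hf, ← weyl_pow_add_apply] at h
    exact hd i 1 hi _ h
  set t := -canonicalClass 6 - e - f with ht
  have hee := (hE 0).1
  have heK := (hE 0).2
  rw [← he] at hee heK
  have htexc : IsExc t := by
    constructor
    · simp only [ht, map_sub, map_neg, LinearMap.sub_apply, LinearMap.neg_apply,
        form_symm 6 (canonicalClass 6), hee, heK, hfe.1, hfe.2, form_symm 6 f e, ef,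
        form_canonicalClass_self]
      norm_num
    · simp only [ht, map_sub, map_neg, LinearMap.sub_apply, LinearMap.neg_apply, heK, hfe.2,
        form_canonicalClass_self]
      norm_num
  obtain ⟨i, hi0, hi1, hit⟩ : ∃ i : Fin 6, i ≠ 0 ∧ i ≠ 1 ∧ ∀ l : ℕ, exc i ≠ (w ^ l).1.1 t := by
    by_cases h2 : ∀ l : ℕ, (exc 2 : H2 6) ≠ (w ^ l).1.1 t
    · exact ⟨2, by decide, by decide, h2⟩
    · refine ⟨3, by decide, by decide, fun l hl => ?_⟩
      push Not at h2
      obtain ⟨m, hm⟩ := h2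
      have h1 := hw.form_ne_zero_of_orbit hw3 htexc m l
      rw [← hm, ← hl] at h1
      exact h1 (form_exc_exc (by decide))
  obtain ⟨j, eq, ewq, ewwq⟩ := hw.exists_normalized hw3 (hE 0) (hE i) (hd i 0 hi0)
  set q := (w ^ j).1.1 (exc i) with hq
  rw [← he] at eq ewq ewwq
  have hqe : IsExc q := (hE i).map _
  have hback : ∀ (l : ℕ) (x : H2 6), q = (w ^ l).1.1 x → exc i = (w ^ (2 * j + l)).1.1 x := by
    intro l x h
    rw [weyl_pow_add_apply, ← h, hq, hinv]
  have hsum := hw.form_add_add hw3 hqe hfe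
  have hn : ∀ l : ℕ, 0 ≤ form 6 q ((w ^ l).1.1 f) := fun l =>
    hqe.form_nonneg (by norm_num) (hfe.map _) fun h => hdf i hi1 _ (hback l f h)
  have n0 : 0 ≤ form 6 q f := hn 0
  have n1 : 0 ≤ form 6 q (w.1.1 f) := hn 1
  have n2 : 0 ≤ form 6 q (w.1.1 (w.1.1 f)) := hn 2
  have hqf : form 6 q f ≠ 1 := by
    intro h
    have hqt : form 6 q t = -1 := by
      simp only [ht, map_sub, map_neg, hqe.2, form_symm 6 q e, eq, h]
      norm_num
    have : ¬ 0 ≤ form 6 q t := by rw [hqt]; norm_num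
    refine this (hqe.form_nonneg (by norm_num) htexc fun h => ?_)
    exact hit _ (hback 0 t h)
  have hc : form 6 q (w.1.1 f) = 1 ∨ form 6 q (w.1.1 (w.1.1 f)) = 1 := by omega
  have hi : ∀ x y, form 6 (w.1.1 x) (w.1.1 y) = form 6 x y := weyl_form w
  rcases hc with h | h
  · exact ⟨e, f, q, hE 0, hfe, hqe, ef, ewf, ewwf, eq, ewq, ewwq, by omega, h, by omega⟩
  · refine ⟨e, q, f, hE 0, hqe, hfe, eq, ewq, ewwq, ef, ewf, ewwf, ?_, ?_, ?_⟩
    · rw [form_symm]; omega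
    · rw [form_symm, ← hi, ← hi, h3, h]
    · rw [form_symm, ← hi, h3]; omega

theorem IsLineTriple.form_eq {w : Weyl 6} (hw : IsElliptic w) (hw3 : w ^ 3 = 1) {e f q : H2 6}
    (h : IsLineTriple w e f q) (i j : Fin 7) :
    form 6 (![e, w.1.1 e, w.1.1 (w.1.1 e), f, w.1.1 f, q, w.1.1 q] i)
      (![e, w.1.1 e, w.1.1 (w.1.1 e), f, w.1.1 f, q, w.1.1 q] j) =
      (!![-1, 1, 1, 1, 0, 1, 0; 1, -1, 1, 0, 1, 0, 1; 1, 1, -1, 0, 0, 0, 0;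
        1, 0, 0, -1, 1, 0, 0; 0, 1, 0, 1, -1, 1, 0; 1, 0, 0, 0, 1, -1, 1;
        0, 1, 0, 0, 0, 1, -1] : Matrix (Fin 7) (Fin 7) ℤ) i j := by
  have h3 : ∀ x, w.1.1 (w.1.1 (w.1.1 x)) = x := fun x => by
    have : (w ^ 3).1.1 x = x := by rw [hw3, weyl_one_apply]
    exact this
  have hi : ∀ x y, form 6 (w.1.1 x) (w.1.1 y) = form 6 x y := weyl_form w
  obtain ⟨a1, a2⟩ := hw.form_apply_three hw3 h.exc_e
  obtain ⟨b1, b2⟩ := hw.form_apply_three hw3 h.exc_f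
  obtain ⟨c1, c2⟩ := hw.form_apply_three hw3 h.exc_q
  have s1 : ∀ x, form 6 (w.1.1 x) e = form 6 e (w.1.1 x) := fun x => form_symm _ _ _
  have s2 : form 6 f e = 1 := (form_symm _ _ _).trans h.ef
  have s3 : form 6 q e = 1 := (form_symm _ _ _).trans h.eq
  have s4 : form 6 f q = 0 := (form_symm _ _ _).trans h.qf
  have s5 : ∀ x, form 6 (w.1.1 x) f = form 6 x (w.1.1 (w.1.1 f)) := fun x => by
    rw [← hi, ← hi, h3]
  have s6 : ∀ x, form 6 (w.1.1 x) q = form 6 x (w.1.1 (w.1.1 q)) := fun x => by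
    rw [← hi, ← hi, h3]
  have t1 : form 6 f (w.1.1 e) = 0 := by rw [form_symm, s5, h.ewwf]
  have t2 : form 6 f (w.1.1 (w.1.1 e)) = 0 := by rw [form_symm, s5, hi, h.ewf]
  have t3 : form 6 q (w.1.1 e) = 0 := by rw [form_symm, s6, h.ewwq]
  have t4 : form 6 q (w.1.1 (w.1.1 e)) = 0 := by rw [form_symm, s6, hi, h.ewq]
  have t5 : form 6 f (w.1.1 q) = 0 := by rw [form_symm, s5, h.qwwf]
  have t6 : form 6 f (w.1.1 (w.1.1 q)) = 1 := by rw [form_symm, s5, hi, h.qwf]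
  fin_cases i <;> fin_cases j <;>
    simp [hi, s1, s2, s3, s4, s5, s6, a1, a2, b1, b2, c1, c2, t1, t2, t3, t4, t5, t6, h.exc_e.1,
      h.exc_f.1, h.exc_q.1, h.ef, h.ewf, h.ewwf, h.eq, h.ewq, h.ewwq, h.qf, h.qwf, h.qwwf]

/-- Seven of the nine lines in the three orbits form a unimodular frame. The two missing lines are
recovered from K, since every orbit sums to -K. -/
theorem isConj_six {w w' : Weyl 6} (hw : IsElliptic w) (hw3 : w ^ 3 = 1) (hw' : IsElliptic w')
    (hw3' : w' ^ 3 = 1) : IsConj w w' := by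
  obtain ⟨e, f, q, h⟩ := hw.exists_lineTriple hw3
  obtain ⟨e', f', q', h'⟩ := hw'.exists_lineTriple hw3'
  refine isConj_of_frames (by simp) _ _ _
    !![-1, 0, -1, 0, 1, 1, 1; 0, -1, -1, 1, 1, 1, 0; -1, -1, -3, 1, 2, 2, 1;
      0, 1, 1, -2, -1, 0, 1; 1, 1, 2, -1, -2, -1, 0; 1, 1, 2, 0, -1, -2, -1;
      1, 0, 1, 1, 0, -1, -2] (h.form_eq hw hw3) (h'.form_eq hw' hw3') (by decide) ?_
  intro u hu
  have u0 : u e = e' := hu 0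
  have u1 : u (w.1.1 e) = w'.1.1 e' := hu 1
  have u2 : u (w.1.1 (w.1.1 e)) = w'.1.1 (w'.1.1 e') := hu 2
  have u3 : u f = f' := hu 3
  have u4 : u (w.1.1 f) = w'.1.1 f' := hu 4
  have u5 : u q = q' := hu 5
  have u6 : u (w.1.1 q) = w'.1.1 q' := hu 6
  refine ⟨?_, fun hK i => ?_⟩
  · have e1 := hw.add_add_eq hw3 h.exc_e
    have e2 := hw'.add_add_eq hw3' h'.exc_e
    rw [← neg_inj, ← map_neg, ← e1, map_add, map_add, u0, u1, u2, e2, e1]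
  · have cycle : ∀ (v : Weyl 6), v ^ 3 = 1 → ∀ x, v.1.1 (v.1.1 (v.1.1 x)) = x := fun v hv x => by
      have : (v ^ 3).1.1 x = x := by rw [hv, weyl_one_apply]
      exact this
    have third : ∀ x x' : H2 6, IsExc x → IsExc x' → u x = x' → u (w.1.1 x) = w'.1.1 x' →
        u (w.1.1 (w.1.1 x)) = w'.1.1 (w'.1.1 x') := by
      intro x x' hx hx' h0 h1
      have e1 := hw.add_add_eq hw3 hx
      have e2 := hw'.add_add_eq hw3' hx'
      rw [← eq_sub_iff_add_eq'] at e1 e2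
      rw [e1, e2, map_sub, map_neg, map_add, hK, h0, h1]
    fin_cases i
    · exact u1
    · exact u2
    · change u (w.1.1 (w.1.1 (w.1.1 e))) = w'.1.1 (w'.1.1 (w'.1.1 e'))
      rw [cycle w hw3, cycle w' hw3', u0]
    · exact u4
    · exact third f f' h.exc_f h'.exc_f u3 u4
    · exact u6
    · exact third q q' h.exc_q h'.exc_q u5 u6


/-! ### Elliptic elements in degree one -/

/-- The Weyl group acts transitively on tuples of orthogonal exceptional classes. -/
theorem exists_map_tuple (k : ℕ) : ∀ n : ℕ, k + 2 ≤ n → n ≤ 8 → ∀ e : Fin k → H2 n,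
    (∀ i, IsExc (e i)) → (∀ i j, i ≠ j → form n (e i) (e j) = 0) →
    ∃ w : Weyl n, ∀ (i : Fin k) (j : Fin n), i.val + j.val + 1 = n → w.1.1 (e i) = exc j := by
  induction k with
  | zero => exact fun n _ _ _ _ _ => ⟨1, fun i => i.elim0⟩
  | succ k ih =>
    intro n hk hn e he ho
    obtain ⟨m, rfl⟩ : ∃ m, n = m + 1 := ⟨n - 1, by omega⟩
    -- The bound k + 2 ≤ n keeps at least three points at every stage, so transitivity on single
    -- classes is available.
    obtain ⟨w, hw⟩ := (he 0).exists_map_eq (by omega) hn (Fin.last m)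
    have hr : ∀ i : Fin k, extend (restrict (w.1.1 (e i.succ))) = w.1.1 (e i.succ) := fun i =>
      extend_restrict (by rw [← hw, weyl_form]; exact ho _ _ (Fin.succ_ne_zero i))
    obtain ⟨v, hv⟩ := ih m (by omega) (by omega) (fun i => restrict (w.1.1 (e i.succ)))
      (fun i => by rw [← isExc_extend_iff, hr]; exact (he _).map w)
      (fun i j hij => by
        rw [← form_extend, hr, hr, weyl_form]
        exact ho _ _ (fun h => hij (Fin.succ_injective _ h)))
    refine ⟨lift v * w, fun i j hij => ?_⟩
    rw [weyl_mul_apply]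
    revert hij
    refine Fin.cases (fun hij => ?_) (fun i hij => ?_) i
    · rw [hw, lift_exc_last]
      congr 1
      ext
      simpa using hij.symm
    · have hj : j.val < m := by
        have := Fin.val_succ i
        omega
      rw [← hr, lift_extend, hv i ⟨j.val, hj⟩ (by have := Fin.val_succ i; simp only; omega),
        extend_exc]
      rfl

theorem IsElliptic.conj {n : ℕ} {w : Weyl n} (hw : IsElliptic w) (u : Weyl n) :
    IsElliptic (u * w * u⁻¹) := by
  intro x hx
  obtain ⟨a, ha⟩ := hw (u⁻¹.1.1 x) (by
    have := congrArg (u⁻¹.1.1) hx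
    rwa [weyl_mul_apply, weyl_mul_apply, weyl_inv_apply_self] at this)
  refine ⟨a, ?_⟩
  have := congrArg u.1.1 ha
  rwa [weyl_apply_inv_self, map_smul, weyl_canonicalClass] at this

theorem IsElliptic.of_isConj {n : ℕ} {w w' : Weyl n} (hw : IsElliptic w) (h : IsConj w w') :
    IsElliptic w' := by
  obtain ⟨u, rfl⟩ := isConj_iff.1 h
  exact hw.conj u

/-- K has E_1-coordinate 1, so a rational multiple of K that is integral is an integral multiple. -/
theorem eq_smul_canonicalClass {n : ℕ} (hn0 : 1 ≤ n) (hn : n ≤ 8) {x : H2 n}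
    (h : (9 - n : ℤ) • x - form n x (canonicalClass n) • canonicalClass n = 0) :
    ∃ a : ℤ, x = a • canonicalClass n := by
  have hK : (0 : ℤ) < 9 - n := by omega
  have h1 := sub_eq_zero.1 h
  have h2 := congrFun h1 (Fin.succ ⟨0, hn0⟩)
  rw [Pi.smul_apply, Pi.smul_apply, canonicalClass_succ, smul_eq_mul, smul_eq_mul, mul_one] at h2
  rw [← h2, mul_smul] at h1
  exact ⟨_, smul_right_injective _ hK.ne' h1⟩

theorem form_proj_canonicalClass {n : ℕ} (x : H2 n) :
    form n ((9 - n : ℤ) • x - form n x (canonicalClass n) • canonicalClass n)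
      (canonicalClass n) = 0 := by
  simp only [map_sub, map_smul, LinearMap.sub_apply, LinearMap.smul_apply,
    form_canonicalClass_self, smul_eq_mul]
  ring

/-- An elliptic element `g` splitting as `r * L h` with `r` trivial on the root lattice of a
smaller Weyl group induces an elliptic element of the latter. -/
theorem IsElliptic.of_splitting {m n p : ℕ} (hm0 : 1 ≤ m) (hm : m ≤ 8) (hn : n ≤ 8)
    (E : H2 m → H2 n) (L : Weyl m →* Weyl n) (hE0 : ∀ x, E x = 0 → x = 0)
    (hEinj : Function.Injective E)
    (hEK : ∀ x, form n (E x) (canonicalClass n) = form m x (canonicalClass m))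
    (hL : ∀ v x, (L v).1.1 (E x) = E (v.1.1 x)) {r : Weyl n}
    (hr : ∀ x, form m x (canonicalClass m) = 0 → r.1.1 (E x) = E x) {h : Weyl m}
    (hg : IsElliptic (r * L h)) (hgp : (r * L h) ^ p = 1) : IsElliptic h ∧ h ^ p = 1 := by
  have hK : (0 : ℤ) < 9 - m := by omega
  have hK' : (0 : ℤ) < 9 - n := by omega
  -- On the image of K^⊥ the factor r is invisible, so there E carries h to the whole element; other
  -- classes are first projected to K^⊥.
  have hstep : ∀ x, form m x (canonicalClass m) = 0 → (r * L h).1.1 (E x) = E (h.1.1 x) := by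
    intro x hx
    rw [weyl_mul_apply, hL, hr _ (by rwa [weyl_form_canonicalClass])]
  have hpow : ∀ i : ℕ, ∀ x, form m x (canonicalClass m) = 0 →
      ((r * L h) ^ i).1.1 (E x) = E ((h ^ i).1.1 x) := by
    intro i
    induction i with
    | zero => intro x _; rfl
    | succ i ih =>
      intro x hx
      rw [weyl_pow_succ_apply, ih x hx, hstep _ (by rwa [weyl_form_canonicalClass]),
        weyl_pow_succ_apply]
  have hproj : ∀ (v : Weyl m) (x : H2 m),
      v.1.1 ((9 - m : ℤ) • x - form m x (canonicalClass m) • canonicalClass m) =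
        (9 - m : ℤ) • v.1.1 x - form m x (canonicalClass m) • canonicalClass m := fun v x => by
    rw [map_sub, map_smul, map_smul, weyl_canonicalClass]
  constructor
  · intro x hx
    refine eq_smul_canonicalClass hm0 hm (hE0 _ ?_)
    set y := (9 - m : ℤ) • x - form m x (canonicalClass m) • canonicalClass m with hy
    have hyK : form m y (canonicalClass m) = 0 := form_proj_canonicalClass x
    have hyh : h.1.1 y = y := by rw [hy, hproj, hx]
    obtain ⟨a, ha⟩ := hg (E y) (by rw [hstep y hyK, hyh])
    have h1 := hEK y
    rw [hyK, ha, map_smul, LinearMap.smul_apply, form_canonicalClass_self, smul_eq_mul,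
      mul_eq_zero] at h1
    rw [ha, h1.resolve_right hK'.ne', zero_smul]
  · refine weyl_ext fun x => ?_
    have h1 := hpow p _ (form_proj_canonicalClass x)
    rw [hgp, weyl_one_apply] at h1
    have h2 := hEinj h1
    rw [hproj, sub_left_inj] at h2
    exact (smul_right_injective _ hK.ne' h2).symm

/-- Conjugacy of elliptic elements reduces to a smaller Weyl group. -/
theorem isConj_of_splitting {m n p : ℕ} (hm0 : 1 ≤ m) (hm : m ≤ 8) (hn : n ≤ 8)
    (E : H2 m → H2 n) (L : Weyl m →* Weyl n) (hE0 : ∀ x, E x = 0 → x = 0)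
    (hEinj : Function.Injective E)
    (hEK : ∀ x, form n (E x) (canonicalClass n) = form m x (canonicalClass m))
    (hL : ∀ v x, (L v).1.1 (E x) = E (v.1.1 x)) {r : Weyl n}
    (hr : ∀ x, form m x (canonicalClass m) = 0 → r.1.1 (E x) = E x)
    (hcomm : ∀ v, L v * r = r * L v)
    (huniq : ∀ h h' : Weyl m, IsElliptic h → h ^ p = 1 → IsElliptic h' → h' ^ p = 1 →
      IsConj h h') {g g' : Weyl n} (hg : IsElliptic g) (hgp : g ^ p = 1) (hg' : IsElliptic g')
    (hgp' : g' ^ p = 1) (hl : ∃ h, L h = r⁻¹ * g) (hl' : ∃ h, L h = r⁻¹ * g') : IsConj g g' := by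
  obtain ⟨h, hh⟩ := hl
  obtain ⟨h', hh'⟩ := hl'
  rw [eq_inv_mul_iff_mul_eq] at hh hh'
  rw [← hh] at hg hgp ⊢
  rw [← hh'] at hg' hgp' ⊢
  obtain ⟨a1, a2⟩ := hg.of_splitting hm0 hm hn E L hE0 hEinj hEK hL hr hgp
  obtain ⟨b1, b2⟩ := hg'.of_splitting hm0 hm hn E L hE0 hEinj hEK hL hr hgp'
  obtain ⟨u, hu⟩ := isConj_iff.1 (huniq h h' a1 a2 b1 b2)
  refine isConj_iff.2 ⟨L u, ?_⟩
  rw [← hu, map_mul, map_mul, map_inv, ← mul_assoc, hcomm, mul_assoc, mul_assoc, mul_assoc]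

theorem rootReflection_comm {n : ℕ} {v : H2 n} (hv : form n v v = -2)
    (hK : form n v (canonicalClass n) = 0) {u : Weyl n} (hu : u.1.1 v = v) :
    u * rootReflection v hv hK = rootReflection v hv hK * u := by
  refine weyl_ext fun x => ?_
  rw [weyl_mul_apply, weyl_mul_apply, rootReflection_apply, rootReflection_apply, map_add, map_smul,
    hu]
  congr 2
  conv_rhs => rw [← hu, weyl_form]

theorem form_extend_canonicalClass {n : ℕ} (x : H2 n) :
    form (n + 1) (extend x) (canonicalClass (n + 1)) = form n x (canonicalClass n) := by
  rw [form_extend_left, restrict_canonicalClass]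

theorem form_extend_exc {n : ℕ} (x : H2 n) (i : Fin n) :
    form (n + 1) (extend x) (exc i.castSucc) = form n x (exc i) := by
  rw [← extend_exc, form_extend]

theorem lift_exc {n : ℕ} (w : Weyl n) (i : Fin n) (h : w.1.1 (exc i) = exc i) :
    (lift w).1.1 (exc i.castSucc) = exc i.castSucc := by
  rw [← extend_exc, lift_extend, h]

theorem exists_lift_eq_of_fixes {n : ℕ} (w : Weyl (n + 1))
    (hw : w.1.1 (exc (Fin.last n)) = exc (Fin.last n)) : ∃ v : Weyl n, lift v = w ∧
    ∀ i : Fin n, w.1.1 (exc i.castSucc) = exc i.castSucc → v.1.1 (exc i) = exc i := by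
  obtain ⟨v, rfl⟩ := exists_lift_eq w hw
  refine ⟨v, rfl, fun i hi => extend_injective ?_⟩
  rw [← lift_extend, extend_exc, hi]

/-- The root `E_{i+1} + K` in degree one. -/
theorem form_exc_add_canonicalClass (i : Fin 8) :
    form 8 (exc i + canonicalClass 8) (exc i + canonicalClass 8) = -2 ∧
      form 8 (exc i + canonicalClass 8) (canonicalClass 8) = 0 := by
  simp only [map_add, LinearMap.add_apply, (isExc_exc i).1, (isExc_exc i).2,
    form_canonicalClass_self, form_symm 8 (canonicalClass 8) (exc i)]
  norm_num

theorem form_exc_sub_exc {n : ℕ} {i j : Fin n} (h : i ≠ j) :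
    form n (exc i - exc j) (exc i - exc j) = -2 ∧
      form n (exc i - exc j) (canonicalClass n) = 0 := by
  simp only [map_sub, LinearMap.sub_apply, (isExc_exc i).1, (isExc_exc i).2, (isExc_exc j).1,
    (isExc_exc j).2, form_exc_exc h, form_exc_exc h.symm]
  norm_num

/-! ### Order three in degree one: splitting off an A_2 -/

/-- The elements of order three with `E_8 ↦ -E_7 - 2K` in degree one. -/
theorem isConj_eight_three_of_normalized {g g' : Weyl 8} (hg : IsElliptic g) (hg3 : g ^ 3 = 1)
    (hg' : IsElliptic g') (hg3' : g' ^ 3 = 1)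
    (h : g.1.1 (exc 7) = -exc 6 - (2 : ℤ) • canonicalClass 8)
    (h' : g'.1.1 (exc 7) = -exc 6 - (2 : ℤ) • canonicalClass 8) : IsConj g g' := by
  -- The roots E_8 + K and E_7 + K span an A_2, and s t is its rotation. It agrees with g on E_7 and
  -- E_8, so (s t)⁻¹ g comes from W_6.
  let s := rootReflection (exc 7 + canonicalClass 8) (form_exc_add_canonicalClass 7).1
    (form_exc_add_canonicalClass 7).2
  let t := rootReflection (exc 6 + canonicalClass 8) (form_exc_add_canonicalClass 6).1
    (form_exc_add_canonicalClass 6).2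
  have hs : ∀ x, s.1.1 x = x + form 8 x (exc 7 + canonicalClass 8) • (exc 7 + canonicalClass 8) :=
    rootReflection_apply _ _ _
  have ht : ∀ x, t.1.1 x = x + form 8 x (exc 6 + canonicalClass 8) • (exc 6 + canonicalClass 8) :=
    rootReflection_apply _ _ _
  have e67 : form 8 (exc 6) (exc 7) = 0 := form_exc_exc (by decide)
  have e76 : form 8 (exc 7) (exc 6) = 0 := form_exc_exc (by decide)
  have hKe : ∀ i, form 8 (canonicalClass 8) (exc i) = -1 := fun i => by
    rw [form_symm, (isExc_exc i).2]
  have r7 : (s * t).1.1 (exc 7) = -exc 6 - (2 : ℤ) • canonicalClass 8 := by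
    rw [weyl_mul_apply, ht, hs]
    simp only [map_add, map_smul, LinearMap.add_apply, LinearMap.smul_apply, e67, e76, hKe,
      (isExc_exc _).1, (isExc_exc _).2, form_canonicalClass_self]
    norm_num
    ring
  have r6 : (s * t).1.1 (exc 6) = exc 7 - exc 6 - canonicalClass 8 := by
    rw [weyl_mul_apply, ht, hs]
    simp only [map_add, map_smul, LinearMap.add_apply, LinearMap.smul_apply, e67, hKe,
      (isExc_exc _).1, (isExc_exc _).2, form_canonicalClass_self]
    norm_num
    ring
  have hlift : ∀ g : Weyl 8, IsElliptic g → g ^ 3 = 1 →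
      g.1.1 (exc 7) = -exc 6 - (2 : ℤ) • canonicalClass 8 →
      ∃ h : Weyl 6, (lift.comp lift) h = (s * t)⁻¹ * g := by
    intro g hg hg3 h
    -- The image of E_7 is forced: the orbit of E_8 sums to -3K.
    have h6 : g.1.1 (exc 6) = exc 7 - exc 6 - canonicalClass 8 := by
      have h1 := hg.smul_orbitSum hg3 (exc 7)
      have hsum : orbitSum g 3 (exc 7) = exc 7 + g.1.1 (exc 7) + g.1.1 (g.1.1 (exc 7)) := by
        simp only [orbitSum, Finset.sum_range_succ, Finset.sum_range_zero, zero_add]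
        rfl
      rw [hsum, h, map_sub, map_neg, map_smul, weyl_canonicalClass, (isExc_exc _).2] at h1
      norm_num at h1
      linear_combination -h1
    have f7 : ((s * t)⁻¹ * g).1.1 (exc 7) = exc 7 := by
      rw [weyl_mul_apply, h, ← r7, weyl_inv_apply_self]
    have f6 : ((s * t)⁻¹ * g).1.1 (exc 6) = exc 6 := by
      rw [weyl_mul_apply, h6, ← r6, weyl_inv_apply_self]
    obtain ⟨v, hv, hv'⟩ := exists_lift_eq_of_fixes (n := 7) _ f7
    obtain ⟨u, hu, -⟩ := exists_lift_eq_of_fixes (n := 6) v (hv' 6 f6)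
    exact ⟨u, by rw [MonoidHom.comp_apply, hu, hv]⟩
  have hE7 : ∀ x : H2 6, form 8 (extend (extend x)) (exc 7) = 0 := fun x =>
    form_extend_exc_last (extend x)
  have hE6 : ∀ x : H2 6, form 8 (extend (extend x)) (exc 6) = 0 := fun x =>
    (form_extend_exc (extend x) 6).trans (form_extend_exc_last x)
  have hEK : ∀ x : H2 6, form 8 (extend (extend x)) (canonicalClass 8) =
      form 6 x (canonicalClass 6) := fun x =>
    (form_extend_canonicalClass (extend x)).trans (form_extend_canonicalClass x)
  refine isConj_of_splitting (p := 3) (by norm_num) (by norm_num) (by norm_num)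
    (fun x : H2 6 => extend (extend x)) (lift.comp lift) (r := s * t) (fun x hx => ?_)
    (extend_injective.comp extend_injective) hEK (fun v x => ?_) (fun x hx => ?_) (fun v => ?_)
    (fun _ _ a b c d => isConj_six a b c d) hg hg3 hg' hg3' (hlift g hg hg3 h)
    (hlift g' hg' hg3' h')
  · refine extend_injective (extend_injective (hx.trans ?_))
    rw [extend_zero, extend_zero]
  · rw [MonoidHom.comp_apply, lift_extend, lift_extend]
  · rw [weyl_mul_apply, ht, map_add (form 8 _), hE6, hEK, hx, add_zero, zero_smul, add_zero, hs,
      map_add (form 8 _), hE7, hEK, hx, add_zero, zero_smul, add_zero]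
  · have l7 : ((lift.comp lift) v).1.1 (exc 7) = exc 7 := lift_exc_last (lift v)
    have l6 : ((lift.comp lift) v).1.1 (exc 6) = exc 6 := lift_exc (lift v) 6 (lift_exc_last v)
    have c1 := rootReflection_comm (form_exc_add_canonicalClass 7).1
      (form_exc_add_canonicalClass 7).2 (u := (lift.comp lift) v)
      (by rw [map_add, l7, weyl_canonicalClass])
    have c2 := rootReflection_comm (form_exc_add_canonicalClass 6).1
      (form_exc_add_canonicalClass 6).2 (u := (lift.comp lift) v)
      (by rw [map_add, l6, weyl_canonicalClass])
    rw [← mul_assoc, c1, mul_assoc, c2, mul_assoc]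

/-- The orbit sum -3K of e gives e·ge = 2, so the image -ge - 2K of ge under the Bertini involution
is an exceptional class orthogonal to e. Transitivity on orthogonal pairs moves e and this class to
E_8 and E_7. -/
theorem exists_isConj_normalized_three {g : Weyl 8} (hg : IsElliptic g) (hg3 : g ^ 3 = 1) :
    ∃ g', IsConj g g' ∧ g'.1.1 (exc 7) = -exc 6 - (2 : ℤ) • canonicalClass 8 := by
  have he : IsExc (exc 7 : H2 8) := isExc_exc 7
  set e : H2 8 := exc 7 with he7
  have h3 : g.1.1 (g.1.1 (g.1.1 e)) = e := by
    have : (g ^ 3).1.1 e = e := by rw [hg3, weyl_one_apply]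
    exact this
  have h1 := hg.smul_orbitSum hg3 e
  have hsum : orbitSum g 3 e = e + g.1.1 e + g.1.1 (g.1.1 e) := by
    simp only [orbitSum, Finset.sum_range_succ, Finset.sum_range_zero, zero_add]
    rfl
  have h2 : form 8 e (g.1.1 (g.1.1 e)) = form 8 e (g.1.1 e) := by
    rw [← weyl_form g, h3, form_symm]
  have hs : form 8 e (g.1.1 e) = 2 := by
    have := congrArg (form 8 e) h1
    rw [hsum] at this
    simp only [map_smul, map_add, he.1, he.2, h2, smul_eq_mul] at this
    norm_num at this
    omega
  have hge := he.map g
  set f : H2 8 := -g.1.1 e - (2 : ℤ) • canonicalClass 8 with hf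
  have hfe : IsExc f := by
    constructor
    · simp only [hf, map_sub, map_neg, map_smul, LinearMap.sub_apply, LinearMap.neg_apply,
        LinearMap.smul_apply, hge.1, hge.2, form_symm 8 (canonicalClass 8),
        form_canonicalClass_self]
      norm_num
    · simp only [hf, map_sub, map_neg, map_smul, LinearMap.sub_apply, LinearMap.neg_apply,
        LinearMap.smul_apply, hge.2, form_canonicalClass_self]
      norm_num
  have hef : form 8 e f = 0 := by
    simp only [hf, map_sub, map_neg, map_smul, hs, he.2]
    norm_num
  obtain ⟨w, hw⟩ := exists_map_tuple 2 8 (by norm_num) le_rfl ![e, f]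
    (fun i => by fin_cases i <;> assumption)
    (fun i j hij => by
      fin_cases i <;> fin_cases j
      · exact absurd rfl hij
      · exact hef
      · exact (form_symm _ _ _).trans hef
      · exact absurd rfl hij)
  have w0 : w.1.1 e = exc 7 := hw 0 7 rfl
  have w1 : w.1.1 f = exc 6 := hw 1 6 rfl
  refine ⟨w * g * w⁻¹, isConj_iff.2 ⟨w, rfl⟩, ?_⟩
  have w2 : w⁻¹.1.1 (exc 7) = e := by rw [← w0, weyl_inv_apply_self]
  have w3 : g.1.1 e = -f - (2 : ℤ) • canonicalClass 8 := by rw [hf]; abel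
  rw [weyl_mul_apply, weyl_mul_apply, w2, w3, map_sub, map_neg, map_smul, w1, weyl_canonicalClass]

theorem isConj_eight_three {g g' : Weyl 8} (hg : IsElliptic g) (hg3 : g ^ 3 = 1)
    (hg' : IsElliptic g') (hg3' : g' ^ 3 = 1) : IsConj g g' := by
  have hpow : ∀ a b : Weyl 8, IsConj a b → a ^ 3 = 1 → b ^ 3 = 1 := by
    intro a b hab ha
    obtain ⟨u, rfl⟩ := isConj_iff.1 hab
    rw [conj_pow, ha, mul_one, mul_inv_cancel]
  obtain ⟨a, ha, ha'⟩ := exists_isConj_normalized_three hg hg3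
  obtain ⟨b, hb, hb'⟩ := exists_isConj_normalized_three hg' hg3'
  exact ha.trans ((isConj_eight_three_of_normalized (hg.of_isConj ha) (hpow _ _ ha hg3)
    (hg'.of_isConj hb) (hpow _ _ hb hg3') ha' hb').trans hb.symm)


/-! ### Order five in degree one: splitting off an A_4 -/

/-- The rotation of the root system `A_4` spanned by the last four exceptional classes in degree
one, on these exceptional classes. -/
def IsPentagonal (g : Weyl 8) : Prop :=
  g.1.1 (exc 7) = -exc 4 - (2 : ℤ) • canonicalClass 8 ∧
  g.1.1 (exc 6) = exc 7 - exc 4 - canonicalClass 8 ∧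
  g.1.1 (exc 5) = exc 6 - exc 4 - canonicalClass 8 ∧
  g.1.1 (exc 4) = exc 5 - exc 4 - canonicalClass 8

/-- Here r is the Coxeter element of the chain E_5 - E_6, E_6 - E_7, E_7 - E_8, E_8 + K of type A_4.
It is trivial on the complement of these roots and commutes with whatever fixes them. -/
theorem exists_pentagonal_lift_comm : ∃ r : Weyl 8, IsPentagonal r ∧
    (∀ x, form 8 x (canonicalClass 8) = 0 → (∀ i : Fin 8, 4 ≤ i → form 8 x (exc i) = 0) →
      r.1.1 x = x) ∧
    ∀ u : Weyl 8, (∀ i : Fin 8, 4 ≤ i → u.1.1 (exc i) = exc i) → u * r = r * u := by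
  obtain ⟨a1, b1⟩ := form_exc_sub_exc (n := 8) (i := 4) (j := 5) (by decide)
  obtain ⟨a2, b2⟩ := form_exc_sub_exc (n := 8) (i := 5) (j := 6) (by decide)
  obtain ⟨a3, b3⟩ := form_exc_sub_exc (n := 8) (i := 6) (j := 7) (by decide)
  obtain ⟨a4, b4⟩ := form_exc_add_canonicalClass 7
  refine ⟨rootReflection _ a1 b1 * (rootReflection _ a2 b2 * (rootReflection _ a3 b3 *
    rootReflection _ a4 b4)), ?_, fun x hx hE => ?_, fun u hu => ?_⟩
  · have hE : ∀ i j : Fin 8, form 8 (exc i) (exc j) = if i = j then -1 else 0 := by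
      intro i j
      split_ifs with h
      · rw [h, (isExc_exc j).1]
      · exact form_exc_exc h
    have hKe : ∀ i, form 8 (canonicalClass 8) (exc i) = -1 := fun i => by
      rw [form_symm, (isExc_exc i).2]
    refine ⟨?_, ?_, ?_, ?_⟩ <;>
    · simp only [weyl_mul_apply, rootReflection_apply, map_add, map_sub, map_smul,
        hE, hKe, (isExc_exc _).2, Fin.reduceEq, if_true, if_false]
      norm_num
      try ring
  · have h4 := hE 4 le_rfl
    have h5 := hE 5 (by decide)
    have h6 := hE 6 (by decide)
    have h7 := hE 7 (by decide)
    simp only [weyl_mul_apply, rootReflection_apply, map_add (form 8 _), map_sub (form 8 _), h4, h5,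
      h6, h7, hx, add_zero, sub_zero, zero_smul]
  · have h4 := hu 4 le_rfl
    have h5 := hu 5 (by decide)
    have h6 := hu 6 (by decide)
    have h7 := hu 7 (by decide)
    have c1 := rootReflection_comm a1 b1 (u := u) (by rw [map_sub, h4, h5])
    have c2 := rootReflection_comm a2 b2 (u := u) (by rw [map_sub, h5, h6])
    have c3 := rootReflection_comm a3 b3 (u := u) (by rw [map_sub, h6, h7])
    have c4 := rootReflection_comm a4 b4 (u := u) (by rw [map_add, h7, weyl_canonicalClass])
    rw [← mul_assoc, c1, mul_assoc, ← mul_assoc u, c2, mul_assoc, ← mul_assoc u, c3, mul_assoc, c4]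
    simp only [mul_assoc]

/-- Two pentagonal elements agree with r on E_5, …, E_8, so their quotients by r descend through
four blow-downs to W_4. -/
theorem isConj_eight_five_of_pentagonal {g g' : Weyl 8} (hg : IsElliptic g) (hg5 : g ^ 5 = 1)
    (hg' : IsElliptic g') (hg5' : g' ^ 5 = 1) (h : IsPentagonal g) (h' : IsPentagonal g') :
    IsConj g g' := by
  obtain ⟨r, hr, hfix, hcomm⟩ := exists_pentagonal_lift_comm
  let L : Weyl 4 →* Weyl 8 := (lift.comp lift).comp (lift.comp lift)
  let E : H2 4 → H2 8 := fun x => extend (extend (extend (extend x)))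
  have hLE : ∀ v x, (L v).1.1 (E x) = E (v.1.1 x) := fun v x => by
    change (lift (lift (lift (lift v)))).1.1 (extend (extend (extend (extend x)))) = _
    rw [lift_extend, lift_extend, lift_extend, lift_extend]
  have hlift : ∀ g : Weyl 8, IsPentagonal g → ∃ h, L h = r⁻¹ * g := by
    intro g hg
    have f7 : (r⁻¹ * g).1.1 (exc 7) = exc 7 := by
      rw [weyl_mul_apply, hg.1, ← hr.1, weyl_inv_apply_self]
    have f6 : (r⁻¹ * g).1.1 (exc 6) = exc 6 := by
      rw [weyl_mul_apply, hg.2.1, ← hr.2.1, weyl_inv_apply_self]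
    have f5 : (r⁻¹ * g).1.1 (exc 5) = exc 5 := by
      rw [weyl_mul_apply, hg.2.2.1, ← hr.2.2.1, weyl_inv_apply_self]
    have f4 : (r⁻¹ * g).1.1 (exc 4) = exc 4 := by
      rw [weyl_mul_apply, hg.2.2.2, ← hr.2.2.2, weyl_inv_apply_self]
    obtain ⟨v, hv, hv'⟩ := exists_lift_eq_of_fixes (n := 7) _ f7
    obtain ⟨u, hu, hu'⟩ := exists_lift_eq_of_fixes (n := 6) v (hv' 6 f6)
    obtain ⟨t, ht, ht'⟩ := exists_lift_eq_of_fixes (n := 5) u (hu' 5 (hv' 5 f5))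
    obtain ⟨s, hs, -⟩ := exists_lift_eq_of_fixes (n := 4) t (ht' 4 (hu' 4 (hv' 4 f4)))
    refine ⟨s, ?_⟩
    change lift (lift (lift (lift s))) = _
    rw [hs, ht, hu, hv]
  have hEK : ∀ x, form 8 (E x) (canonicalClass 8) = form 4 x (canonicalClass 4) := fun x =>
    (((form_extend_canonicalClass _).trans (form_extend_canonicalClass _)).trans
      (form_extend_canonicalClass _)).trans (form_extend_canonicalClass x)
  have hEe : ∀ x, ∀ i : Fin 8, 4 ≤ i → form 8 (E x) (exc i) = 0 := by
    intro x i hi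
    have h7 : form 8 (E x) (exc 7) = 0 := form_extend_exc_last _
    have h6 : form 8 (E x) (exc 6) = 0 := (form_extend_exc _ 6).trans (form_extend_exc_last _)
    have h5 : form 8 (E x) (exc 5) = 0 := (form_extend_exc _ 5).trans
      ((form_extend_exc _ 5).trans (form_extend_exc_last _))
    have h4 : form 8 (E x) (exc 4) = 0 := (form_extend_exc _ 4).trans
      ((form_extend_exc _ 4).trans ((form_extend_exc _ 4).trans (form_extend_exc_last _)))
    fin_cases i
    · exact absurd hi (by decide)
    · exact absurd hi (by decide)
    · exact absurd hi (by decide)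
    · exact absurd hi (by decide)
    · exact h4
    · exact h5
    · exact h6
    · exact h7
  have hLe : ∀ v, ∀ i : Fin 8, 4 ≤ i → (L v).1.1 (exc i) = exc i := by
    intro v i hi
    have h7 : (L v).1.1 (exc 7) = exc 7 := lift_exc_last _
    have h6 : (L v).1.1 (exc 6) = exc 6 := lift_exc _ 6 (lift_exc_last _)
    have h5 : (L v).1.1 (exc 5) = exc 5 := lift_exc _ 5 (lift_exc _ 5 (lift_exc_last _))
    have h4 : (L v).1.1 (exc 4) = exc 4 :=
      lift_exc _ 4 (lift_exc _ 4 (lift_exc _ 4 (lift_exc_last _)))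
    fin_cases i
    · exact absurd hi (by decide)
    · exact absurd hi (by decide)
    · exact absurd hi (by decide)
    · exact absurd hi (by decide)
    · exact h4
    · exact h5
    · exact h6
    · exact h7
  refine isConj_of_splitting (p := 5) (by norm_num) (by norm_num) (by norm_num) E L (r := r)
    (fun x hx => ?_)
    ((extend_injective.comp extend_injective).comp (extend_injective.comp extend_injective)) hEK
    hLE (fun x hx => hfix _ ((hEK x).trans hx) (hEe x)) (fun v => hcomm _ (hLe v))
    (fun _ _ a b c d => isConj_four a b c d) hg hg5 hg' hg5' (hlift g h) (hlift g' h')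
  refine extend_injective (extend_injective (extend_injective (extend_injective (hx.trans ?_))))
  rw [extend_zero, extend_zero, extend_zero, extend_zero]

/-- A root whose orbit under an elliptic element of order five spans a root system `A_4` with the
orbit as a chain. -/
theorem exists_chain {g : Weyl 8} (hg : IsElliptic g) (hg5 : g ^ 5 = 1) :
    ∃ a : H2 8, form 8 a a = -2 ∧ form 8 a (canonicalClass 8) = 0 ∧ form 8 a (g.1.1 a) = 1 ∧
      form 8 a (g.1.1 (g.1.1 a)) = 0 := by
  set v := g.1.1 with hv
  have hi : ∀ x y, form 8 (v x) (v y) = form 8 x y := weyl_form g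
  have hK : ∀ x, form 8 (v x) (canonicalClass 8) = form 8 x (canonicalClass 8) :=
    weyl_form_canonicalClass g
  have h5 : ∀ x, v (v (v (v (v x)))) = x := fun x => by
    have : (g ^ 5).1.1 x = x := by rw [hg5, weyl_one_apply]
    exact this
  obtain ⟨haa, haK⟩ := form_exc_add_canonicalClass 7
  set a : H2 8 := exc 7 + canonicalClass 8 with ha
  have hs : orbitSum g 5 a = a + v a + v (v a) + v (v (v a)) + v (v (v (v a))) := by
    simp only [orbitSum, Finset.sum_range_succ, Finset.sum_range_zero, zero_add]
    rfl
  have h3 : form 8 a (v (v (v a))) = form 8 a (v (v a)) := by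
    rw [← hi, ← hi (v a), h5, form_symm]
  have h4 : form 8 a (v (v (v (v a)))) = form 8 a (v a) := by
    rw [← hi, h5, form_symm]
  have hsum := congrArg (form 8 a) (hg.smul_orbitSum hg5 a)
  rw [hs, haK] at hsum
  simp only [map_smul, map_add, haa, haK, h3, h4, smul_eq_mul] at hsum
  norm_num at hsum
  -- The orbit sum being zero gives a·ga + a·g²a = 1. A product of at least 2 between roots would
  -- mean g^j a = -a, making a fixed by g^(2j), hence by g. So the two products are 0 and 1 in some
  -- order.
  have hle : ∀ j : ℕ, ¬ 5 ∣ j → form 8 a ((g ^ j).1.1 a) ≤ 1 := by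
    intro j hj
    by_contra hcon
    have hKj : form 8 ((g ^ j).1.1 a) (canonicalClass 8) = 0 := by
      rw [weyl_form_canonicalClass, haK]
    have hz : a + (g ^ j).1.1 a = 0 := by
      by_contra hne
      have := form_self_neg_of_orthogonal_canonicalClass (n := 8) le_rfl
        (x := a + (g ^ j).1.1 a) (by rw [map_add, LinearMap.add_apply, haK, hKj, add_zero]) hne
      simp only [map_add, LinearMap.add_apply, weyl_form, haa, form_symm 8 _ a] at this
      omega
    have h1 : (g ^ j).1.1 a = -a := eq_neg_of_add_eq_zero_right hz
    have h2 : (g ^ (j + j)).1.1 a = a := by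
      rw [weyl_pow_add_apply, h1, map_neg, h1, neg_neg]
    have h3 := weyl_fixed_of_pow_fixed Nat.prime_five hg5 (j := j + j) (by omega) h2
    obtain ⟨c, hc⟩ := hg a h3
    have h4 := haa
    rw [hc, map_smul, map_smul, LinearMap.smul_apply, form_canonicalClass_self, smul_eq_mul,
      smul_eq_mul] at h4
    norm_num at h4
    nlinarith [mul_self_nonneg c]
  have n1 : form 8 a (v a) ≤ 1 := hle 1 (by norm_num)
  have n2 : form 8 a (v (v a)) ≤ 1 := hle 2 (by norm_num)
  by_cases h1 : form 8 a (v a) = 1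
  · exact ⟨a, haa, haK, h1, by omega⟩
  have a1 : form 8 a (v a) = 0 := by omega
  have a2 : form 8 a (v (v a)) = 1 := by omega
  have s1 : ∀ x, form 8 (v x) a = form 8 a (v x) := fun x => form_symm _ _ _
  -- When the orbit is a chain for g² instead, this sum of three consecutive roots of that chain is
  -- a root whose orbit is a chain for g.
  refine ⟨a + v (v a) + v (v (v (v a))), ?_, ?_, ?_, ?_⟩
  · simp only [map_add, LinearMap.add_apply, s1, hi, h4, a1, a2, haa]
    norm_num
  · simp only [map_add, LinearMap.add_apply, hK, haK]
    norm_num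
  · simp only [map_add, LinearMap.add_apply, s1, hi, h3, h4, a1, a2, haa, h5]
    norm_num
  · simp only [map_add, LinearMap.add_apply, s1, hi, h3, h4, a1, a2, haa, h5]
    norm_num

theorem exists_isConj_pentagonal {g : Weyl 8} (hg : IsElliptic g) (hg5 : g ^ 5 = 1) :
    ∃ g', IsConj g g' ∧ IsPentagonal g' := by
  obtain ⟨a, haa, haK, a1, a2⟩ := exists_chain hg hg5
  set v := g.1.1 with hv
  have hi : ∀ x y, form 8 (v x) (v y) = form 8 x y := weyl_form g
  have hK : ∀ x, form 8 (v x) (canonicalClass 8) = form 8 x (canonicalClass 8) :=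
    weyl_form_canonicalClass g
  have hKv : ∀ x, form 8 (canonicalClass 8) (v x) = form 8 x (canonicalClass 8) := fun x => by
    rw [form_symm, hK]
  have hvK : v (canonicalClass 8) = canonicalClass 8 := weyl_canonicalClass g
  have hKK : form 8 (canonicalClass 8) (canonicalClass 8) = 1 := by
    rw [form_canonicalClass_self]; norm_num
  have hKa : form 8 (canonicalClass 8) a = 0 := by rw [form_symm, haK]
  have h5 : ∀ x, v (v (v (v (v x)))) = x := fun x => by
    have : (g ^ 5).1.1 x = x := by rw [hg5, weyl_one_apply]
    exact this
  have hsum : a + v a + v (v a) + v (v (v a)) + v (v (v (v a))) = 0 := by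
    have h := hg.smul_orbitSum hg5 a
    have hs : orbitSum g 5 a = a + v a + v (v a) + v (v (v a)) + v (v (v (v a))) := by
      simp only [orbitSum, Finset.sum_range_succ, Finset.sum_range_zero, zero_add]
      rfl
    rw [hs, haK, mul_zero, zero_smul] at h
    exact (smul_eq_zero.1 h).resolve_left (by norm_num)
  have h3 : form 8 a (v (v (v a))) = 0 := by
    rw [← hi, ← hi (v a), h5, form_symm, a2]
  have s1 : ∀ x, form 8 (v x) a = form 8 a (v x) := fun x => form_symm _ _ _
  -- These partial sums, shifted by -K, are orthogonal exceptional classes. Sending them to E_8,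
  -- E_7, E_6, E_5 sends a, ga, g²a, g³a to E_5 - E_6, E_6 - E_7, E_7 - E_8, E_8 + K.
  obtain ⟨w, hw⟩ := exists_map_tuple 4 8 (by norm_num) le_rfl
    ![v (v (v a)) - canonicalClass 8, v (v (v a)) + v (v a) - canonicalClass 8,
      v (v (v a)) + v (v a) + v a - canonicalClass 8,
      v (v (v a)) + v (v a) + v a + a - canonicalClass 8]
    (fun i => by
      fin_cases i <;> constructor <;>
      · simp only [Fin.mk_zero, Fin.mk_one, Fin.reduceFinMk, Matrix.cons_val, map_add, map_sub,
          LinearMap.add_apply, LinearMap.sub_apply, s1, hi, hK, hKv, hKK, hKa, haK, haa, h3, a1, a2]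
        norm_num)
    (fun i j hij => by
      fin_cases i <;> fin_cases j <;> first
      | exact absurd rfl hij
      | simp only [Fin.mk_zero, Fin.mk_one, Fin.reduceFinMk, Matrix.cons_val, map_add, map_sub,
          LinearMap.add_apply, LinearMap.sub_apply, s1, hi, hK, hKv, hKK, hKa, haK, haa, h3, a1, a2]
        norm_num)
  have w0 : w.1.1 (v (v (v a)) - canonicalClass 8) = exc 7 := hw 0 7 rfl
  have w1 : w.1.1 (v (v (v a)) + v (v a) - canonicalClass 8) = exc 6 := hw 1 6 rfl
  have w2 : w.1.1 (v (v (v a)) + v (v a) + v a - canonicalClass 8) = exc 5 := hw 2 5 rfl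
  have w3 : w.1.1 (v (v (v a)) + v (v a) + v a + a - canonicalClass 8) = exc 4 := hw 3 4 rfl
  have hwK := weyl_canonicalClass w
  have h4 : v (v (v (v a))) = -(a + v a + v (v a) + v (v (v a))) := by
    rw [← add_eq_zero_iff_neg_eq.1 hsum]
  have hconj : ∀ x y, w.1.1 x = y → (w * g * w⁻¹).1.1 y = w.1.1 (v x) := by
    rintro x _ rfl
    rw [weyl_mul_apply, weyl_mul_apply, weyl_inv_apply_self]
  refine ⟨w * g * w⁻¹, isConj_iff.2 ⟨w, rfl⟩, ?_, ?_, ?_, ?_⟩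
  · rw [hconj _ _ w0, ← w3, show v (v (v (v a)) - canonicalClass 8) =
      -(v (v (v a)) + v (v a) + v a + a - canonicalClass 8) - (2 : ℤ) • canonicalClass 8 by
        rw [map_sub, hvK, h4]; module, map_sub, map_neg, map_smul, hwK]
  · rw [hconj _ _ w1, ← w3, ← w0, show v (v (v (v a)) + v (v a) - canonicalClass 8) =
      v (v (v a)) - canonicalClass 8 - (v (v (v a)) + v (v a) + v a + a - canonicalClass 8) -
        canonicalClass 8 by rw [map_sub, map_add, hvK, h4]; module]
    rw [map_sub _ _ (canonicalClass 8), hwK, map_sub _ (_ - _)]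
  · rw [hconj _ _ w2, ← w3, ← w1, show v (v (v (v a)) + v (v a) + v a - canonicalClass 8) =
      v (v (v a)) + v (v a) - canonicalClass 8 -
        (v (v (v a)) + v (v a) + v a + a - canonicalClass 8) - canonicalClass 8 by
          rw [map_sub, map_add, map_add, hvK, h4]; module]
    rw [map_sub _ _ (canonicalClass 8), hwK, map_sub _ (_ - _)]
  · rw [hconj _ _ w3, ← w3, ← w2, show v (v (v (v a)) + v (v a) + v a + a - canonicalClass 8) =
      v (v (v a)) + v (v a) + v a - canonicalClass 8 -
        (v (v (v a)) + v (v a) + v a + a - canonicalClass 8) - canonicalClass 8 by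
          rw [map_sub, map_add, map_add, map_add, hvK, h4]; module]
    rw [map_sub _ _ (canonicalClass 8), hwK, map_sub _ (_ - _)]

theorem IsConj.pow_eq_one {G : Type*} [Group G] {a b : G} (h : IsConj a b) {p : ℕ}
    (ha : a ^ p = 1) : b ^ p = 1 := by
  obtain ⟨u, rfl⟩ := isConj_iff.1 h
  rw [conj_pow, ha, mul_one, mul_inv_cancel]

theorem isConj_eight_five {g g' : Weyl 8} (hg : IsElliptic g) (hg5 : g ^ 5 = 1)
    (hg' : IsElliptic g') (hg5' : g' ^ 5 = 1) : IsConj g g' := by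
  obtain ⟨a, ha, ha'⟩ := exists_isConj_pentagonal hg hg5
  obtain ⟨b, hb, hb'⟩ := exists_isConj_pentagonal hg' hg5'
  exact ha.trans ((isConj_eight_five_of_pentagonal (hg.of_isConj ha) (IsConj.pow_eq_one ha hg5)
    (hg'.of_isConj hb) (IsConj.pow_eq_one hb hg5') ha' hb').trans hb.symm)


/-! ### Orders and Coxeter elements -/

/-- Reduction of a class modulo `q`. -/
def reduce (q : ℕ) {n : ℕ} (x : H2 n) : Fin (n + 1) → ZMod q := fun i => (x i : ZMod q)

theorem reduce_surjective (q n : ℕ) : Function.Surjective (reduce q (n := n)) := fun y =>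
  ⟨fun i => (ZMod.intCast_surjective (y i)).choose, funext fun i =>
    (ZMod.intCast_surjective (y i)).choose_spec⟩

theorem exists_reduce_map (q : ℕ) {n : ℕ} (w : Weyl n) :
    ∃ f : Function.End (Fin (n + 1) → ZMod q), ∀ x, f (reduce q x) = reduce q (w.1.1 x) := by
  refine ⟨fun y => ((LinearMap.toMatrix' w.1.1.toLinearMap).map (Int.castRingHom (ZMod q))).mulVec
    y, fun x => funext fun i => ?_⟩
  have h := RingHom.map_mulVec (Int.castRingHom (ZMod q)) (LinearMap.toMatrix' w.1.1.toLinearMap)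
    x i
  rw [LinearMap.toMatrix'_mulVec] at h
  exact h.symm

/-- Modulo q the fixed vectors are exactly the q multiples of K: for fixed x, p x equals the orbit
sum p(x·K)K, and p is invertible. All other orbits on the q⁹ vectors have length p. -/
theorem IsElliptic.dvd_pow_sub {w : Weyl 8} (hw : IsElliptic w) {p : ℕ} (hp : p.Prime)
    (hwp : w ^ p = 1) {q : ℕ} (hq : q.Prime) (hpq : p ≠ q) : p ∣ q ^ 9 - q := by
  classical
  have : Fact p.Prime := ⟨hp⟩
  have : Fact q.Prime := ⟨hq⟩
  obtain ⟨f, hf⟩ := exists_reduce_map q w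
  have hpow : ∀ (i : ℕ) x, (f ^ i) (reduce q x) = reduce q ((w ^ i).1.1 x) := by
    intro i
    induction i with
    | zero => intro x; rfl
    | succ i ih =>
      intro x
      rw [pow_succ', weyl_pow_succ_apply, ← hf, ← ih]
      rfl
  have hfp : f ^ p ^ 1 = 1 := by
    funext y
    obtain ⟨x, rfl⟩ := reduce_surjective q 8 y
    rw [pow_one, hpow, hwp]
    rfl
  have hp0 : (p : ZMod q) ≠ 0 := by
    rw [Ne, ZMod.natCast_eq_zero_iff, Nat.prime_dvd_prime_iff_eq hq hp]
    exact hpq.symm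
  have hadd : ∀ x y : H2 8, reduce q (x + y) = reduce q x + reduce q y := fun x y =>
    funext fun i => Int.cast_add _ _
  have hsmul : ∀ (a : ℤ) (x : H2 8), reduce q (a • x) = (a : ZMod q) • reduce q x := fun a x =>
    funext fun i => Int.cast_mul _ _
  have hK1 : reduce q (canonicalClass 8) 1 = 1 := by simp [reduce, canonicalClass]
  let φ : ZMod q → f.fixedPoints := fun c => ⟨c • reduce q (canonicalClass 8), by
    obtain ⟨a, rfl⟩ := ZMod.intCast_surjective c
    change f _ = _
    rw [← hsmul, hf, map_smul, weyl_canonicalClass]⟩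
  have hφ : Function.Bijective φ := by
    constructor
    · intro a b hab
      have := congrFun (congrArg Subtype.val hab) 1
      change a * reduce q (canonicalClass 8) 1 = b * reduce q (canonicalClass 8) 1 at this
      rwa [hK1, mul_one, mul_one] at this
    · rintro ⟨y, hy⟩
      obtain ⟨x, rfl⟩ := reduce_surjective q 8 y
      have hy' : f (reduce q x) = reduce q x := hy
      have hyi : ∀ i : ℕ, reduce q ((w ^ i).1.1 x) = reduce q x := by
        intro i
        induction i with
        | zero => rfl
        | succ i ih => rw [weyl_pow_succ_apply, ← hf, ih, hy']
      have hsum : ∀ m : ℕ, reduce q (orbitSum w m x) = (m : ZMod q) • reduce q x := by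
        intro m
        induction m with
        | zero => rw [Nat.cast_zero, zero_smul]; exact funext fun i => Int.cast_zero
        | succ m ih =>
          rw [orbitSum, Finset.sum_range_succ, ← orbitSum, hadd, ih, hyi, Nat.cast_succ, add_smul,
            one_smul]
      have h1 := hw.smul_orbitSum hwp x
      norm_num at h1
      have h2 := hsum p
      refine ⟨(form 8 x (canonicalClass 8) : ZMod q), Subtype.ext ?_⟩
      change (form 8 x (canonicalClass 8) : ZMod q) • reduce q (canonicalClass 8) = reduce q x
      refine smul_right_injective _ hp0 ?_
      change (p : ZMod q) • _ = (p : ZMod q) • _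
      have h3 := hw.smul_orbitSum hwp x
      rw [show (9 : ℤ) - (8 : ℕ) = 1 by norm_num, one_smul] at h3
      rw [← h2, h3, hsmul, smul_smul, Int.cast_mul, Int.cast_natCast]
  have hcard := Equiv.Perm.card_fixedPoints_modEq hfp
  rw [Fintype.card_eq_nat_card (α := f.fixedPoints), ← Nat.card_congr (Equiv.ofBijective φ hφ),
    Nat.card_zmod, Fintype.card_fun, ZMod.card, Fintype.card_fin] at hcard
  exact (Nat.modEq_iff_dvd' (Nat.le_self_pow (by norm_num) q)).1 hcard.symm

/-- Elliptic elements of odd prime order in degree one have order three or five. -/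
theorem IsElliptic.eq_three_or_five {w : Weyl 8} (hw : IsElliptic w) {p : ℕ} (hp : p.Prime)
    (hodd : Odd p) (hwp : w ^ p = 1) : p = 3 ∨ p = 5 := by
  by_cases h3 : p = 3
  · exact Or.inl h3
  have h2 : p ≠ 2 := by
    rintro rfl
    exact absurd hodd (by decide)
  have a := hw.dvd_pow_sub hp hwp Nat.prime_two h2
  have b := hw.dvd_pow_sub hp hwp Nat.prime_three h3
  have c := Nat.dvd_gcd a b
  -- The two numbers are 510 = 2·3·5·17 and 19680 = 2⁵·3·5·41.
  rw [show Nat.gcd (2 ^ 9 - 2) (3 ^ 9 - 3) = 2 * 3 * 5 by norm_num] at c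
  rcases hp.dvd_mul.1 c with c | c
  · rcases hp.dvd_mul.1 c with c | c
    · exact absurd ((Nat.prime_dvd_prime_iff_eq hp Nat.prime_two).1 c) h2
    · exact absurd ((Nat.prime_dvd_prime_iff_eq hp Nat.prime_three).1 c) h3
  · exact Or.inr ((Nat.prime_dvd_prime_iff_eq hp Nat.prime_five).1 c)

/-! ### Products of involutions along a forest -/

/-- The equivalence of words generated by interchanging adjacent commuting letters and rotating. -/
inductive CyclicEquiv {G : Type*} [Group G] {ι : Type*} (s : ι → G) : List ι → List ι → Prop
  | refl (l) : CyclicEquiv s l l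
  | swap (l m) (a b : ι) : s a * s b = s b * s a →
      CyclicEquiv s (l ++ a :: b :: m) (l ++ b :: a :: m)
  | rotate (a : ι) (l) : CyclicEquiv s (a :: l) (l ++ [a])
  | symm {l m} : CyclicEquiv s l m → CyclicEquiv s m l
  | trans {l m k} : CyclicEquiv s l m → CyclicEquiv s m k → CyclicEquiv s l k

namespace CyclicEquiv

variable {G : Type*} [Group G] {ι : Type*} {s : ι → G}

theorem isConj {l m : List ι} (h : CyclicEquiv s l m) :
    IsConj (l.map s).prod (m.map s).prod := by
  induction h with
  | refl l => exact IsConj.refl _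
  | swap l m a b hab =>
    have : ((l ++ a :: b :: m).map s).prod = ((l ++ b :: a :: m).map s).prod := by
      simp only [List.map_append, List.map_cons, List.prod_append, List.prod_cons]
      rw [← mul_assoc (s a), hab, mul_assoc (s b)]
    rw [this]
  | rotate a l =>
    refine isConj_iff.2 ⟨(s a)⁻¹, ?_⟩
    simp
  | symm _ ih => exact ih.symm
  | trans _ _ ih1 ih2 => exact ih1.trans ih2

theorem perm {l m : List ι} (h : CyclicEquiv s l m) : l.Perm m := by
  induction h with
  | refl l => exact List.Perm.refl _
  | swap l m a b _ => exact (List.Perm.swap b a m).append_left l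
  | rotate a l => exact (List.perm_append_singleton a l).symm
  | symm _ ih => exact ih.symm
  | trans _ _ ih1 ih2 => exact ih1.trans ih2

theorem rotate_append (l m : List ι) : CyclicEquiv s (l ++ m) (m ++ l) := by
  induction l generalizing m with
  | nil => rw [List.append_nil]; exact refl _
  | cons a l ih =>
    have h1 : CyclicEquiv s (a :: (l ++ m)) (l ++ m ++ [a]) := rotate a _
    rw [List.append_assoc] at h1
    have h2 := ih (m ++ [a])
    rw [List.append_assoc] at h2
    exact h1.trans h2

/-- A letter commutes past a word all of whose letters commute with it. -/
theorem move_right (a : ι) (l m : List ι) (h : ∀ b ∈ l, s a * s b = s b * s a) (k : List ι) :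
    CyclicEquiv s (k ++ a :: (l ++ m)) (k ++ l ++ a :: m) := by
  induction l generalizing k with
  | nil => rw [List.append_nil, List.nil_append]; exact refl _
  | cons b l ih =>
    have h1 : CyclicEquiv s (k ++ a :: b :: (l ++ m)) (k ++ b :: a :: (l ++ m)) :=
      swap k _ a b (h b (by simp))
    have h2 := ih (fun c hc => h c (List.mem_cons_of_mem _ hc)) (k ++ [b])
    rw [List.append_assoc, List.append_assoc, List.append_assoc] at h2
    rw [List.append_assoc]
    exact h1.trans h2

/-- A letter that fails to commute with at most one letter of a word can be added to an
equivalence of words. -/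
theorem cons {a : ι} {l m : List ι} (h : CyclicEquiv s l m) (hl : l.Nodup) {b : ι}
    (hb : ∀ c ∈ l, c ≠ b → s a * s c = s c * s a) : CyclicEquiv s (a :: l) (a :: m) := by
  induction h with
  | refl l => exact refl _
  | swap l m c d hcd => exact swap (a :: l) m c d hcd
  | rotate c l =>
    -- If c is the letter that may fail to commute with a, rotate: a c l ~ c l a ~ c a l ~ a l c.
    -- Otherwise a passes c, and c is then rotated to the end.
    by_cases hc : c = b
    · subst hc
      have hcl := (List.nodup_cons.1 hl).1
      have h1 : CyclicEquiv s (a :: c :: l) ((c :: l) ++ [a]) := rotate a _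
      have h2 := move_right (s := s) a l [] (fun d hd => hb d (List.mem_cons_of_mem _ hd) (by
        rintro rfl; exact hcl hd)) [c]
      rw [List.append_nil] at h2
      have h3 : CyclicEquiv s (c :: a :: l) ((a :: l) ++ [c]) := rotate c _
      exact (h1.trans h2.symm).trans h3
    · have h1 : CyclicEquiv s (a :: c :: l) (c :: a :: l) :=
        swap [] l a c (hb c (by simp) hc)
      exact h1.trans (rotate c (a :: l))
  | symm h ih =>
    refine (ih (h.perm.nodup_iff.2 hl) fun c hc => hb c (h.perm.mem_iff.1 hc)).symm
  | trans h1 h2 ih1 ih2 =>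
    exact (ih1 hl hb).trans (ih2 (h1.perm.nodup_iff.1 hl) fun c hc => hb c (h1.perm.mem_iff.2 hc))

end CyclicEquiv

/-- If every letter of a word fails to commute with at most one of the later letters, then all
rearrangements of the word are equivalent. -/
theorem cyclicEquiv_of_perm {G : Type*} [Group G] {ι : Type*} {s : ι → G} (l : List ι)
    (hl : l.Nodup)
    (h : ∀ k a m, l = k ++ a :: m → ∃ b, ∀ c ∈ m, c ≠ b → s a * s c = s c * s a) (m : List ι)
    (hm : m.Perm l) : CyclicEquiv s m l := by
  induction l generalizing m with
  | nil => rw [hm.eq_nil]; exact .refl _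
  | cons a l ih =>
    obtain ⟨m₁, m₂, rfl⟩ := List.append_of_mem (hm.mem_iff.2 (by simp : a ∈ a :: l))
    have hp : (m₂ ++ m₁).Perm l := by
      refine List.Perm.cons_inv (a := a) (List.Perm.trans ?_ hm)
      exact List.perm_append_comm (l₁ := a :: m₂) (l₂ := m₁)
    obtain ⟨b, hb⟩ := h [] a l rfl
    have h1 := ih (List.nodup_cons.1 hl).2 (fun k c m hc => h (a :: k) c m (by rw [hc]; rfl)) _ hp
    exact (CyclicEquiv.rotate_append m₁ (a :: m₂)).trans
      (h1.cons (hp.nodup_iff.2 (List.nodup_cons.1 hl).2) fun c hc => hb c (hp.mem_iff.1 hc))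

theorem rootReflection_mul_comm {n : ℕ} {u v : H2 n} (hu : form n u u = -2) (hv : form n v v = -2)
    (huv : form n u v = 0) (x : H2 n) :
    reflection u hu (reflection v hv x) = reflection v hv (reflection u hu x) := by
  simp only [reflection_apply, map_add, map_smul, huv, (form_symm n v u).trans huv, zero_smul, add_zero]
  abel

theorem simpleReflection_comm {n : ℕ} (hn : 3 ≤ n) {i j : Fin n}
    (h : form n (simpleRoot n i) (simpleRoot n j) = 0) :
    simpleReflection hn i * simpleReflection hn j =
      simpleReflection hn j * simpleReflection hn i :=
  weyl_ext fun x => rootReflection_mul_comm (form_simpleRoot_self hn i) (form_simpleRoot_self hn j)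
    h x

/-- In this numbering each node of the Dynkin diagram has at most one later neighbour: 3 for the
node 0, and i + 1 for i ≥ 1. -/
theorem form_simpleRoot_eq_zero {n : ℕ} {i j : Fin n} (hij : i < j)
    (h : j.val ≠ if i.val = 0 then 3 else i.val + 1) :
    form n (simpleRoot n i) (simpleRoot n j) = 0 := by
  have hj := j.isLt
  have hi : i.val < j.val := hij
  have hj0 : j.val ≠ 0 := by omega
  rw [simpleRoot, simpleRoot, if_neg hj0, map_sub, form_basisVec n _ (by omega),
    form_basisVec n _ (by omega), if_neg hj0, if_neg (Nat.succ_ne_zero _)]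
  split_ifs at h ⊢ with h0
  · simp only [basisVec, Pi.sub_apply]
    have : j.val ≠ 3 := h
    by_cases h1 : j.val = 1 <;> by_cases h2 : j.val = 2 <;> simp [h1, h2, this, hj0]
  · simp only [basisVec, Pi.sub_apply]
    have h1 : j.val ≠ i.val := by omega
    have h2 : j.val + 1 ≠ i.val := by omega
    simp [h1, h2, h]

/-- The product of the simple reflections in the standard order. -/
def standardCoxeter {n : ℕ} (hn : 3 ≤ n) : Weyl n := (List.ofFn (simpleReflection hn)).prod

theorem IsCoxeterElement.isConj {n : ℕ} {hn : 3 ≤ n} {c : Weyl n} (hc : IsCoxeterElement hn c) :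
    IsConj c (standardCoxeter hn) := by
  obtain ⟨σ, rfl⟩ := hc
  have h := cyclicEquiv_of_perm (s := simpleReflection hn) (List.finRange n) (List.nodup_finRange n)
    (fun k a m hk => by
      have hlt : ∀ c ∈ m, a < c := by
        have := List.pairwise_lt_finRange n
        rw [hk, List.pairwise_append] at this
        exact (List.pairwise_cons.1 this.2.1).1
      -- If the index is out of range there is no later neighbour, and `a` serves as a dummy
      -- exception.
      by_cases hb : (if a.val = 0 then 3 else a.val + 1) < n
      · refine ⟨⟨_, hb⟩, fun c hc hcb => simpleReflection_comm hn
          (form_simpleRoot_eq_zero (hlt c hc) fun h => hcb (Fin.ext h))⟩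
      · refine ⟨a, fun c hc _ => simpleReflection_comm hn
          (form_simpleRoot_eq_zero (hlt c hc) fun h => hb (h ▸ c.isLt))⟩)
    (List.ofFn σ) (by
      rw [List.ofFn_eq_map]
      exact (List.perm_ext_iff_of_nodup ((List.nodup_finRange n).map σ.injective)
        (List.nodup_finRange n)).2 fun i => by simpa using σ.surjective i)
  have h2 := h.isConj
  rw [List.map_ofFn, ← List.ofFn_eq_map] at h2
  exact h2


/-! ### Representatives -/

theorem IsElliptic.of_smul_orbitSum {n : ℕ} (hn : 1 ≤ n) (hn8 : n ≤ 8) {w : Weyl n} {p : ℕ}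
    (hp : p ≠ 0)
    (h : ∀ x, (9 - n : ℤ) • orbitSum w p x = (p * form n x (canonicalClass n)) • canonicalClass n) :
    IsElliptic w := by
  intro x hx
  refine eq_smul_canonicalClass hn hn8 ?_
  have h1 := h x
  rw [orbitSum_of_fixed p hx, smul_comm, mul_smul, ← sub_eq_zero, ← smul_sub] at h1
  exact (smul_eq_zero.1 h1).resolve_left (by exact_mod_cast hp)

/-- The right-hand side is fixed by w, hence so is the orbit sum; comparing the sum with its image
telescopes to w^p x = x. -/
theorem pow_eq_one_of_smul_orbitSum {n : ℕ} (hn8 : n ≤ 8) {w : Weyl n} {p : ℕ}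
    (h : ∀ x, (9 - n : ℤ) • orbitSum w p x = (p * form n x (canonicalClass n)) • canonicalClass n) :
    w ^ p = 1 := by
  refine weyl_ext fun x => ?_
  have h1 : w.1.1 (orbitSum w p x) = orbitSum w p x := by
    have h2 := congrArg w.1.1 (h x)
    rw [map_smul, map_smul, weyl_canonicalClass, ← h x] at h2
    exact smul_right_injective (H2 n) (show (9 - n : ℤ) ≠ 0 by omega) h2
  have h3 : w.1.1 (orbitSum w p x) + x = orbitSum w p x + (w ^ p).1.1 x := by
    rw [orbitSum, map_sum]
    simp only [← weyl_pow_succ_apply]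
    have := Finset.sum_range_succ (fun i => (w ^ i).1.1 x) p
    rw [Finset.sum_range_succ'] at this
    exact this
  rw [h1] at h3
  exact (add_left_cancel h3).symm

/-- The matrix of `w` in the basis `H, E_1, …, E_n` is `A`. -/
def HasMatrix {n : ℕ} (w : Weyl n) (A : Matrix (Fin (n + 1)) (Fin (n + 1)) ℤ) : Prop :=
  ∀ x, w.1.1 x = A.mulVec x

theorem HasMatrix.mul {n : ℕ} {v w : Weyl n} {A B : Matrix (Fin (n + 1)) (Fin (n + 1)) ℤ}
    (hv : HasMatrix v A) (hw : HasMatrix w B) : HasMatrix (v * w) (A * B) := fun x => by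
  rw [weyl_mul_apply, hw, hv, Matrix.mulVec_mulVec]

theorem HasMatrix.pow_add {n : ℕ} {w : Weyl n} {A B : Matrix (Fin (n + 1)) (Fin (n + 1)) ℤ}
    {i j k : ℕ} (hA : HasMatrix (w ^ i) A) (hB : HasMatrix (w ^ j) B) (hk : i + j = k)
    {C : Matrix (Fin (n + 1)) (Fin (n + 1)) ℤ} (hC : A * B = C) : HasMatrix (w ^ k) C := by
  rw [← hC, ← hk, _root_.pow_add]
  exact hA.mul hB

/-- The matrix of `x ↦ (x·K) K`. -/
def canonicalMatrix (n : ℕ) : Matrix (Fin (n + 1)) (Fin (n + 1)) ℤ :=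
  Matrix.of fun i j => (if i = 0 then -3 else 1) * (if j = 0 then -3 else -1)

theorem canonicalMatrix_mulVec {n : ℕ} (x : H2 n) :
    (canonicalMatrix n).mulVec x = form n x (canonicalClass n) • canonicalClass n := by
  funext i
  simp only [Matrix.mulVec, dotProduct, canonicalMatrix, Matrix.of_apply, mul_assoc,
    ← Finset.mul_sum, Pi.smul_apply, smul_eq_mul, form_canonicalClass, Fin.sum_univ_succ,
    Fin.succ_ne_zero, if_true, if_false, neg_mul, one_mul, Finset.sum_neg_distrib, canonicalClass]
  ring

theorem HasMatrix.smul_orbitSum_three {n : ℕ} {w : Weyl n}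
    {A : Matrix (Fin (n + 1)) (Fin (n + 1)) ℤ} (h : HasMatrix w A)
    (hA : (9 - n : ℤ) • (1 + A + A * A) = (3 : ℤ) • canonicalMatrix n) (x : H2 n) :
    (9 - n : ℤ) • orbitSum w 3 x =
      ((3 : ℕ) * form n x (canonicalClass n)) • canonicalClass n := by
  have h1 : orbitSum w 3 x = (1 + A + A * A).mulVec x := by
    simp only [orbitSum, Finset.sum_range_succ, Finset.sum_range_zero, zero_add,
      weyl_pow_succ_apply, pow_zero, weyl_one_apply, h _, Matrix.mulVec_mulVec, Matrix.add_mulVec,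
      Matrix.one_mulVec]
  rw [h1, ← Matrix.smul_mulVec, hA, Matrix.smul_mulVec, canonicalMatrix_mulVec, mul_smul]
  rfl

theorem HasMatrix.smul_orbitSum_five {n : ℕ} {w : Weyl n}
    {A B : Matrix (Fin (n + 1)) (Fin (n + 1)) ℤ} (h : HasMatrix w A) (hB : A * A = B)
    (hA : (9 - n : ℤ) • (1 + A + B + A * B + B * B) = (5 : ℤ) • canonicalMatrix n) (x : H2 n) :
    (9 - n : ℤ) • orbitSum w 5 x =
      ((5 : ℕ) * form n x (canonicalClass n)) • canonicalClass n := by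
  have h1 : orbitSum w 5 x = (1 + A + B + A * B + B * B).mulVec x := by
    simp only [← hB, orbitSum, Finset.sum_range_succ, Finset.sum_range_zero, zero_add,
      weyl_pow_succ_apply, pow_zero, weyl_one_apply, h _, Matrix.mulVec_mulVec, Matrix.add_mulVec,
      Matrix.one_mulVec, Matrix.mul_assoc]
  rw [h1, ← Matrix.smul_mulVec, hA, Matrix.smul_mulVec, canonicalMatrix_mulVec, mul_smul]
  rfl

theorem mem_oddPrimeIrreducibles_of_smul_orbitSum {n : ℕ} (hn : 3 ≤ n) (hn8 : n ≤ 8) {w : Weyl n}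
    {p : ℕ} (hp : p.Prime) (hodd : Odd p)
    (h : ∀ x, (9 - n : ℤ) • orbitSum w p x = (p * form n x (canonicalClass n)) • canonicalClass n) :
    w ∈ oddPrimeIrreducibles n ∧ orderOf w = p := by
  have he := IsElliptic.of_smul_orbitSum (by omega) hn8 hp.ne_zero h
  have : Fact p.Prime := ⟨hp⟩
  have ho : orderOf w = p := orderOf_eq_prime (pow_eq_one_of_smul_orbitSum hn8 h) fun h1 =>
    he.apply_ne hn8 (isExc_exc ⟨0, by omega⟩) (by rw [h1, weyl_one_apply])
  exact ⟨(mem_oddPrimeIrreducibles_iff hn hn8).2 ⟨ho.symm ▸ hp, ho.symm ▸ hodd, he⟩, ho⟩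

theorem simpleReflection_apply {n : ℕ} (hn : 3 ≤ n) (i : Fin n) (x : H2 n) :
    (simpleReflection hn i).1.1 x = x + form n x (simpleRoot n i) • simpleRoot n i :=
  reflection_apply _ (form_simpleRoot_self hn i) x

theorem simpleReflection_apply_of_ne_zero {n : ℕ} (hn : 3 ≤ n) {i : Fin n} (hi : i.val ≠ 0)
    (x : H2 n) (j : Fin (n + 1)) :
    (simpleReflection hn i).1.1 x j = x (Equiv.swap i.castSucc i.succ j) := by
  have hlt := i.isLt
  rw [simpleReflection_apply, simpleRoot, if_neg hi, map_sub, form_basisVec n _ (by omega),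
    form_basisVec n _ (by omega), if_neg hi, if_neg (Nat.succ_ne_zero _)]
  change x j + (-1 * x i.castSucc - -1 * x i.succ) *
    ((if j.val = i.val then 1 else 0) - (if j.val = i.val + 1 then 1 else 0)) = _
  rcases eq_or_ne j i.castSucc with rfl | h1
  · rw [Equiv.swap_apply_left]
    simp
  · rcases eq_or_ne j i.succ with rfl | h2
    · rw [Equiv.swap_apply_right]
      simp
    · rw [Equiv.swap_apply_of_ne_of_ne h1 h2, if_neg (show ¬ j.val = i.val from fun h => h1 (Fin.ext h)),
        if_neg (show ¬ j.val = i.val + 1 from fun h => h2 (Fin.ext h))]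
      ring

theorem simpleReflection_apply_of_eq_zero {n : ℕ} (hn : 3 ≤ n) {i : Fin n} (hi : i.val = 0)
    (x : H2 n) (j : Fin (n + 1)) :
    (simpleReflection hn i).1.1 x j = x j + (x 0 + x ⟨1, by omega⟩ + x ⟨2, by omega⟩ +
      x ⟨3, by omega⟩) * (if j.val = 0 then 1 else if j.val ≤ 3 then -1 else 0) := by
  rw [simpleReflection_apply, simpleRoot, if_pos hi]
  simp only [map_sub, form_basisVec n 0 (by omega), form_basisVec n 1 (by omega),
    form_basisVec n 2 (by omega), form_basisVec n 3 (by omega), Pi.add_apply, Pi.smul_apply,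
    Pi.sub_apply, smul_eq_mul, basisVec]
  have h0 : (⟨0, by omega⟩ : Fin (n + 1)) = 0 := rfl
  obtain h | h | h | h | h : j.val = 0 ∨ j.val = 1 ∨ j.val = 2 ∨ j.val = 3 ∨ 3 < j.val := by omega
  · simp [h]
  · simp [h]
  · simp [h]
  · simp [h]
  · have h1 : j.val ≠ 0 ∧ j.val ≠ 1 ∧ j.val ≠ 2 ∧ j.val ≠ 3 ∧ ¬ j.val ≤ 3 := by omega
    simp [h1]

theorem hasMatrix_standardCoxeter_four :
    HasMatrix (standardCoxeter (n := 4) (by norm_num)) !![2, 1, 1, 0, 1;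
    -1, -1, -1, 0, 0;
    -1, 0, -1, 0, -1;
    -1, -1, 0, 0, -1;
    0, 0, 0, 1, 0] := by
  intro x
  simp only [standardCoxeter, List.ofFn_succ, List.ofFn_zero, List.prod_cons, List.prod_nil,
    weyl_mul_apply, weyl_one_apply]
  funext j
  rw [simpleReflection_apply_of_eq_zero _ rfl]
  simp only [simpleReflection_apply_of_ne_zero, Fin.val_succ, ne_eq, Nat.succ_ne_zero,
    not_false_eq_true]
  fin_cases j <;>
  simp [Equiv.swap_apply_def, Fin.ext_iff, Matrix.mulVec, dotProduct, Fin.sum_univ_succ]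
  all_goals ring

theorem hasMatrix_standardCoxeter_six :
    HasMatrix (standardCoxeter (n := 6) (by norm_num)) !![2, 1, 1, 0, 0, 0, 1;
    -1, -1, -1, 0, 0, 0, 0;
    -1, 0, -1, 0, 0, 0, -1;
    -1, -1, 0, 0, 0, 0, -1;
    0, 0, 0, 1, 0, 0, 0;
    0, 0, 0, 0, 1, 0, 0;
    0, 0, 0, 0, 0, 1, 0] := by
  intro x
  simp only [standardCoxeter, List.ofFn_succ, List.ofFn_zero, List.prod_cons, List.prod_nil,
    weyl_mul_apply, weyl_one_apply]
  funext j
  rw [simpleReflection_apply_of_eq_zero _ rfl]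
  simp only [simpleReflection_apply_of_ne_zero, Fin.val_succ, ne_eq, Nat.succ_ne_zero,
    not_false_eq_true]
  fin_cases j <;>
  simp [Equiv.swap_apply_def, Fin.ext_iff, Matrix.mulVec, dotProduct, Fin.sum_univ_succ]
  all_goals ring

theorem hasMatrix_standardCoxeter_eight :
    HasMatrix (standardCoxeter (n := 8) (by norm_num)) !![2, 1, 1, 0, 0, 0, 0, 0, 1;
    -1, -1, -1, 0, 0, 0, 0, 0, 0;
    -1, 0, -1, 0, 0, 0, 0, 0, -1;
    -1, -1, 0, 0, 0, 0, 0, 0, -1;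
    0, 0, 0, 1, 0, 0, 0, 0, 0;
    0, 0, 0, 0, 1, 0, 0, 0, 0;
    0, 0, 0, 0, 0, 1, 0, 0, 0;
    0, 0, 0, 0, 0, 0, 1, 0, 0;
    0, 0, 0, 0, 0, 0, 0, 1, 0] := by
  intro x
  simp only [standardCoxeter, List.ofFn_succ, List.ofFn_zero, List.prod_cons, List.prod_nil,
    weyl_mul_apply, weyl_one_apply]
  funext j
  rw [simpleReflection_apply_of_eq_zero _ rfl]
  simp only [simpleReflection_apply_of_ne_zero, Fin.val_succ, ne_eq, Nat.succ_ne_zero,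
    not_false_eq_true]
  fin_cases j <;>
  simp [Equiv.swap_apply_def, Fin.ext_iff, Matrix.mulVec, dotProduct, Fin.sum_univ_succ]
  all_goals ring

theorem standardCoxeter_four_mem :
    standardCoxeter (n := 4) (by norm_num) ∈ oddPrimeIrreducibles 4 :=
  (mem_oddPrimeIrreducibles_of_smul_orbitSum (by norm_num) (by norm_num) Nat.prime_five (by decide)
    (hasMatrix_standardCoxeter_four.smul_orbitSum_five (B := !![2, 1, 0, 1, 1;
    0, 0, 1, 0, 0;
    -1, -1, 0, -1, 0;
    -1, 0, 0, -1, -1;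
    -1, -1, 0, 0, -1])
      (by decide +kernel) (by decide +kernel))).1

theorem standardCoxeter_six_mem :
    standardCoxeter (n := 6) (by norm_num) ^ 4 ∈ oddPrimeIrreducibles 6 := by
  have h1 := hasMatrix_standardCoxeter_six
  rw [← pow_one (standardCoxeter _)] at h1
  have h2 := h1.pow_add h1 (k := 2) rfl (C := !![2, 1, 0, 0, 0, 1, 1;
    0, 0, 1, 0, 0, 0, 0;
    -1, -1, 0, 0, 0, -1, 0;
    -1, 0, 0, 0, 0, -1, -1;
    -1, -1, 0, 0, 0, 0, -1;
    0, 0, 0, 1, 0, 0, 0;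
    0, 0, 0, 0, 1, 0, 0]) (by decide +kernel)
  -- The Coxeter number of E_6 is 12, so the fourth power has order 3.
  have h4 := h2.pow_add h2 (k := 4) rfl (C := !![4, 2, 1, 1, 1, 2, 2;
    -1, -1, 0, 0, 0, -1, 0;
    -2, -1, -1, -1, 0, -1, -1;
    -2, -1, 0, -1, -1, -1, -1;
    -2, -1, -1, 0, -1, -1, -1;
    -1, 0, 0, 0, 0, -1, -1;
    -1, -1, 0, 0, 0, 0, -1]) (by decide +kernel)
  exact (mem_oddPrimeIrreducibles_of_smul_orbitSum (by norm_num) (by norm_num) Nat.prime_three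
    (by decide) (h4.smul_orbitSum_three (by decide +kernel))).1

theorem standardCoxeter_eight_mem :
    (standardCoxeter (n := 8) (by norm_num) ^ 10 ∈ oddPrimeIrreducibles 8 ∧
      orderOf (standardCoxeter (n := 8) (by norm_num) ^ 10) = 3) ∧
    (standardCoxeter (n := 8) (by norm_num) ^ 6 ∈ oddPrimeIrreducibles 8 ∧
      orderOf (standardCoxeter (n := 8) (by norm_num) ^ 6) = 5) := by
  have h1 := hasMatrix_standardCoxeter_eight
  rw [← pow_one (standardCoxeter _)] at h1
  have h2 := h1.pow_add h1 (k := 2) rfl (C := !![2, 1, 0, 0, 0, 0, 0, 1, 1;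
    0, 0, 1, 0, 0, 0, 0, 0, 0;
    -1, -1, 0, 0, 0, 0, 0, -1, 0;
    -1, 0, 0, 0, 0, 0, 0, -1, -1;
    -1, -1, 0, 0, 0, 0, 0, 0, -1;
    0, 0, 0, 1, 0, 0, 0, 0, 0;
    0, 0, 0, 0, 1, 0, 0, 0, 0;
    0, 0, 0, 0, 0, 1, 0, 0, 0;
    0, 0, 0, 0, 0, 0, 1, 0, 0]) (by decide +kernel)
  have h4 := h2.pow_add h2 (k := 4) rfl (C := !![4, 2, 1, 0, 0, 1, 1, 2, 2;
    -1, -1, 0, 0, 0, 0, 0, -1, 0;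
    -2, -1, -1, 0, 0, -1, 0, -1, -1;
    -2, -1, 0, 0, 0, -1, -1, -1, -1;
    -2, -1, -1, 0, 0, 0, -1, -1, -1;
    -1, 0, 0, 0, 0, 0, 0, -1, -1;
    -1, -1, 0, 0, 0, 0, 0, 0, -1;
    0, 0, 0, 1, 0, 0, 0, 0, 0;
    0, 0, 0, 0, 1, 0, 0, 0, 0]) (by decide +kernel)
  -- The Coxeter number of E_8 is 30, so the sixth and tenth powers have orders 5 and 3.
  have h6 := h4.pow_add h2 (k := 6) rfl (C := !![7, 3, 2, 1, 1, 2, 2, 3, 4;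
    -2, -1, -1, 0, 0, -1, 0, -1, -1;
    -3, -1, -1, -1, 0, -1, -1, -1, -2;
    -4, -2, -1, -1, -1, -1, -1, -2, -2;
    -3, -1, -1, 0, -1, -1, -1, -1, -2;
    -2, -1, 0, 0, 0, -1, -1, -1, -1;
    -2, -1, -1, 0, 0, 0, -1, -1, -1;
    -1, 0, 0, 0, 0, 0, 0, -1, -1;
    -1, -1, 0, 0, 0, 0, 0, 0, -1]) (by decide +kernel)
  have h10 := h6.pow_add h4 (k := 10) rfl (C := !![13, 5, 4, 3, 4, 4, 5, 5, 6;
    -4, -2, -1, -1, -1, -1, -2, -1, -2;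
    -5, -2, -2, -1, -2, -1, -2, -2, -2;
    -6, -2, -2, -2, -2, -2, -2, -2, -3;
    -5, -2, -1, -1, -2, -2, -2, -2, -2;
    -5, -2, -2, -1, -1, -2, -2, -2, -2;
    -4, -1, -1, -1, -1, -1, -2, -2, -2;
    -4, -2, -1, -1, -1, -1, -1, -2, -2;
    -3, -1, -1, 0, -1, -1, -1, -1, -2]) (by decide +kernel)
  exact ⟨mem_oddPrimeIrreducibles_of_smul_orbitSum (by norm_num) (by norm_num) Nat.prime_three
    (by decide) (h10.smul_orbitSum_three (by decide +kernel)),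
    mem_oddPrimeIrreducibles_of_smul_orbitSum (by norm_num) (by norm_num) Nat.prime_five
    (by decide) (h6.smul_orbitSum_five (B := !![15, 5, 5, 4, 5, 5, 6, 6, 6;
    -5, -2, -2, -1, -2, -1, -2, -2, -2;
    -5, -1, -2, -1, -2, -2, -2, -2, -2;
    -6, -2, -2, -2, -2, -2, -3, -2, -2;
    -6, -2, -2, -2, -2, -2, -2, -3, -2;
    -6, -2, -2, -2, -2, -2, -2, -2, -3;
    -5, -2, -1, -1, -2, -2, -2, -2, -2;
    -5, -2, -2, -1, -1, -2, -2, -2, -2;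
    -4, -1, -1, -1, -1, -1, -2, -2, -2]) (by decide +kernel) (by decide +kernel))⟩


/-! ### Assembling the classification -/

theorem oddPrimeIrreducibles_eq_empty {n : ℕ} (hn : 3 ≤ n) (hn8 : n ≤ 8) (hodd : Odd n) :
    oddPrimeIrreducibles n = ∅ := by
  refine Set.eq_empty_of_forall_notMem fun w hw => ?_
  obtain ⟨-, ho, he⟩ := (mem_oddPrimeIrreducibles_iff hn hn8).1 hw
  obtain ⟨a, ha⟩ := he.dvd (by omega) (pow_orderOf_eq_one w)
  obtain ⟨k, hk⟩ := ho
  obtain ⟨m, rfl⟩ := hodd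
  rw [hk] at ha
  have h2 := congrArg (fun z : ℤ => z % 2) (show (2 * k + 1 : ℤ) = 2 * ((4 - m) * a) by
    push_cast at ha; linarith)
  beta_reduce at h2
  omega

/-- When 9 - n is itself a prime q, its divisibility into the prime order forces the order to be q.
-/
theorem prime_eq_of_dvd {n q : ℕ} (hn : 3 ≤ n) (hn8 : n ≤ 8) (hq : q.Prime) (hnq : n + q = 9)
    {w : Weyl n} (hw : w ∈ oddPrimeIrreducibles n) : IsElliptic w ∧ w ^ q = 1 := by
  obtain ⟨hp, -, he⟩ := (mem_oddPrimeIrreducibles_iff hn hn8).1 hw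
  have h := he.dvd (by omega) (pow_orderOf_eq_one w)
  rw [show (9 - n : ℤ) = (q : ℕ) by omega, Int.natCast_dvd_natCast,
    Nat.prime_dvd_prime_iff_eq hq hp] at h
  exact ⟨he, h ▸ pow_orderOf_eq_one w⟩

theorem oddPrimeIrreducibleClasses_eq_singleton {n : ℕ} {g : Weyl n}
    (hg : g ∈ oddPrimeIrreducibles n) (h : ∀ w ∈ oddPrimeIrreducibles n, IsConj w g) :
    oddPrimeIrreducibleClasses n = {ConjClasses.mk g} := by
  refine Set.Subset.antisymm ?_ (Set.singleton_subset_iff.2 ⟨g, hg, rfl⟩)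
  rintro _ ⟨w, hw, rfl⟩
  exact ConjClasses.mk_eq_mk_iff_isConj.2 (h w hw)

theorem IsCoxeterElement.mk_pow {n : ℕ} {hn : 3 ≤ n} {c : Weyl n} (hc : IsCoxeterElement hn c)
    (k : ℕ) : ConjClasses.mk (c ^ k) = ConjClasses.mk (standardCoxeter hn ^ k) :=
  ConjClasses.mk_eq_mk_iff_isConj.2 (hc.isConj.pow k)

theorem oddPrimeIrreducibleClasses_four :
    oddPrimeIrreducibleClasses 4 = {ConjClasses.mk (standardCoxeter (by norm_num))} := by
  have h := fun w => prime_eq_of_dvd (n := 4) (w := w) (by norm_num) (by norm_num)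
    Nat.prime_five rfl
  have hc := standardCoxeter_four_mem
  exact oddPrimeIrreducibleClasses_eq_singleton hc fun w hw =>
    isConj_four (h w hw).1 (h w hw).2 (h _ hc).1 (h _ hc).2

theorem oddPrimeIrreducibleClasses_six :
    oddPrimeIrreducibleClasses 6 = {ConjClasses.mk (standardCoxeter (by norm_num) ^ 4)} := by
  have h := fun w => prime_eq_of_dvd (n := 6) (w := w) (by norm_num) (by norm_num)
    Nat.prime_three rfl
  have hc := standardCoxeter_six_mem
  exact oddPrimeIrreducibleClasses_eq_singleton hc fun w hw =>
    isConj_six (h w hw).1 (h w hw).2 (h _ hc).1 (h _ hc).2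

theorem oddPrimeIrreducibleClasses_eight :
    oddPrimeIrreducibleClasses 8 = {ConjClasses.mk (standardCoxeter (by norm_num) ^ 10),
      ConjClasses.mk (standardCoxeter (by norm_num) ^ 6)} := by
  obtain ⟨⟨h3, o3⟩, h5, o5⟩ := standardCoxeter_eight_mem
  have he := fun w => (mem_oddPrimeIrreducibles_iff (n := 8) (w := w) (by norm_num)
    (by norm_num)).1
  refine Set.Subset.antisymm ?_ (Set.insert_subset ⟨_, h3, rfl⟩
    (Set.singleton_subset_iff.2 ⟨_, h5, rfl⟩))
  rintro _ ⟨w, hw, rfl⟩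
  obtain ⟨hp, ho, hw⟩ := he w hw
  have h := pow_orderOf_eq_one w
  rcases hw.eq_three_or_five hp ho h with hp | hp <;> rw [hp] at h
  · exact Or.inl (ConjClasses.mk_eq_mk_iff_isConj.2
      (isConj_eight_three hw h (he _ h3).2.2 (orderOf_dvd_iff_pow_eq_one.1 o3.dvd)))
  · exact Or.inr (ConjClasses.mk_eq_mk_iff_isConj.2
      (isConj_eight_five hw h (he _ h5).2.2 (orderOf_dvd_iff_pow_eq_one.1 o5.dvd)))

theorem ncard_oddPrimeIrreducibleClasses_eight : (oddPrimeIrreducibleClasses 8).ncard = 2 := by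
  rw [oddPrimeIrreducibleClasses_eight]
  refine Set.ncard_pair fun h => ?_
  obtain ⟨⟨-, o3⟩, -, o5⟩ := standardCoxeter_eight_mem
  -- Conjugacy of the two representatives would make the order 5 divide 3.
  have h1 := IsConj.pow_eq_one (ConjClasses.mk_eq_mk_iff_isConj.1 h)
    (orderOf_dvd_iff_pow_eq_one.1 o3.dvd)
  have h2 := orderOf_dvd_of_pow_eq_one h1
  rw [o5] at h2
  norm_num at h2

end DelPezzo

theorem theorem6p5 :
    (∀ n : ℕ, n = 3 ∨ n = 5 ∨ n = 7 → DelPezzo.oddPrimeIrreducibles n = ∅) ∧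
    ((DelPezzo.oddPrimeIrreducibleClasses 4).ncard = 1 ∧
      ∀ c : DelPezzo.Weyl 4, DelPezzo.IsCoxeterElement (by norm_num) c →
        ConjClasses.mk c ∈ DelPezzo.oddPrimeIrreducibleClasses 4) ∧
    ((DelPezzo.oddPrimeIrreducibleClasses 6).ncard = 1 ∧
      ∀ c : DelPezzo.Weyl 6, DelPezzo.IsCoxeterElement (by norm_num) c →
        ConjClasses.mk (c ^ 4) ∈ DelPezzo.oddPrimeIrreducibleClasses 6) ∧
    ((DelPezzo.oddPrimeIrreducibleClasses 8).ncard = 2 ∧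
      ∀ c : DelPezzo.Weyl 8, DelPezzo.IsCoxeterElement (by norm_num) c →
        ∀ C ∈ DelPezzo.oddPrimeIrreducibleClasses 8, ∃ k : ℕ, C = ConjClasses.mk (c ^ k)) := by
  refine ⟨?_, ⟨?_, fun c hc => ?_⟩, ⟨?_, fun c hc => ?_⟩,
    DelPezzo.ncard_oddPrimeIrreducibleClasses_eight, fun c hc C hC => ?_⟩
  · rintro n (rfl | rfl | rfl) <;>
      exact DelPezzo.oddPrimeIrreducibles_eq_empty (by norm_num) (by norm_num) (by decide)
  · rw [DelPezzo.oddPrimeIrreducibleClasses_four, Set.ncard_singleton]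
  · rw [DelPezzo.oddPrimeIrreducibleClasses_four]
    exact ConjClasses.mk_eq_mk_iff_isConj.2 hc.isConj
  · rw [DelPezzo.oddPrimeIrreducibleClasses_six, Set.ncard_singleton]
  · rw [DelPezzo.oddPrimeIrreducibleClasses_six]
    exact hc.mk_pow 4
  · rw [DelPezzo.oddPrimeIrreducibleClasses_eight] at hC
    rcases hC with rfl | rfl
    · exact ⟨10, (hc.mk_pow 10).symm⟩
    · exact ⟨6, (hc.mk_pow 6).symm⟩
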